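/- Let $M$ be a smooth $2$-dimensional manifold, $\pi:TM\to M$ its tangent bundle with induced coordinates $(x^i,y^i)$, $T_0M=TM\setminus\{0\}$, $J=\frac{\partial}{\partial y^i}\otimes dx^i$ the tangent structure and $\mathcal C=y^i\frac{\partial}{\partial y^i}$ the Liouville vector field. Let $A\subset T_0M$ be an open cone (an open set with $(x,\lambda y)\in A$ for all $(x,y)\in A$, $\lambda>0$; for instance $A=T_0M$), and let $S$ be a spray on $A$, i.e. a smooth vector field on $A$ with $JS=\mathcal C$ and $[\mathcal C,S]=S$. Put $h=\frac12(\mathrm{Id}+[J,S])$, $v=\frac12(\mathrm{Id}-[J,S])$, $\mathbb F=h\circ[S,h]-J$ and $\Phi=v\circ[S,h]$ (Frölicher–Nijenhuis brackets), and assume that $S$ is non-flat: $\Phi$ vanishes nowhere on $A$. Let $\mathcal D=\operatorname{Im}h\oplus\operatorname{Im}\Phi$ be the Berwald distribution. Since $\dim M=2$, there are a unique smooth function $\rho$ and a unique smooth semi-basic $1$-form $\alpha$ on $A$ with $\Phi=\rho J-\alpha\otimes\mathcal C$. The spray $S$ is called degenerate if $\rho$ vanishes nowhere on $A$ and the $2$-form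 $$\Omega=d\Big(\frac{\alpha}{\rho}\Big)+2\,i_{\mathbb F}\frac{\alpha}{\rho}\wedge\frac{\alpha}{\rho}$$ has rank $2$ at every point of $A$. A degenerate Finsler function on an open cone $U\subset T_0M$ is a smooth function $F:U\to(0,\infty)$ with $F(x,\lambda y)=\lambda F(x,y)$ for $\lambda>0$ whose metric tensor $g_{ij}=\frac12\frac{\partial^2F^2}{\partial y^i\partial y^j}$ has rank $1$ at every point of $U$; it metrizes $S$ on $U$ if $i_Sdd_JF^2=-dF^2$ on $U$. The following conditions are equivalent: (i) $S$ is locally metrizable by a degenerate Finsler function: every point of $A$ has an open conic neighbourhood $U\subset A$ on which some degenerate Finsler function metrizes $S$; (ii) $S$ is degenerate and the Berwald distribution $\mathcal D$ is integrable (through every point of $A$ passes a $3$-dimensional immersed submanifold of $A$ whose tangent spaces are the spaces of $\mathcal D$); (iii) there is a closed $1$-form $\omega$ on $A$ that annihilates $\mathcal D$, is normalised by $i_{\mathcal C}\omega=1$, and satisfies $\operatorname{rank}\left(d_J\omega+2\,\omega\wedge i_J\omega\right)=2$ at every point of $A$. Moreover, if every closed $1$-form on $A$ is exact, then (ii) and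 (iii) are also equivalent to the existence of a degenerate Finsler function defined on all of $A$ that metrizes $S$ on $A$. -/

import Mathlib

open scoped Manifold ContDiff

namespace SprayGeometry

open VectorField Bundle FiberBundle

noncomputable section

/-! ## Tensor calculus on a smooth manifold `N` -/

section General

variable {E : Type*} [NormedAddCommGroup E] [NormedSpace ℝ E] [FiniteDimensional ℝ E]
  {H : Type*} [TopologicalSpace H] (I : ModelWithCorners ℝ E H)
  {N : Type*} [TopologicalSpace N] [ChartedSpace H N] [IsManifold I 2 N]

/-- Vector fields `X` on `N`. -/
abbrev VField : Type _ := Π p : N, TangentSpace I p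

/-- Differential `1`-forms on `N`. -/
abbrev OneForm : Type _ := Π p : N, TangentSpace I p →L[ℝ] ℝ

/-- Differential `2`-forms on `N`: a bilinear form on each tangent space (all those built below
are alternating). -/
abbrev TwoForm : Type _ := Π p : N, LinearMap.BilinForm ℝ (TangentSpace I p)

/-- Vector valued `1`-forms, i.e. fields of endomorphisms of the tangent spaces of `N`. -/
abbrev EndField : Type _ := Π p : N, TangentSpace I p →L[ℝ] TangentSpace I p

variable {I}

/-- The vector field `X` is smooth on the set `A`. -/
def SmoothVField (A : Set N) (X : VField I (N := N)) : Prop :=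
  ContMDiffOn I I.tangent ∞ (fun p => (⟨p, X p⟩ : TangentBundle I N)) A

/-- The `1`-form `η` is smooth on the set `A`. -/
def SmoothOneForm (A : Set N) (η : OneForm I (N := N)) : Prop :=
  ContMDiffOn I (I.prod 𝓘(ℝ, E →L[ℝ] ℝ)) ∞
    (fun p => TotalSpace.mk' (E →L[ℝ] ℝ)
      (E := fun p : N => TangentSpace I p →L[ℝ] Bundle.Trivial N ℝ p) p (η p)) A

/-- The expression `[S, K X] - K [S, X]` at `p`. -/
def lieExpr (S : VField I (N := N)) (K : EndField I (N := N)) (p : N) (X : VField I (N := N)) :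
    TangentSpace I p :=
  mlieBracket I S (fun q => K q (X q)) p - K p (mlieBracket I S X p)

open Classical in
/-- The Lie derivative `ℒ_S K = [S, K]` (Frölicher–Nijenhuis bracket) of a field of endomorphisms:
the field of endomorphisms with `(ℒ_S K) X = [S, K X] - K [S, X]` for all vector fields `X`. -/
def lieDerivEnd (S : VField I (N := N)) (K : EndField I (N := N)) : EndField I (N := N) :=
  fun p =>
    if h : TensorialAt I E (lieExpr S K p) p then TensorialAt.mkHom (lieExpr S K p) p h else 0

/-- The expression `X (η Y) - Y (η X) - η [X, Y]` at `p`. -/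
def extExpr (η : OneForm I (N := N)) (p : N) (X Y : VField I (N := N)) : ℝ :=
  mvfderiv I (fun q => η q (Y q)) p (X p) - mvfderiv I (fun q => η q (X q)) p (Y p)
    - η p (mlieBracket I X Y p)

open Classical in
/-- The exterior derivative of a `1`-form: the `2`-form with
`dη (X, Y) = X (η Y) - Y (η X) - η [X, Y]` for all vector fields `X`, `Y`. -/
def extDer (η : OneForm I (N := N)) : TwoForm I (N := N) := fun p =>
  if h : (∀ Y : VField I (N := N), MDiffAt (T% Y) p → TensorialAt I E (extExpr η p · Y) p) ∧
      (∀ X : VField I (N := N), MDiffAt (T% X) p → TensorialAt I E (extExpr η p X) p) then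
    (ContinuousLinearMap.coeLM ℝ).comp
      (TensorialAt.mkHom₂ (extExpr η p) p h.1 h.2).toLinearMap
  else 0

/-- For a vector field and a field of endomorphisms that are smooth enough, the Lie derivative is
given by the bracket formula. -/
theorem lieDerivEnd_apply {S : VField I (N := N)} {K : EndField I (N := N)} {p : N}
    (hK : ∀ X : VField I (N := N), MDiffAt (T% X) p → MDiffAt (T% (fun q => K q (X q))) p)
    {X : VField I (N := N)} (hX : MDiffAt (T% X) p) :
    lieDerivEnd S K p (X p) =
      mlieBracket I S (fun q => K q (X q)) p - K p (mlieBracket I S X p) := by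
  have h : TensorialAt I E (lieExpr S K p) p := by
    refine ⟨fun {f σ} hf hσ => ?_, fun {σ σ'} hσ hσ' => ?_⟩
    · have e : (fun q => K q ((f • σ) q)) = f • (fun q => K q (σ q)) := by
        funext q; simp
      simp only [lieExpr, e, mlieBracket_smul_right hf (hK σ hσ), mlieBracket_smul_right hf hσ,
        map_add, map_smul]
      module
    · have e : (fun q => K q ((σ + σ') q)) = (fun q => K q (σ q)) + (fun q => K q (σ' q)) := by
        funext q; simp
      simp only [lieExpr, e, mlieBracket_add_right (hK σ hσ) (hK σ' hσ'),
        mlieBracket_add_right hσ hσ', map_add]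
      module
  rw [lieDerivEnd, dif_pos h, TensorialAt.mkHom_apply h hX]
  rfl

/-- For a `1`-form that is smooth enough, the exterior derivative is given by Cartan's formula. -/
theorem extDer_apply {η : OneForm I (N := N)} {p : N}
    (hη : ∀ X : VField I (N := N), MDiffAt (T% X) p → MDiffAt (fun q => η q (X q)) p)
    {X Y : VField I (N := N)} (hX : MDiffAt (T% X) p) (hY : MDiffAt (T% Y) p) :
    extDer η p (X p) (Y p) =
      mvfderiv I (fun q => η q (Y q)) p (X p) - mvfderiv I (fun q => η q (X q)) p (Y p)
        - η p (mlieBracket I X Y p) := by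
  have h1 : ∀ Y : VField I (N := N), MDiffAt (T% Y) p → TensorialAt I E (extExpr η p · Y) p := by
    intro Y hY
    refine ⟨fun {f σ} hf hσ => ?_, fun {σ σ'} hσ hσ' => ?_⟩
    · have e : (fun q => η q ((f • σ) q)) = f • (fun q => η q (σ q)) := by
        funext q; simp
      simp only [extExpr, e, mlieBracket_smul_left hf hσ, mvfderiv_smul hf (hη σ hσ)]
      simp
      ring
    · have e : (fun q => η q ((σ + σ') q)) = (fun q => η q (σ q)) + (fun q => η q (σ' q)) := by
        funext q; simp
      simp only [extExpr, e, mlieBracket_add_left hσ hσ', mvfderiv_add (hη σ hσ) (hη σ' hσ')]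
      simp
      ring
  have h2 : ∀ X : VField I (N := N), MDiffAt (T% X) p → TensorialAt I E (extExpr η p X) p := by
    intro X hX
    have anti : ∀ Y, extExpr η p X Y = - extExpr η p Y X := by
      intro Y
      simp only [extExpr]
      rw [mlieBracket_swap_apply, map_neg]
      ring
    refine ⟨fun {f σ} hf hσ => ?_, fun {σ σ'} hσ hσ' => ?_⟩
    · rw [anti, anti, (h1 X hX).smul hf hσ, smul_neg]
    · rw [anti, anti, anti, (h1 X hX).add hσ hσ', neg_add]
  rw [extDer, dif_pos ⟨h1, h2⟩]
  exact TensorialAt.mkHom₂_apply h1 h2 hX hY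

/-- The function `f` as a `1`-form `df`. -/
def differential (f : N → ℝ) : OneForm I (N := N) := fun p => mvfderiv I f p

/-- `i_K η = η ∘ K` for a `1`-form `η` and a field of endomorphisms `K`. -/
def insertEnd (K : EndField I (N := N)) (η : OneForm I (N := N)) : OneForm I (N := N) :=
  fun p => (η p).comp (K p)

/-- `(i_K θ) (X, Y) = θ (K X, Y) + θ (X, K Y)` for a `2`-form `θ`. -/
def insertEnd₂ (K : EndField I (N := N)) (θ : TwoForm I (N := N)) : TwoForm I (N := N) :=
  fun p => (θ p).compl₁₂ (K p).toLinearMap LinearMap.id +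
    (θ p).compl₁₂ LinearMap.id (K p).toLinearMap

/-- `d_K η = i_K dη - d i_K η` for a `1`-form `η` and a field of endomorphisms `K`. -/
def dEnd (K : EndField I (N := N)) (η : OneForm I (N := N)) : TwoForm I (N := N) :=
  insertEnd₂ K (extDer η) - extDer (insertEnd K η)

/-- `(η ∧ ζ) (X, Y) = η X ζ Y - η Y ζ X`. -/
def wedge (η ζ : OneForm I (N := N)) : TwoForm I (N := N) := fun p =>
  LinearMap.BilinForm.linMulLin (η p).toLinearMap (ζ p).toLinearMap -
    LinearMap.BilinForm.linMulLin (ζ p).toLinearMap (η p).toLinearMap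

/-- The rank of a `2`-form at a point. -/
def rankAt (θ : TwoForm I (N := N)) (p : N) : ℕ :=
  Module.finrank ℝ (LinearMap.range (θ p))

/-- The smooth `1`-form `η` is closed on `A`. -/
def ClosedOn (A : Set N) (η : OneForm I (N := N)) : Prop :=
  SmoothOneForm A η ∧ ∀ p ∈ A, extDer η p = 0

/-- Every closed `1`-form on `A` is exact, i.e. the first de Rham cohomology of the open set `A`
vanishes. -/
def ClosedFormsExact (I : ModelWithCorners ℝ E H) (A : Set N) [IsManifold I 2 N] : Prop :=
  ∀ η : OneForm I (N := N), ClosedOn A η →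
    ∃ f : N → ℝ, ContMDiffOn I 𝓘(ℝ, ℝ) ∞ f A ∧ ∀ p ∈ A, η p = differential f p

/-- A `k`-dimensional distribution `D` on the open set `A` is integrable: through every point of
`A` passes an immersed `k`-dimensional submanifold (parametrized by an open neighbourhood of the
origin of `ℝ^k`) that is everywhere tangent to `D`, with tangent spaces equal to `D`. -/
def IntegrableDistribution (k : ℕ) (A : Set N) (D : Π p : N, Submodule ℝ (TangentSpace I p)) : Prop :=
  ∀ p ∈ A, ∃ (W : Set (EuclideanSpace ℝ (Fin k))) (ψ : EuclideanSpace ℝ (Fin k) → N),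
    IsOpen W ∧ 0 ∈ W ∧ ψ 0 = p ∧ ContMDiffOn (𝓡 k) I ∞ ψ W ∧
    ∀ u ∈ W, ψ u ∈ A ∧ Function.Injective (mfderiv (𝓡 k) I ψ u) ∧
      LinearMap.range (mfderiv (𝓡 k) I ψ u).toLinearMap = D (ψ u)

end General

/-! ## Sprays on a surface `M` -/

section Spray

variable {M : Type*} [TopologicalSpace M] [ChartedSpace (EuclideanSpace ℝ (Fin 2)) M]
  [IsManifold (𝓡 2) ∞ M]

variable (M) in
/-- The tangent bundle `TM` of the surface `M`; a point is a pair `(x, y)`, `y ∈ T_x M`. -/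
abbrev TM : Type _ := TangentBundle (𝓡 2) M

/-- The tangent space of the manifold `TM` at `p`. -/
abbrev TTM (p : TM M) : Type _ := TangentSpace (𝓡 2).tangent p

/-- The point `(x, c y)`, for `p = (x, y)`. -/
def dilate (c : ℝ) (p : TM M) : TM M := ⟨p.1, c • p.2⟩

/-- `A` is an open cone in `T₀M`, the tangent bundle with the zero section removed. -/
structure IsOpenCone (A : Set (TM M)) : Prop where
  isOpen : IsOpen A
  ne_zero : ∀ p ∈ A, p.2 ≠ 0
  dilate_mem : ∀ p ∈ A, ∀ c : ℝ, 0 < c → dilate c p ∈ A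

/-- The derivative `T_p TM → T_x M` of the projection `π : TM → M`. -/
def dproj (p : TM M) : TTM p →L[ℝ] TangentSpace (𝓡 2) p.1 :=
  mfderiv (𝓡 2).tangent (𝓡 2) (TotalSpace.proj : TM M → M) p

/-- The vertical lift `T_x M → T_p TM`, for `p = (x, y)`: the derivative at `y` of the inclusion
of the fibre `T_x M` into `TM`. -/
def vlift (p : TM M) : TangentSpace (𝓡 2) p.1 →L[ℝ] TTM p :=
  mfderiv 𝓘(ℝ, EuclideanSpace ℝ (Fin 2)) (𝓡 2).tangent
    (fun y : EuclideanSpace ℝ (Fin 2) => (⟨p.1, y⟩ : TM M)) p.2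

variable (M) in
/-- The tangent structure `J = ∂/∂yⁱ ⊗ dxⁱ`. -/
def tangentStr : EndField (𝓡 2).tangent (N := TM M) := fun p => (vlift p).comp (dproj p)

variable (M) in
/-- The Liouville vector field `𝒞 = yⁱ ∂/∂yⁱ`. -/
def liouville : VField (𝓡 2).tangent (N := TM M) := fun p => vlift p p.2

/-- `S` is a spray on the open cone `A`: `S` is smooth, `J S = 𝒞` and `[𝒞, S] = S`. -/
structure IsSpray (A : Set (TM M)) (S : VField (𝓡 2).tangent (N := TM M)) : Prop where
  smooth : SmoothVField A S
  second_order : ∀ p ∈ A, tangentStr M p (S p) = liouville M p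
  homogeneous : ∀ p ∈ A, mlieBracket (𝓡 2).tangent (liouville M) S p = S p

/-- The horizontal projector `h = (Id + [J, S]) / 2`, where `[J, S] = -[S, J] = -ℒ_S J`. -/
def hproj (S : VField (𝓡 2).tangent (N := TM M)) : EndField (𝓡 2).tangent (N := TM M) :=
  fun p => (1 / 2 : ℝ) •
    (ContinuousLinearMap.id ℝ (TTM p) - lieDerivEnd S (tangentStr M) p)

/-- The vertical projector `v = (Id - [J, S]) / 2`. -/
def vproj (S : VField (𝓡 2).tangent (N := TM M)) : EndField (𝓡 2).tangent (N := TM M) :=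
  fun p => (1 / 2 : ℝ) •
    (ContinuousLinearMap.id ℝ (TTM p) + lieDerivEnd S (tangentStr M) p)

/-- The almost complex structure `𝔽 = h ∘ [S, h] - J`. -/
def almostComplex (S : VField (𝓡 2).tangent (N := TM M)) : EndField (𝓡 2).tangent (N := TM M) :=
  fun p => (hproj S p).comp (lieDerivEnd S (hproj S) p) - tangentStr M p

/-- The Jacobi endomorphism `Φ = v ∘ [S, h]`. -/
def jacobi (S : VField (𝓡 2).tangent (N := TM M)) : EndField (𝓡 2).tangent (N := TM M) :=
  fun p => (vproj S p).comp (lieDerivEnd S (hproj S) p)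

/-- The spray `S` is non-flat on `A`: its Jacobi endomorphism vanishes nowhere on `A`. -/
def NonFlat (A : Set (TM M)) (S : VField (𝓡 2).tangent (N := TM M)) : Prop :=
  ∀ p ∈ A, jacobi S p ≠ 0

/-- The Berwald distribution `𝒟 = Im h ⊕ Im Φ`. -/
def berwald (S : VField (𝓡 2).tangent (N := TM M)) (p : TM M) : Submodule ℝ (TTM p) :=
  LinearMap.range (hproj S p).toLinearMap ⊔ LinearMap.range (jacobi S p).toLinearMap

/-- The smooth function `ρ` (the Ricci scalar) and the smooth semi-basic `1`-form `α` express that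
`S` is isotropic: `Φ = ρ J - α ⊗ 𝒞` on `A`. They are uniquely determined on `A` by this equation
(`M` is a surface). -/
structure IsotropyData (A : Set (TM M)) (S : VField (𝓡 2).tangent (N := TM M))
    (ρ : TM M → ℝ) (α : OneForm (𝓡 2).tangent (N := TM M)) : Prop where
  smooth_ricci : ContMDiffOn (𝓡 2).tangent 𝓘(ℝ, ℝ) ∞ ρ A
  smooth_form : SmoothOneForm A α
  semibasic : ∀ p ∈ A, ∀ w : TTM p, dproj p w = 0 → α p w = 0
  jacobi_eq : ∀ p ∈ A, ∀ w : TTM p,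
    jacobi S p w = ρ p • tangentStr M p w - α p w • liouville M p

/-- The `2`-form `Ω = d(α/ρ) + 2 i_𝔽(α/ρ) ∧ α/ρ`. -/
def omegaForm (S : VField (𝓡 2).tangent (N := TM M)) (ρ : TM M → ℝ)
    (α : OneForm (𝓡 2).tangent (N := TM M)) : TwoForm (𝓡 2).tangent (N := TM M) :=
  extDer (fun p => (ρ p)⁻¹ • α p) +
    2 • wedge (insertEnd (almostComplex S) (fun p => (ρ p)⁻¹ • α p)) (fun p => (ρ p)⁻¹ • α p)

/-- The spray `S` is degenerate on `A`: the `2`-form `Ω` is defined on `A` (i.e. the Ricci scalar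
vanishes nowhere) and has rank `2` everywhere on `A`. -/
def Degenerate (A : Set (TM M)) (S : VField (𝓡 2).tangent (N := TM M)) : Prop :=
  ∃ (ρ : TM M → ℝ) (α : OneForm (𝓡 2).tangent (N := TM M)),
    IsotropyData A S ρ α ∧ ∀ p ∈ A, ρ p ≠ 0 ∧ rankAt (omegaForm S ρ α) p = 2

/-- The metric tensor `g_{ij} = ½ ∂²F²/∂yⁱ∂yʲ` at `p = (x, y)`: half the second derivative at `y`
of `F²` restricted to the vector space `T_x M`. -/
def metricTensor (F : TM M → ℝ) (p : TM M) :
    EuclideanSpace ℝ (Fin 2) →L[ℝ] EuclideanSpace ℝ (Fin 2) →L[ℝ] ℝ :=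
  (1 / 2 : ℝ) • fderiv ℝ (fderiv ℝ
    (fun y : EuclideanSpace ℝ (Fin 2) => (F (⟨p.1, y⟩ : TM M)) ^ 2)) p.2

/-- `F` is a (conic) degenerate Finsler function on the open cone `U`. -/
structure IsDegenerateFinsler (U : Set (TM M)) (F : TM M → ℝ) : Prop where
  smooth : ContMDiffOn (𝓡 2).tangent 𝓘(ℝ, ℝ) ∞ F U
  pos : ∀ p ∈ U, 0 < F p
  homogeneous : ∀ p ∈ U, ∀ c : ℝ, 0 < c → F (dilate c p) = c * F p
  rank_eq_one : ∀ p ∈ U, Module.finrank ℝ (LinearMap.range (metricTensor F p).toLinearMap) = 1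

/-- The Euler–Lagrange equation `i_S d d_J F² = -dF²` on `U`, where `d_J F² = dF² ∘ J`. -/
def EulerLagrange (U : Set (TM M)) (S : VField (𝓡 2).tangent (N := TM M)) (F : TM M → ℝ) : Prop :=
  ∀ p ∈ U, ∀ w : TTM p,
    extDer (insertEnd (tangentStr M) (differential (fun q => F q ^ 2))) p (S p) w =
      -differential (I := (𝓡 2).tangent) (fun q => F q ^ 2) p w

/-- `S` is metrizable on the cone `U` by a degenerate Finsler function defined on all of `U`. -/
def DegMetrizableOn (U : Set (TM M)) (S : VField (𝓡 2).tangent (N := TM M)) : Prop :=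
  ∃ F : TM M → ℝ, IsDegenerateFinsler U F ∧ EulerLagrange U S F

/-- `S` is locally metrizable on `A` by degenerate Finsler functions: every point of `A` has an
open conic neighbourhood on which `S` is metrizable by a degenerate Finsler function. -/
def LocallyDegMetrizable (A : Set (TM M)) (S : VField (𝓡 2).tangent (N := TM M)) : Prop :=
  ∀ p ∈ A, ∃ U : Set (TM M), IsOpenCone U ∧ p ∈ U ∧ U ⊆ A ∧ DegMetrizableOn U S

/-- There is a closed `1`-form `η` on `A` in the annihilator of the Berwald distribution,
normalised by `i_𝒞 η = 1`, such that `d_J η + 2 η ∧ i_J η` has rank `2` everywhere on `A`. -/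
def HasClosedAnnihilator (A : Set (TM M)) (S : VField (𝓡 2).tangent (N := TM M)) : Prop :=
  ∃ η : OneForm (𝓡 2).tangent (N := TM M), ClosedOn A η ∧
    (∀ p ∈ A, ∀ w ∈ berwald S p, η p w = 0) ∧
    (∀ p ∈ A, η p (liouville M p) = 1) ∧
    ∀ p ∈ A, rankAt (dEnd (tangentStr M) η + 2 • wedge η (insertEnd (tangentStr M) η)) p = 2

end Spray

end

end SprayGeometry

open SprayGeometry

/-!
Let `S` be a non-flat spray on the open cone `A`. Call a `1`-form *adapted* if it annihilates the
Berwald distribution `𝒟` and takes the value one on the Liouville field `𝒞`. Since `Φ ≠ 0`, `𝒟` has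
rank three and is transverse to `𝒞`, so that there is at most one adapted form
(`adapted_unique`, `mem_berwald_iff`), and each of the three conditions is a statement about it.

*Finsler functions.* If `F` is homogeneous and satisfies the Euler–Lagrange equation, then `dF²`
vanishes on horizontal vectors (`LocalSpray.hor_of_eulerLagrange`), hence, by commuting with `S`, on
the image of `Φ` (`LocalSpray.jac_of_hor`). So `dF / F` is adapted and closed
(`exists_adapted_of_metrizes`). Conversely, if `df` is adapted, then `exp f` is homogeneous and solves
the Euler–Lagrange equation (`degMetrizable_of_potential`). By uniqueness, local forms `dF / F` fit
together (`hasClosedAnnihilator_of_local`), and closed forms have potentials on small convex cones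
(`exists_conic_potential`).

*Isotropy.* The form `β` on the base given by the vertical part of an adapted `η` satisfies
`β ∘ R = 0` and `β(y) = 1`, while `R y = 0`. In dimension two this forces `R = ρ (Id - β ⊗ y)`, i.e.
`α / ρ = i_J η` (`exists_isotropy`, `degenerate_of_hasClosedAnnihilator`). Conversely `i_𝔽 (α / ρ)` is
adapted (`isAdapted_of_isotropyData`); its exterior derivative vanishes on `𝒞` by homogeneity, and on
`𝒟` if `𝒟` is integrable, so that it is closed (`hasClosedAnnihilator_of_degenerate`). If an adapted
form is closed, then the level sets of its potentials are integral manifolds of `𝒟`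
(`integrable_of_hasClosedAnnihilator`).

*Ranks.* The rank conditions on the metric tensor, on `Ω` and on `d_J η + 2 η ∧ i_J η` all say that
the vertical derivative of a closed adapted `η`, restricted to the kernel line of its vertical part,
vanishes (`FlatOnKernel`, `rank_metricTensor_iff`, `rank_omegaForm_iff`, `rank_dEnd_iff`).

All computations are done in the charts of `TM` induced by charts of `M`, where the spray is
`(y, g(x, y))`, the connection coefficients are `N = -½ ∂g/∂y`, and `h (a, b) = (a, -N a)`,
`Φ (a, b) = (0, R a)`, `𝔽 (a, b) = (c, -N c - a)` with `c = b + N a`.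
-/

namespace SprayGeometry

open VectorField Bundle FiberBundle Set Filter Topology

set_option linter.unusedSectionVars false

noncomputable section

/-! ### Tensor calculus in a chart -/

section Charts

variable {E : Type*} [NormedAddCommGroup E] [NormedSpace ℝ E] [FiniteDimensional ℝ E]
  {H : Type*} [TopologicalSpace H] {I : ModelWithCorners ℝ E H} [I.Boundaryless]
  {N : Type*} [TopologicalSpace N] [ChartedSpace H N] [IsManifold I ∞ N]
  {F : Type*} [NormedAddCommGroup F] [NormedSpace ℝ F]

variable (I) in
/-- The derivative at `q` of the chart centred at `p₀`. -/
def chartDeriv (p₀ q : N) : TangentSpace I q →L[ℝ] E := mfderiv I 𝓘(ℝ, E) (extChartAt I p₀) q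

variable (I) in
/-- The inverse of the derivative at `q` of the chart centred at `p₀` (zero where that derivative
is not invertible). -/
def chartDerivInv (p₀ q : N) : E →L[ℝ] TangentSpace I q := (chartDeriv I p₀ q).inverse

omit [FiniteDimensional ℝ E] [I.Boundaryless] in
theorem chartDeriv_invertible {p₀ q : N} (hq : q ∈ (extChartAt I p₀).source) :
    (chartDeriv I p₀ q).IsInvertible := by
  have : IsManifold I 1 N := IsManifold.of_le (n := ∞) (by simp)
  exact isInvertible_mfderiv_extChartAt hq

omit [FiniteDimensional ℝ E] [I.Boundaryless] in
@[simp] theorem chartDeriv_chartDerivInv {p₀ q : N} (hq : q ∈ (extChartAt I p₀).source) (v : E) :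
    chartDeriv I p₀ q (chartDerivInv I p₀ q v) = v :=
  (chartDeriv_invertible hq).self_apply_inverse v

omit [FiniteDimensional ℝ E] [I.Boundaryless] in
@[simp] theorem chartDerivInv_chartDeriv {p₀ q : N} (hq : q ∈ (extChartAt I p₀).source)
    (v : TangentSpace I q) : chartDerivInv I p₀ q (chartDeriv I p₀ q v) = v :=
  (chartDeriv_invertible hq).inverse_apply_self v

omit [FiniteDimensional ℝ E] [IsManifold I ∞ N] in
theorem extChartAt_target_mem_nhds_of_mem {p₀ : N} {z : E} (hz : z ∈ (extChartAt I p₀).target) :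
    (extChartAt I p₀).target ∈ 𝓝 z :=
  (isOpen_extChartAt_target p₀).mem_nhds hz

theorem contMDiffAt_chart {p₀ q : N} (hq : q ∈ (extChartAt I p₀).source) :
    ContMDiffAt I 𝓘(ℝ, E) ∞ (extChartAt I p₀) q :=
  contMDiffAt_extChartAt' (by simpa using hq)

theorem contMDiffAt_chart_symm {p₀ : N} {z : E} (hz : z ∈ (extChartAt I p₀).target) :
    ContMDiffAt 𝓘(ℝ, E) I ∞ (extChartAt I p₀).symm z :=
  (contMDiffOn_extChartAt_symm p₀ z hz).contMDiffAt (extChartAt_target_mem_nhds_of_mem hz)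

theorem eventually_mem_target {p₀ q : N} (hq : q ∈ (extChartAt I p₀).source) :
    ∀ᶠ z in 𝓝 (extChartAt I p₀ q), z ∈ (extChartAt I p₀).target :=
  extChartAt_target_mem_nhds_of_mem ((extChartAt I p₀).map_source hq)

theorem eventually_mem_source {p₀ q : N} (hq : q ∈ (extChartAt I p₀).source) :
    ∀ᶠ r in 𝓝 q, r ∈ (extChartAt I p₀).source :=
  (isOpen_extChartAt_source p₀).mem_nhds hq

theorem eventually_chart {p₀ q : N} (hq : q ∈ (extChartAt I p₀).source) {P : N → Prop}
    (h : ∀ᶠ r in 𝓝 q, P r) : ∀ᶠ z in 𝓝 (extChartAt I p₀ q), P ((extChartAt I p₀).symm z) := by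
  have := (contMDiffAt_chart_symm ((extChartAt I p₀).map_source hq)).continuousAt
  rw [ContinuousAt, (extChartAt I p₀).left_inv hq] at this
  exact this.eventually h

/-! ### Functions in a chart -/

theorem contMDiffAt_iff_chart {p₀ q : N} (hq : q ∈ (extChartAt I p₀).source) {f : N → F}
    {n : ℕ∞} : ContMDiffAt I 𝓘(ℝ, F) n f q ↔
      ContDiffAt ℝ n (f ∘ (extChartAt I p₀).symm) (extChartAt I p₀ q) := by
  have hz := (extChartAt I p₀).map_source hq
  constructor
  · intro h
    rw [← contMDiffAt_iff_contDiffAt]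
    refine ContMDiffAt.comp (I' := I) _ ?_ ((contMDiffAt_chart_symm hz).of_le (by exact_mod_cast le_top))
    rwa [(extChartAt I p₀).left_inv hq]
  · intro h
    have := ContMDiffAt.comp (I' := 𝓘(ℝ, E)) q h.contMDiffAt
      ((contMDiffAt_chart hq).of_le (by exact_mod_cast le_top))
    refine this.congr_of_eventuallyEq ?_
    filter_upwards [eventually_mem_source hq] with r hr
    rw [Function.comp_apply, Function.comp_apply, (extChartAt I p₀).left_inv hr]

theorem mdifferentiableAt_iff_chart {p₀ q : N} (hq : q ∈ (extChartAt I p₀).source) {f : N → F} :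
    MDifferentiableAt I 𝓘(ℝ, F) f q ↔
      DifferentiableAt ℝ (f ∘ (extChartAt I p₀).symm) (extChartAt I p₀ q) := by
  have hz := (extChartAt I p₀).map_source hq
  constructor
  · intro h
    rw [← mdifferentiableAt_iff_differentiableAt]
    refine MDifferentiableAt.comp (I' := I) _ ?_ ((contMDiffAt_chart_symm hz).mdifferentiableAt (by simp))
    rwa [(extChartAt I p₀).left_inv hq]
  · intro h
    have := MDifferentiableAt.comp (I' := 𝓘(ℝ, E)) q h.mdifferentiableAt
      ((contMDiffAt_chart hq).mdifferentiableAt (by simp))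
    refine this.congr_of_eventuallyEq ?_
    filter_upwards [eventually_mem_source hq] with r hr
    rw [Function.comp_apply, Function.comp_apply, (extChartAt I p₀).left_inv hr]

theorem mvfderiv_eq_chart {p₀ q : N} (hq : q ∈ (extChartAt I p₀).source) {f : N → F}
    (hf : DifferentiableAt ℝ (f ∘ (extChartAt I p₀).symm) (extChartAt I p₀ q))
    (w : TangentSpace I q) :
    mvfderiv I f q w =
      fderiv ℝ (f ∘ (extChartAt I p₀).symm) (extChartAt I p₀ q) (chartDeriv I p₀ q w) := by
  have e : f =ᶠ[𝓝 q] (f ∘ (extChartAt I p₀).symm) ∘ extChartAt I p₀ := by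
    filter_upwards [eventually_mem_source hq] with r hr
    rw [Function.comp_apply, Function.comp_apply, (extChartAt I p₀).left_inv hr]
  have h1 : mfderiv I 𝓘(ℝ, F) f q =
      (mfderiv 𝓘(ℝ, E) 𝓘(ℝ, F) (f ∘ (extChartAt I p₀).symm) (extChartAt I p₀ q)).comp
        (mfderiv I 𝓘(ℝ, E) (extChartAt I p₀) q) := by
    rw [e.mfderiv_eq]
    exact mfderiv_comp q hf.mdifferentiableAt ((contMDiffAt_chart hq).mdifferentiableAt (by simp))
  rw [mfderiv_eq_fderiv] at h1
  exact DFunLike.congr_fun h1 w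

/-! ### Vector fields in a chart -/

/-- The vector field `X` in the chart centred at `p₀`, meaningful on the target of the chart. -/
def coordField (p₀ : N) (X : VField I (N := N)) (z : E) : E :=
  chartDeriv I p₀ ((extChartAt I p₀).symm z) (X ((extChartAt I p₀).symm z))

/-- The vector field given by `V` in the chart centred at `p₀`. -/
def ofCoord (p₀ : N) (V : E → E) : VField I (N := N) :=
  fun q => chartDerivInv I p₀ q (V (extChartAt I p₀ q))

theorem trivialization_apply {p₀ q : N} (hq : q ∈ (extChartAt I p₀).source)
    (v : TangentSpace I q) :
    (trivializationAt E (TangentSpace I) p₀ ⟨q, v⟩).2 = chartDeriv I p₀ q v := by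
  have : IsManifold I 1 N := IsManifold.of_le (n := ∞) (by simp)
  have hq' : q ∈ (chartAt H p₀).source := by simpa using hq
  rw [chartDeriv, ← TangentBundle.continuousLinearMapAt_trivializationAt hq',
    Trivialization.continuousLinearMapAt_apply, Trivialization.linearMapAt_apply]
  simp [hq']

theorem mdifferentiableAt_field_iff {p₀ q : N} (hq : q ∈ (extChartAt I p₀).source)
    {X : VField I (N := N)} :
    MDiffAt (T% X) q ↔ DifferentiableAt ℝ (coordField p₀ X) (extChartAt I p₀ q) := by
  have : IsManifold I 1 N := IsManifold.of_le (n := ∞) (by simp)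
  have hq' : q ∈ (trivializationAt E (TangentSpace I) p₀).baseSet := by simpa using hq
  rw [Trivialization.mdifferentiableAt_section_iff I (trivializationAt E (TangentSpace I) p₀) X hq']
  have e : (fun x => (trivializationAt E (TangentSpace I) p₀ ⟨x, X x⟩).2) =ᶠ[𝓝 q]
      (fun x => chartDeriv I p₀ x (X x)) := by
    filter_upwards [eventually_mem_source hq] with r hr
    exact trivialization_apply hr _
  rw [e.mdifferentiableAt_iff]
  exact mdifferentiableAt_iff_chart hq

theorem contMDiffAt_field_iff {p₀ q : N} (hq : q ∈ (extChartAt I p₀).source)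
    {X : VField I (N := N)} :
    ContMDiffAt I I.tangent ∞ (T% X) q ↔
      ContDiffAt ℝ ∞ (coordField p₀ X) (extChartAt I p₀ q) := by
  have hq' : q ∈ (trivializationAt E (TangentSpace I) p₀).baseSet := by simpa using hq
  rw [Trivialization.contMDiffAt_section_iff (trivializationAt E (TangentSpace I) p₀) hq']
  have e : (fun x => (trivializationAt E (TangentSpace I) p₀ ⟨x, X x⟩).2) =ᶠ[𝓝 q]
      (fun x => chartDeriv I p₀ x (X x)) := by
    filter_upwards [eventually_mem_source hq] with r hr
    exact trivialization_apply hr _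
  rw [e.contMDiffAt_iff]
  exact contMDiffAt_iff_chart (n := ⊤) hq

theorem mdifferentiableAt_vectorSpace_iff {V : Π z : E, TangentSpace 𝓘(ℝ, E) z} {z : E} :
    MDiffAt (T% V) z ↔ DifferentiableAt ℝ (V : E → E) z := by
  rw [mdifferentiableAt_field_iff (p₀ := z) (by simp)]
  have e : coordField (I := 𝓘(ℝ, E)) z V = V := by
    funext w
    have h : chartDeriv 𝓘(ℝ, E) z w = ContinuousLinearMap.id ℝ E := by
      rw [chartDeriv, extChartAt_self_eq, mfderiv_eq_fderiv]
      exact fderiv_id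
    change chartDeriv 𝓘(ℝ, E) z w (V w) = V w
    rw [h]
    rfl
  rw [e]
  rfl

theorem coordField_ofCoord {p₀ q : N} (hq : q ∈ (extChartAt I p₀).source) (V : E → E) :
    coordField (I := I) (N := N) p₀ (ofCoord (I := I) p₀ V) =ᶠ[𝓝 (extChartAt I p₀ q)] V := by
  filter_upwards [eventually_mem_target hq] with z (hz : z ∈ (extChartAt I p₀).target)
  rw [coordField, ofCoord, chartDeriv_chartDerivInv ((extChartAt I p₀).map_target hz),
    (extChartAt I p₀).right_inv hz]

theorem ofCoord_coordField {p₀ q : N} (hq : q ∈ (extChartAt I p₀).source)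
    (X : VField I (N := N)) : ofCoord (I := I) p₀ (coordField p₀ X) =ᶠ[𝓝 q] X := by
  filter_upwards [eventually_mem_source hq] with r hr
  rw [ofCoord, coordField, (extChartAt I p₀).left_inv hr, chartDerivInv_chartDeriv hr]

theorem mdifferentiableAt_ofCoord {p₀ q : N} (hq : q ∈ (extChartAt I p₀).source) {V : E → E}
    (hV : DifferentiableAt ℝ V (extChartAt I p₀ q)) : MDiffAt (T% (ofCoord (I := I) p₀ V)) q := by
  rw [mdifferentiableAt_field_iff hq]
  exact hV.congr_of_eventuallyEq (coordField_ofCoord hq V)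

/-- The Lie bracket of vector fields is computed in a chart, by naturality under the chart. -/
theorem chartDeriv_mlieBracket_ofCoord {p₀ q : N} (hq : q ∈ (extChartAt I p₀).source) {V W : E → E}
    (hV : DifferentiableAt ℝ V (extChartAt I p₀ q)) (hW : DifferentiableAt ℝ W (extChartAt I p₀ q)) :
    chartDeriv I p₀ q (mlieBracket I (ofCoord p₀ V) (ofCoord p₀ W) q) =
      lieBracket ℝ V W (extChartAt I p₀ q) := by
  have : IsManifold I 3 N := IsManifold.of_le (n := ∞) (by decide)
  have : IsManifold I (minSmoothness ℝ 2) N := by simp; infer_instance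
  have : IsManifold I (minSmoothness ℝ 3) N := by simpa
  have key : ∀ V' W' : Π z : E, TangentSpace 𝓘(ℝ, E) z,
      DifferentiableAt ℝ (V' : E → E) (extChartAt I p₀ q) →
      DifferentiableAt ℝ (W' : E → E) (extChartAt I p₀ q) →
      mpullback I 𝓘(ℝ, E) (extChartAt I p₀) (lieBracket ℝ (V' : E → E) (W' : E → E)) q =
        mlieBracket I (mpullback I 𝓘(ℝ, E) (extChartAt I p₀) V')
          (mpullback I 𝓘(ℝ, E) (extChartAt I p₀) W') q := by
    intro V' W' hV' hW'
    rw [← mpullback_mlieBracket (n := ∞) (mdifferentiableAt_vectorSpace_iff.2 hV')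
      (mdifferentiableAt_vectorSpace_iff.2 hW') (contMDiffAt_chart hq)
      (by rw [minSmoothness_of_isRCLikeNormedField]; decide), ← mlieBracketWithin_univ,
      mlieBracketWithin_eq_lieBracketWithin]
    exact congrArg (fun X => mpullback I 𝓘(ℝ, E) (extChartAt I p₀) X q)
      (lieBracketWithin_univ (𝕜 := ℝ) (V := (V' : E → E)) (W := (W' : E → E))).symm
  have h := key V W hV hW
  change chartDerivInv I p₀ q (lieBracket ℝ V W (extChartAt I p₀ q)) =
    mlieBracket I (ofCoord p₀ V) (ofCoord p₀ W) q at h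
  rw [← h, chartDeriv_chartDerivInv hq]

theorem contDiffAt_clm_of_apply {D : Type*} [NormedAddCommGroup D] [NormedSpace ℝ D]
    {n : WithTop ℕ∞} {f : D → E →L[ℝ] F} {z : D} (h : ∀ v, ContDiffAt ℝ n (fun x => f x v) z) :
    ContDiffAt ℝ n f z := by
  let d := Module.finrank ℝ E
  let e₁ := ContinuousLinearEquiv.ofFinrankEq (𝕜 := ℝ) (E := E) (F := Fin d → ℝ)
    (Module.finrank_fin_fun ℝ).symm
  let e₂ := (e₁.arrowCongr (1 : F ≃L[ℝ] F)).trans (ContinuousLinearEquiv.piRing (Fin d))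
  rw [← Function.id_comp f, ← e₂.symm_comp_self, Function.comp_assoc]
  exact e₂.symm.contDiff.contDiffAt.comp z (contDiffAt_pi.mpr fun i => h _)

/-! ### Fields of endomorphisms and one-forms in a chart -/

/-- The field of endomorphisms `K` in the chart centred at `p₀`, meaningful on the target of the
chart. -/
def coordEnd (p₀ : N) (K : EndField I (N := N)) (z : E) : E →L[ℝ] E :=
  (chartDeriv I p₀ ((extChartAt I p₀).symm z)).comp
    ((K ((extChartAt I p₀).symm z)).comp (chartDerivInv I p₀ ((extChartAt I p₀).symm z)))

/-- The `1`-form `η` in the chart centred at `p₀`, meaningful on the target of the chart. -/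
def coordForm (p₀ : N) (η : OneForm I (N := N)) (z : E) : E →L[ℝ] ℝ :=
  (η ((extChartAt I p₀).symm z)).comp (chartDerivInv I p₀ ((extChartAt I p₀).symm z))

theorem coordEnd_chart {p₀ q : N} (hq : q ∈ (extChartAt I p₀).source) (K : EndField I (N := N))
    (v : TangentSpace I q) :
    coordEnd p₀ K (extChartAt I p₀ q) (chartDeriv I p₀ q v) = chartDeriv I p₀ q (K q v) := by
  have h : ∀ r, r = q → r ∈ (extChartAt I p₀).source → ∀ v : TangentSpace I q,
      (chartDeriv I p₀ r).comp ((K r).comp (chartDerivInv I p₀ r)) (chartDeriv I p₀ q v) =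
      chartDeriv I p₀ q (K q v) := by
    rintro r rfl hr v
    simp only [ContinuousLinearMap.comp_apply, chartDerivInv_chartDeriv hr]
  exact h _ ((extChartAt I p₀).left_inv hq) (by rwa [(extChartAt I p₀).left_inv hq]) v

theorem coordForm_chart {p₀ q : N} (hq : q ∈ (extChartAt I p₀).source) (η : OneForm I (N := N))
    (v : TangentSpace I q) :
    coordForm p₀ η (extChartAt I p₀ q) (chartDeriv I p₀ q v) = η q v := by
  have h : ∀ r, r = q → r ∈ (extChartAt I p₀).source → ∀ v : TangentSpace I q,
      (η r).comp (chartDerivInv I p₀ r) (chartDeriv I p₀ q v) = η q v := by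
    rintro r rfl hr v
    simp only [ContinuousLinearMap.comp_apply, chartDerivInv_chartDeriv hr]
  exact h _ ((extChartAt I p₀).left_inv hq) (by rwa [(extChartAt I p₀).left_inv hq]) v

theorem coordField_chart {p₀ q : N} (hq : q ∈ (extChartAt I p₀).source) (X : VField I (N := N)) :
    coordField p₀ X (extChartAt I p₀ q) = chartDeriv I p₀ q (X q) := by
  rw [coordField, (extChartAt I p₀).left_inv hq]

theorem coordEnd_apply_coordField {p₀ : N} (K : EndField I (N := N)) (X : VField I (N := N))
    {z : E} (hz : z ∈ (extChartAt I p₀).target) :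
    coordEnd p₀ K z (coordField p₀ X z) = coordField p₀ (fun q => K q (X q)) z := by
  have hs := (extChartAt I p₀).map_target hz
  simp [coordEnd, coordField, hs, -extChartAt]

theorem coordForm_apply_coordField {p₀ : N} (η : OneForm I (N := N)) (X : VField I (N := N))
    {z : E} (hz : z ∈ (extChartAt I p₀).target) :
    coordForm p₀ η z (coordField p₀ X z) = η _ (X ((extChartAt I p₀).symm z)) := by
  have hs := (extChartAt I p₀).map_target hz
  simp [coordForm, coordField, hs, -extChartAt]

/-- In a chart, `ℒ_S K = D K (S) - D S ∘ K + K ∘ D S`. -/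
theorem chartDeriv_lieDerivEnd {p₀ q : N} (hq : q ∈ (extChartAt I p₀).source)
    {S : VField I (N := N)} {K : EndField I (N := N)}
    (hS : DifferentiableAt ℝ (coordField p₀ S) (extChartAt I p₀ q))
    (hK : DifferentiableAt ℝ (coordEnd p₀ K) (extChartAt I p₀ q)) (w : TangentSpace I q) :
    chartDeriv I p₀ q (lieDerivEnd S K q w) =
      fderiv ℝ (coordEnd p₀ K) (extChartAt I p₀ q) (coordField p₀ S (extChartAt I p₀ q))
          (chartDeriv I p₀ q w)
        - fderiv ℝ (coordField p₀ S) (extChartAt I p₀ q)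
          (coordEnd p₀ K (extChartAt I p₀ q) (chartDeriv I p₀ q w))
        + coordEnd p₀ K (extChartAt I p₀ q)
          (fderiv ℝ (coordField p₀ S) (extChartAt I p₀ q) (chartDeriv I p₀ q w)) := by
  have hKX : ∀ X : VField I (N := N), coordField p₀ (fun q => K q (X q)) =ᶠ[𝓝 (extChartAt I p₀ q)]
      fun z => coordEnd p₀ K z (coordField p₀ X z) := by
    intro X
    filter_upwards [eventually_mem_target hq] with z hz
    rw [coordEnd_apply_coordField K X hz]
  have hK' : ∀ X : VField I (N := N), MDiffAt (T% X) q → MDiffAt (T% (fun q => K q (X q))) q := by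
    intro X hX
    rw [mdifferentiableAt_field_iff hq] at hX ⊢
    exact (hK.clm_apply hX).congr_of_eventuallyEq (hKX X)
  set v := chartDeriv I p₀ q w with hv
  set X : VField I (N := N) := ofCoord p₀ (fun _ => v) with hX
  have hXd : MDiffAt (T% X) q := mdifferentiableAt_ofCoord hq (differentiableAt_const _)
  have hXq : X q = w := by simp [hX, ofCoord, hv, hq, -extChartAt]
  have h := lieDerivEnd_apply (S := S) hK' hXd
  rw [hXq] at h
  have hSe := (ofCoord_coordField hq S).symm
  have hKe : (fun q => K q (X q)) =ᶠ[𝓝 q] ofCoord (I := I) p₀ (fun z => coordEnd p₀ K z v) := by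
    filter_upwards [eventually_mem_source hq] with r hr
    have := coordEnd_chart hr K (X r)
    rw [ofCoord, ← chartDerivInv_chartDeriv hr (K r (X r)), ← this]
    rw [show chartDeriv I p₀ r (X r) = v from chartDeriv_chartDerivInv hr v]
  have hKd : DifferentiableAt ℝ (fun z => coordEnd p₀ K z v) (extChartAt I p₀ q) :=
    hK.clm_apply (differentiableAt_const _)
  rw [h, map_sub, ← coordEnd_chart hq, hSe.mlieBracket_vectorField_eq hKe,
    hSe.mlieBracket_vectorField_eq (EventuallyEq.refl _ X),
    chartDeriv_mlieBracket_ofCoord hq hS hKd,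
    chartDeriv_mlieBracket_ofCoord hq hS (differentiableAt_const _)]
  simp only [lieBracket]
  rw [fderiv_clm_apply hK (differentiableAt_const _)]
  simp

/-- In a chart, the exterior derivative of a `1`-form is the antisymmetrized derivative. -/
theorem extDer_chart {p₀ q : N} (hq : q ∈ (extChartAt I p₀).source) {η : OneForm I (N := N)}
    (hη : DifferentiableAt ℝ (coordForm p₀ η) (extChartAt I p₀ q)) (w₁ w₂ : TangentSpace I q) :
    extDer η q w₁ w₂ =
      fderiv ℝ (coordForm p₀ η) (extChartAt I p₀ q) (chartDeriv I p₀ q w₁) (chartDeriv I p₀ q w₂)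
      - fderiv ℝ (coordForm p₀ η) (extChartAt I p₀ q)
        (chartDeriv I p₀ q w₂) (chartDeriv I p₀ q w₁) := by
  have he : ∀ X : VField I (N := N), (fun q => η q (X q)) ∘ (extChartAt I p₀).symm
      =ᶠ[𝓝 (extChartAt I p₀ q)] fun z => coordForm p₀ η z (coordField p₀ X z) := by
    intro X
    filter_upwards [eventually_mem_target hq] with z hz
    rw [coordForm_apply_coordField η X hz, Function.comp_apply]
  have hη' : ∀ X : VField I (N := N), MDiffAt (T% X) q → MDiffAt (fun q => η q (X q)) q := by
    intro X hX
    rw [mdifferentiableAt_field_iff hq] at hX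
    rw [mdifferentiableAt_iff_chart hq]
    exact (hη.clm_apply hX).congr_of_eventuallyEq (he X)
  have hd : ∀ v : E, MDiffAt (T% (ofCoord (I := I) p₀ (fun _ => v))) q :=
    fun v => mdifferentiableAt_ofCoord hq (differentiableAt_const _)
  have hv : ∀ w : TangentSpace I q, ofCoord (I := I) p₀ (fun _ => chartDeriv I p₀ q w) q = w := by
    intro w; simp [ofCoord, hq, -extChartAt]
  have hder : ∀ (v : E) (w : TangentSpace I q),
      mvfderiv I (fun q => η q (ofCoord (I := I) p₀ (fun _ => v) q)) q w =
        fderiv ℝ (coordForm p₀ η) (extChartAt I p₀ q) (chartDeriv I p₀ q w) v := by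
    intro v w
    have h1 : (fun q => η q (ofCoord (I := I) p₀ (fun _ => v) q)) ∘ (extChartAt I p₀).symm
        =ᶠ[𝓝 (extChartAt I p₀ q)] fun z => coordForm p₀ η z v := by
      filter_upwards [he (ofCoord p₀ fun _ => v), coordField_ofCoord hq (fun _ => v)] with z h1 h2
      rw [h1, h2]
    rw [mvfderiv_eq_chart hq
      ((hη.clm_apply (differentiableAt_const v)).congr_of_eventuallyEq h1), h1.fderiv_eq,
      fderiv_clm_apply hη (differentiableAt_const _)]
    simp
  have h := extDer_apply hη' (hd (chartDeriv I p₀ q w₁)) (hd (chartDeriv I p₀ q w₂))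
  rw [hder, hder, hv, hv] at h
  rw [h]
  have hb : mlieBracket I (ofCoord (I := I) p₀ (fun _ => chartDeriv I p₀ q w₁))
      (ofCoord p₀ (fun _ => chartDeriv I p₀ q w₂)) q = 0 := by
    rw [← chartDerivInv_chartDeriv hq (mlieBracket _ _ _ q), chartDeriv_mlieBracket_ofCoord hq
      (differentiableAt_const _) (differentiableAt_const _)]
    simp [lieBracket]
  rw [hb]
  simp

theorem coordForm_differential {p₀ q : N} (hq : q ∈ (extChartAt I p₀).source) {f : N → ℝ}
    (hf : DifferentiableAt ℝ (f ∘ (extChartAt I p₀).symm) (extChartAt I p₀ q)) :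
    coordForm (I := I) p₀ (differential f) (extChartAt I p₀ q) =
      fderiv ℝ (f ∘ (extChartAt I p₀).symm) (extChartAt I p₀ q) := by
  ext v
  have := coordForm_chart hq (differential (I := I) f) (chartDerivInv I p₀ q v)
  rw [chartDeriv_chartDerivInv hq] at this
  rw [this, differential, mvfderiv_eq_chart hq hf, chartDeriv_chartDerivInv hq]

/-- Smoothness of a `1`-form at `p` can be tested in the chart centred at `p` itself. -/
theorem contMDiffAt_form_of_coord {p : N} {η : OneForm I (N := N)}
    (h : ContDiffAt ℝ ∞ (coordForm p η) (extChartAt I p p)) :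
    ContMDiffAt I (I.prod 𝓘(ℝ, E →L[ℝ] ℝ)) ∞ (fun p => TotalSpace.mk' (E →L[ℝ] ℝ)
      (E := fun p : N => TangentSpace I p →L[ℝ] Bundle.Trivial N ℝ p) p (η p)) p := by
  have : IsManifold I 1 N := IsManifold.of_le (n := ∞) (by simp)
  rw [contMDiffAt_hom_bundle]
  refine ⟨contMDiffAt_id, ?_⟩
  have hp : p ∈ (extChartAt I p).source := mem_extChartAt_source p
  rw [← contMDiffAt_iff_contDiffAt] at h
  have h2 : ContMDiffAt I 𝓘(ℝ, E →L[ℝ] ℝ) ∞ (fun q => coordForm p η (extChartAt I p q)) p :=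
    ContMDiffAt.comp (I' := 𝓘(ℝ, E)) p h (contMDiffAt_chart hp)
  refine h2.congr_of_eventuallyEq ?_
  filter_upwards [eventually_mem_source hp] with q hq
  have hq' : q ∈ (chartAt H p).source := by simpa using hq
  ext v
  rw [ContinuousLinearMap.inCoordinates_eq (by simpa using hq') (by simp)]
  have e : coordForm p η (extChartAt I p q) v = η q (chartDerivInv I p q v) := by
    rw [← coordForm_chart hq, chartDeriv_chartDerivInv hq]
  rw [e]
  have e2 : ((trivializationAt E (TangentSpace I) p).continuousLinearEquivAt ℝ q
      (by simpa using hq')).symm v = chartDerivInv I p q v := by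
    rw [ContinuousLinearEquiv.symm_apply_eq]
    have := trivialization_apply hq (chartDerivInv I p q v)
    rw [chartDeriv_chartDerivInv hq] at this
    simpa using this.symm
  simp only [ContinuousLinearMap.comp_apply, ContinuousLinearEquiv.coe_coe]
  rw [e2]
  simp

/-- A smooth `1`-form is smooth in every chart. -/
theorem contDiffAt_coordForm {p₀ q : N} (hq : q ∈ (extChartAt I p₀).source) {η : OneForm I (N := N)}
    (h : ContMDiffAt I (I.prod 𝓘(ℝ, E →L[ℝ] ℝ)) ∞ (fun p => TotalSpace.mk' (E →L[ℝ] ℝ)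
      (E := fun p : N => TangentSpace I p →L[ℝ] Bundle.Trivial N ℝ p) p (η p)) q) :
    ContDiffAt ℝ ∞ (coordForm p₀ η) (extChartAt I p₀ q) := by
  refine contDiffAt_clm_of_apply fun v => ?_
  have hX : ContMDiffAt I I.tangent ∞ (T% (ofCoord (I := I) p₀ (fun _ => v))) q := by
    rw [contMDiffAt_field_iff hq]
    exact contDiffAt_const.congr_of_eventuallyEq (coordField_ofCoord hq _)
  have h2 := ContMDiffAt.clm_bundle_apply h hX
  rw [contMDiffAt_totalSpace] at h2
  have h3 : ContMDiffAt I 𝓘(ℝ, ℝ) ∞ (fun r => η r (ofCoord (I := I) p₀ (fun _ => v) r)) q := h2.2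
  rw [contMDiffAt_iff_chart (n := ⊤) hq] at h3
  refine h3.congr_of_eventuallyEq ?_
  filter_upwards [eventually_mem_target hq, coordField_ofCoord hq (fun _ => v)] with z hz h2
  rw [Function.comp_apply, ← coordForm_apply_coordField _ _ hz, h2]

end Charts

/-! ### The charts of the tangent bundle -/

section TangentCharts

variable {M : Type*} [TopologicalSpace M] [ChartedSpace (EuclideanSpace ℝ (Fin 2)) M]
  [IsManifold (𝓡 2) ∞ M]

/-- The model plane of the surface `M`. -/
abbrev Plane : Type := EuclideanSpace ℝ (Fin 2)

/-- The chart of `TM` induced by the chart of `M` at the base point of `p₀`. -/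
abbrev tchart (p₀ : TM M) : PartialEquiv (TM M) (Plane × Plane) := extChartAt (𝓡 2).tangent p₀

/-- The derivative at `p` of the chart of `TM` centred at `p₀`. -/
abbrev tderiv (p₀ p : TM M) : TTM p →L[ℝ] Plane × Plane := chartDeriv (𝓡 2).tangent p₀ p

/-- The inverse of the derivative at `p` of the chart of `TM` centred at `p₀`. -/
abbrev tderivInv (p₀ p : TM M) : Plane × Plane →L[ℝ] TTM p := chartDerivInv (𝓡 2).tangent p₀ p

theorem mem_tchart_source {p₀ p : TM M} :
    p ∈ (tchart p₀).source ↔ p.1 ∈ (extChartAt (𝓡 2) p₀.1).source := by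
  simp

/-- The chart of `TM` centred at `p₀` is the tangent map of the chart of `M`; in particular it is
linear on the fibres. -/
theorem tchart_apply {p₀ p : TM M} (hp : p ∈ (tchart p₀).source) :
    tchart p₀ p = (extChartAt (𝓡 2) p₀.1 p.1, chartDeriv (𝓡 2) p₀.1 p.1 p.2) := by
  have h := trivialization_apply (mem_tchart_source.1 hp) p.2
  refine Prod.ext rfl ?_
  rw [← h]
  rfl

theorem tchart_dilate {p₀ p : TM M} (hp : p ∈ (tchart p₀).source) (c : ℝ) :
    dilate c p ∈ (tchart p₀).source ∧
      tchart p₀ (dilate c p) = ((tchart p₀ p).1, c • (tchart p₀ p).2) := by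
  have h : dilate c p ∈ (tchart p₀).source := mem_tchart_source.2 (mem_tchart_source.1 hp)
  refine ⟨h, ?_⟩
  rw [tchart_apply h, tchart_apply hp]
  exact Prod.ext rfl (map_smul _ _ _)

/-- The tangent space at `p.1` is identified with `Plane` by the chart at `p.1`, so the chart of
`TM` centred at `p` is the identity on the fibre through `p`. This is what makes the second
derivative in `metricTensor` a derivative in that chart. -/
theorem tchart_self_fibre (p : TM M) (y : Plane) :
    (⟨p.1, y⟩ : TM M) ∈ (tchart p).source ∧
      tchart p (⟨p.1, y⟩ : TM M) = ((tchart p p).1, y) := by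
  have h : (⟨p.1, y⟩ : TM M) ∈ (tchart p).source :=
    mem_tchart_source.2 (mem_extChartAt_source p.1)
  refine ⟨h, ?_⟩
  have : IsManifold (𝓡 2) 1 M := IsManifold.of_le (n := ∞) (by simp)
  rw [tchart_apply h, tchart_apply (mem_extChartAt_source p)]
  refine Prod.ext rfl ?_
  have h1 : chartDeriv (𝓡 2) p.1 p.1 = ContinuousLinearMap.id ℝ _ := mfderiv_extChartAt_self
  change chartDeriv (𝓡 2) p.1 p.1 y = y
  rw [h1]
  rfl

theorem chartDeriv_dproj {p₀ p : TM M} (hp : p ∈ (tchart p₀).source) (w : TTM p) :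
    chartDeriv (𝓡 2) p₀.1 p.1 (dproj p w) = (tderiv p₀ p w).1 := by
  have hp1 := mem_tchart_source.1 hp
  have e : extChartAt (𝓡 2) p₀.1 ∘ (TotalSpace.proj : TM M → M) = Prod.fst ∘ tchart p₀ := rfl
  have hproj : MDifferentiableAt (𝓡 2).tangent (𝓡 2) (TotalSpace.proj : TM M → M) p :=
    (contMDiff_proj (TangentSpace (𝓡 2) : M → Type _) (n := ∞)).mdifferentiableAt (by simp)
  have h1 := mfderiv_comp p ((contMDiffAt_chart hp1).mdifferentiableAt (by simp)) hproj
  have h2 := mfderiv_comp (I' := 𝓘(ℝ, Plane × Plane)) (I'' := 𝓘(ℝ, Plane)) p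
    (g := (Prod.fst : Plane × Plane → Plane)) (f := tchart p₀)
    differentiableAt_fst.mdifferentiableAt
    ((contMDiffAt_chart hp).mdifferentiableAt (by simp))
  rw [e, h2, mfderiv_eq_fderiv, fderiv_fst] at h1
  exact (DFunLike.congr_fun h1 w).symm

theorem tderiv_vlift {p₀ p : TM M} (hp : p ∈ (tchart p₀).source) (u : TangentSpace (𝓡 2) p.1) :
    tderiv p₀ p (vlift p u) = (0, chartDeriv (𝓡 2) p₀.1 p.1 u) := by
  set L : Plane →L[ℝ] Plane := chartDeriv (𝓡 2) p₀.1 p.1 with hL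
  set x : Plane := extChartAt (𝓡 2) p₀.1 p.1 with hx
  have hs : ∀ y : Plane, (⟨p.1, y⟩ : TM M) ∈ (tchart p₀).source :=
    fun y => mem_tchart_source.2 (mem_tchart_source.1 hp)
  have e : tchart p₀ ∘ (fun y : Plane => (⟨p.1, y⟩ : TM M)) = fun y => (x, L y) := by
    funext y
    rw [Function.comp_apply, tchart_apply (hs y)]
    rfl
  have e2 : (fun y : Plane => (⟨p.1, y⟩ : TM M)) = (tchart p₀).symm ∘ fun y => (x, L y) := by
    rw [← e]
    funext y
    exact ((tchart p₀).left_inv (hs y)).symm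
  have hd : HasFDerivAt (fun y : Plane => (x, L y)) ((0 : Plane →L[ℝ] Plane).prod L) p.2 :=
    (hasFDerivAt_const x _).prodMk L.hasFDerivAt
  have hxz : (x, L p.2) = tchart p₀ p := (tchart_apply hp).symm
  have hm : MDifferentiableAt 𝓘(ℝ, Plane) (𝓡 2).tangent
      (fun y : Plane => (⟨p.1, y⟩ : TM M)) p.2 := by
    rw [e2]
    refine MDifferentiableAt.comp (I' := 𝓘(ℝ, Plane × Plane)) _ ?_ hd.differentiableAt.mdifferentiableAt
    refine (contMDiffAt_chart_symm ?_).mdifferentiableAt (by simp)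
    rw [hxz]
    exact (tchart p₀).map_source hp
  have h1 := mfderiv_comp (I'' := 𝓘(ℝ, Plane × Plane)) p.2
    (f := fun y : Plane => (⟨p.1, y⟩ : TM M)) (g := tchart p₀)
    ((contMDiffAt_chart hp).mdifferentiableAt (by simp)) hm
  rw [e] at h1
  have h2 := h1.symm.trans hd.hasMFDerivAt.mfderiv
  exact DFunLike.congr_fun h2 u

theorem tderiv_tangentStr {p₀ p : TM M} (hp : p ∈ (tchart p₀).source) (w : TTM p) :
    tderiv p₀ p (tangentStr M p w) = (0, (tderiv p₀ p w).1) := by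
  rw [tangentStr, ContinuousLinearMap.comp_apply, tderiv_vlift hp, chartDeriv_dproj hp]

theorem tderiv_liouville {p₀ p : TM M} (hp : p ∈ (tchart p₀).source) :
    tderiv p₀ p (liouville M p) = (0, (tchart p₀ p).2) := by
  rw [liouville, tderiv_vlift hp, tchart_apply hp]

theorem dproj_eq_zero_iff {p₀ p : TM M} (hp : p ∈ (tchart p₀).source) (w : TTM p) :
    dproj p w = 0 ↔ (tderiv p₀ p w).1 = 0 := by
  rw [← chartDeriv_dproj hp]
  constructor
  · intro h; rw [h, map_zero]
  · intro h
    rw [← chartDerivInv_chartDeriv (mem_tchart_source.1 hp) (dproj p w), h, map_zero]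

end TangentCharts

/-! ### Sprays in coordinates -/

section LocalCalculus

variable {F : Type*} [NormedAddCommGroup F] [NormedSpace ℝ F]

theorem fderiv_fderiv_symm {V : Type*} [NormedAddCommGroup V] [NormedSpace ℝ V] {f : V → F} {z : V}
    (hf : ContDiffAt ℝ ∞ f z) (v w : V) :
    fderiv ℝ (fderiv ℝ f) z v w = fderiv ℝ (fderiv ℝ f) z w v :=
  (hf.isSymmSndFDerivAt (by rw [minSmoothness_of_isRCLikeNormedField]; decide)).eq v w

theorem contDiffAt_fderiv {V : Type*} [NormedAddCommGroup V] [NormedSpace ℝ V] {f : V → F} {z : V}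
    (hf : ContDiffAt ℝ ∞ f z) : ContDiffAt ℝ ∞ (fderiv ℝ f) z :=
  hf.fderiv_right (by simp)

/-- The spray `yⁱ ∂/∂xⁱ + gⁱ ∂/∂yⁱ` of a chart. -/
def sprayVec (g : Plane × Plane → Plane) (z : Plane × Plane) : Plane × Plane := (z.2, g z)

/-- The coefficients `N = -½ ∂g/∂y` of the nonlinear connection of the spray
`yⁱ ∂/∂xⁱ + gⁱ ∂/∂yⁱ`. -/
def nonlin (g : Plane × Plane → Plane) (z : Plane × Plane) : Plane →L[ℝ] Plane :=
  (-(1 / 2 : ℝ)) • (fderiv ℝ g z).comp (ContinuousLinearMap.inr ℝ Plane Plane)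

/-- The horizontal lift of `a`. -/
def hor (g : Plane × Plane → Plane) (z : Plane × Plane) (a : Plane) : Plane × Plane :=
  (a, -nonlin g z a)

/-- The Jacobi endomorphism `R = -∂g/∂x - S(N) - N²` of the spray `S = yⁱ ∂/∂xⁱ + gⁱ ∂/∂yⁱ`. -/
def jac (g : Plane × Plane → Plane) (z : Plane × Plane) : Plane →L[ℝ] Plane :=
  -(fderiv ℝ g z).comp (ContinuousLinearMap.inl ℝ Plane Plane)
    - fderiv ℝ (nonlin g) z (sprayVec g z) - (nonlin g z).comp (nonlin g z)

/-- `g` is the fibre part of a spray on the open set `O`: it is smooth and, infinitesimally,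
positively homogeneous of degree two in `y`. -/
structure LocalSpray (O : Set (Plane × Plane)) (g : Plane × Plane → Plane) : Prop where
  isOpen : IsOpen O
  smooth : ∀ z ∈ O, ContDiffAt ℝ ∞ g z
  homogeneous : ∀ z ∈ O, fderiv ℝ g z (0, z.2) = (2 : ℝ) • g z

variable {O : Set (Plane × Plane)} {g : Plane × Plane → Plane} {z : Plane × Plane}

theorem fderiv_vert (g : Plane × Plane → Plane) (z : Plane × Plane) (a : Plane) :
    fderiv ℝ g z (0, a) = -((2 : ℝ) • nonlin g z a) := by
  simp [nonlin, smul_smul]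

theorem fderiv_horiz (g : Plane × Plane → Plane) (z : Plane × Plane) (a : Plane) :
    fderiv ℝ g z (a, 0) =
      -jac g z a - fderiv ℝ (nonlin g) z (sprayVec g z) a - nonlin g z (nonlin g z a) := by
  simp [jac]
  abel

theorem fderiv_split {f : Plane × Plane → F} (w : Plane × Plane) :
    fderiv ℝ f z w = fderiv ℝ f z (w.1, 0) + fderiv ℝ f z (0, w.2) := by
  rw [← map_add]; simp

theorem fderiv_snd_prod (z w : Plane × Plane) :
    fderiv ℝ (fun z : Plane × Plane => ((0 : Plane), z.2)) z w = (0, w.2) := by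
  have h : HasFDerivAt (fun z : Plane × Plane => ((0 : Plane), z.2))
    ((0 : Plane × Plane →L[ℝ] Plane).prod (ContinuousLinearMap.snd ℝ Plane Plane)) z :=
    (hasFDerivAt_const _ _).prodMk hasFDerivAt_snd
  rw [h.fderiv]; rfl

theorem differentiableAt_snd_prod (z : Plane × Plane) :
    DifferentiableAt ℝ (fun z : Plane × Plane => ((0 : Plane), z.2)) z :=
  (differentiableAt_const _).prodMk differentiableAt_snd

/-- Derivative of `z ↦ Df(z) X(z)`. -/
theorem fderiv_fderiv_apply {f : Plane × Plane → F} {X : Plane × Plane → Plane × Plane}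
    (hf : ContDiffAt ℝ ∞ f z) (hX : DifferentiableAt ℝ X z) (v : Plane × Plane) :
    fderiv ℝ (fun z => fderiv ℝ f z (X z)) z v =
      fderiv ℝ (fderiv ℝ f) z v (X z) + fderiv ℝ f z (fderiv ℝ X z v) := by
  rw [fderiv_clm_apply ((contDiffAt_fderiv hf).differentiableAt (by simp)) hX]
  simp [add_comm]

namespace LocalSpray

variable (hg : LocalSpray O g)

include hg

theorem eventually_mem (hz : z ∈ O) : ∀ᶠ z in 𝓝 z, z ∈ O := hg.isOpen.mem_nhds hz

theorem contDiffAt_sprayVec (hz : z ∈ O) : ContDiffAt ℝ ∞ (sprayVec g) z :=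
  contDiffAt_snd.prodMk (hg.smooth z hz)

theorem fderiv_sprayVec (hz : z ∈ O) (w : Plane × Plane) :
    fderiv ℝ (sprayVec g) z w = (w.2, fderiv ℝ g z w) := by
  have h : HasFDerivAt (sprayVec g) ((ContinuousLinearMap.snd ℝ Plane Plane).prod (fderiv ℝ g z)) z :=
    hasFDerivAt_snd.prodMk ((hg.smooth z hz).differentiableAt (by simp)).hasFDerivAt
  rw [h.fderiv]; rfl

theorem contDiffAt_nonlin (hz : z ∈ O) : ContDiffAt ℝ ∞ (nonlin g) z :=
  ((contDiffAt_fderiv (hg.smooth z hz)).clm_comp contDiffAt_const).const_smul _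

theorem contDiffAt_jac (hz : z ∈ O) : ContDiffAt ℝ ∞ (jac g) z := by
  have h1 := contDiffAt_fderiv (hg.smooth z hz)
  have h2 := hg.contDiffAt_nonlin hz
  exact ((h1.clm_comp contDiffAt_const).neg.sub
    ((contDiffAt_fderiv h2).clm_apply (hg.contDiffAt_sprayVec hz))).sub (h2.clm_comp h2)

theorem nonlin_self (hz : z ∈ O) : nonlin g z z.2 = -g z := by
  have h1 := hg.homogeneous z hz
  rw [fderiv_vert, ← smul_neg] at h1
  have := smul_right_injective Plane (two_ne_zero (α := ℝ)) h1
  simpa using congrArg Neg.neg this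

theorem hor_self (hz : z ∈ O) : hor g z z.2 = sprayVec g z := by
  rw [hor, hg.nonlin_self hz, neg_neg]; rfl

/-- Derivative of the horizontal lift of a constant vector. -/
theorem hasFDerivAt_hor (hz : z ∈ O) (a : Plane) (w : Plane × Plane) :
    DifferentiableAt ℝ (fun z => hor g z a) z ∧
      fderiv ℝ (fun z => hor g z a) z w = (0, -fderiv ℝ (nonlin g) z w a) := by
  have hN := ((hg.contDiffAt_nonlin hz).differentiableAt (by simp)).hasFDerivAt
  have h := (hasFDerivAt_const a z).prodMk (hN.clm_apply (hasFDerivAt_const a z)).neg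
  refine ⟨h.differentiableAt, ?_⟩
  have h' : HasFDerivAt (fun z => hor g z a) _ z := h
  rw [h'.fderiv]
  simp

/-- The Jacobi endomorphism kills the spray. -/
theorem jac_self (hz : z ∈ O) : jac g z z.2 = 0 := by
  have hN := (hg.contDiffAt_nonlin hz).differentiableAt (by simp)
  have e : (fun z : Plane × Plane => nonlin g z z.2) =ᶠ[𝓝 z] fun z => -g z := by
    filter_upwards [hg.eventually_mem hz] with w hw using hg.nonlin_self hw
  have h := DFunLike.congr_fun (e.fderiv_eq (𝕜 := ℝ)) (sprayVec g z)
  rw [fderiv_clm_apply hN differentiableAt_snd, fderiv_fun_neg] at h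
  simp only [fderiv_snd, _root_.add_apply, ContinuousLinearMap.comp_apply,
    ContinuousLinearMap.flip_apply, _root_.neg_apply, ContinuousLinearMap.coe_snd'] at h
  rw [fderiv_split (f := g) (sprayVec g z)] at h
  simp only [sprayVec] at h
  rw [fderiv_vert, fderiv_horiz] at h
  rw [hg.nonlin_self hz, map_neg] at h
  simp only [sprayVec] at h
  have : jac g z z.2 = -(-jac g z z.2 - (fderiv ℝ (nonlin g) z (z.2, g z)) z.2 - -nonlin g z (g z)
      + -((2 : ℝ) • nonlin g z (g z))) -
      (nonlin g z (g z) + (fderiv ℝ (nonlin g) z (z.2, g z)) z.2) := by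
    rw [two_smul]; abel
  rw [this, h, sub_self]

/-- The connection coefficients are homogeneous of degree one. -/
theorem fderiv_nonlin_vert (hz : z ∈ O) : fderiv ℝ (nonlin g) z (0, z.2) = nonlin g z := by
  have hgz := hg.smooth z hz
  have h1 := (contDiffAt_fderiv hgz).differentiableAt (by simp)
  ext1 a
  have e : (fun z : Plane × Plane => fderiv ℝ g z (0, z.2)) =ᶠ[𝓝 z] fun z => (2 : ℝ) • g z := by
    filter_upwards [hg.eventually_mem hz] with w hw using hg.homogeneous w hw
  have h := DFunLike.congr_fun (e.fderiv_eq (𝕜 := ℝ)) (0, a)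
  rw [fderiv_fderiv_apply hgz (differentiableAt_snd_prod z),
    fderiv_snd_prod, fderiv_fun_const_smul (hgz.differentiableAt (by simp)),
    _root_.smul_apply, two_smul, add_left_inj, fderiv_fderiv_symm hgz] at h
  have h2 : HasFDerivAt (nonlin g) _ z :=
    (h1.hasFDerivAt.clm_comp (hasFDerivAt_const (ContinuousLinearMap.inr ℝ Plane Plane) z)).const_smul
      (-(1 / 2 : ℝ))
  rw [h2.fderiv]
  simp [nonlin, h]

/-- The Jacobi endomorphism is homogeneous of degree two. -/
theorem fderiv_jac_vert (hz : z ∈ O) : fderiv ℝ (jac g) z (0, z.2) = (2 : ℝ) • jac g z := by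
  have hgz := hg.smooth z hz
  have h1 := (contDiffAt_fderiv hgz).differentiableAt (by simp)
  have hN := hg.contDiffAt_nonlin hz
  have hN1 := hN.differentiableAt (by simp)
  have hN2 := (contDiffAt_fderiv hN).differentiableAt (by simp)
  have hS := (hg.contDiffAt_sprayVec hz).differentiableAt (by simp)
  have d1 := (h1.hasFDerivAt.clm_comp
    (hasFDerivAt_const (ContinuousLinearMap.inl ℝ Plane Plane) z)).neg
  have d2 := hN2.hasFDerivAt.clm_apply hS.hasFDerivAt
  have d3 := hN1.hasFDerivAt.clm_comp hN1.hasFDerivAt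
  have d : HasFDerivAt (jac g) _ z := (d1.sub d2).sub d3
  have e1 : ∀ a, fderiv ℝ (fderiv ℝ g) z (0, z.2) (a, 0) = (2 : ℝ) • fderiv ℝ g z (a, 0) := by
    intro a
    have e : (fun z : Plane × Plane => fderiv ℝ g z (0, z.2)) =ᶠ[𝓝 z] fun z => (2 : ℝ) • g z := by
      filter_upwards [hg.eventually_mem hz] with w hw using hg.homogeneous w hw
    have h := DFunLike.congr_fun (e.fderiv_eq (𝕜 := ℝ)) (a, 0)
    rw [fderiv_fderiv_apply hgz (differentiableAt_snd_prod z),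
      fderiv_snd_prod, fderiv_fun_const_smul (hgz.differentiableAt (by simp)),
      _root_.smul_apply, fderiv_fderiv_symm hgz] at h
    have h0 : fderiv ℝ g z (0, 0) = 0 := map_zero _
    simpa [h0] using h
  have e2 : fderiv ℝ (fderiv ℝ (nonlin g)) z (0, z.2) (sprayVec g z) +
      fderiv ℝ (nonlin g) z (0, g z) = fderiv ℝ (nonlin g) z (sprayVec g z) := by
    have e : (fun z : Plane × Plane => fderiv ℝ (nonlin g) z (0, z.2)) =ᶠ[𝓝 z] nonlin g := by
      filter_upwards [hg.eventually_mem hz] with w hw using hg.fderiv_nonlin_vert hw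
    have h := DFunLike.congr_fun (e.fderiv_eq (𝕜 := ℝ)) (sprayVec g z)
    rwa [fderiv_fderiv_apply hN (differentiableAt_snd_prod z), fderiv_snd_prod,
      fderiv_fderiv_symm hN] at h
  have e3 : fderiv ℝ (nonlin g) z (fderiv ℝ (sprayVec g) z (0, z.2)) =
      fderiv ℝ (nonlin g) z (sprayVec g z) + fderiv ℝ (nonlin g) z (0, g z) := by
    rw [hg.fderiv_sprayVec hz, hg.homogeneous z hz, ← map_add]
    simp [sprayVec, two_smul]
  ext1 a
  rw [d.fderiv]
  simp only [_root_.sub_apply, _root_.neg_apply,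
    _root_.add_apply, ContinuousLinearMap.comp_apply, ContinuousLinearMap.flip_apply,
    ContinuousLinearMap.compL_apply, _root_.smul_apply, jac,
    hg.fderiv_nonlin_vert hz, e1, e3, ContinuousLinearMap.inl_apply]
  have e2a := DFunLike.congr_fun e2 a
  simp only [_root_.add_apply] at e2a
  rw [← e2a]
  simp
  module

end LocalSpray

end LocalCalculus

/-! ### Linear algebra in the plane and ranks of forms -/

section LinearAlgebra

theorem exists_ne_zero_of_plane_form (β : Plane →L[ℝ] ℝ) : ∃ u, u ≠ 0 ∧ β u = 0 := by
  have h : LinearMap.ker (β : Plane →ₗ[ℝ] ℝ) ≠ ⊥ := LinearMap.ker_ne_bot_of_finrank_lt (by simp)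
  obtain ⟨u, hu, hu0⟩ := Submodule.exists_mem_ne_zero_of_ne_bot h
  exact ⟨u, hu0, hu⟩

theorem plane_decomp {β : Plane →L[ℝ] ℝ} {y u : Plane} (hy : β y = 1) (hu : u ≠ 0) (hβu : β u = 0)
    (a : Plane) : ∃ t : ℝ, a = β a • y + t • u := by
  have hli : LinearIndependent ℝ ![y, u] := by
    rw [LinearIndependent.pair_iff]
    intro s t h
    have hs : s = 0 := by simpa [hy, hβu] using congrArg β h
    subst hs
    refine ⟨rfl, ?_⟩
    simpa [hu] using h
  have hspan := hli.span_eq_top_of_card_eq_finrank' (by simp)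
  have ha : a ∈ Submodule.span ℝ (range ![y, u]) := hspan ▸ Submodule.mem_top
  rw [Matrix.range_cons, Matrix.range_cons, Matrix.range_empty, union_empty,
    singleton_union, Submodule.mem_span_pair] at ha
  obtain ⟨s, t, rfl⟩ := ha
  exact ⟨t, by simp [hy, hβu]⟩

/-- A linear form on the plane that kills a nonzero endomorphism `R` with `β ∘ R = 0` and a vector
`y` with `β y = 1` is zero. -/
theorem plane_form_eq_zero {β δ : Plane →L[ℝ] ℝ} {R : Plane →L[ℝ] Plane} {y : Plane}
    (hy : β y = 1) (hβ : ∀ a, β (R a) = 0) (hR : R ≠ 0) (hδy : δ y = 0) (hδ : ∀ a, δ (R a) = 0) :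
    δ = 0 := by
  obtain ⟨a, ha⟩ : ∃ a, R a ≠ 0 := by
    by_contra! h
    exact hR (ContinuousLinearMap.ext h)
  ext b
  obtain ⟨t, ht⟩ := plane_decomp hy ha (hβ a) b
  rw [ht]
  simp [hδy, hδ]

/-- An endomorphism `R` of the plane with `R y = 0` and `β ∘ R = 0`, where `β y = 1`, is a multiple
of the projection `1 - β ⊗ y`; the factor is its trace. -/
theorem plane_isotropy {β : Plane →L[ℝ] ℝ} {R : Plane →L[ℝ] Plane} {y : Plane}
    (hy : β y = 1) (hβ : ∀ a, β (R a) = 0) (hRy : R y = 0) :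
    ∃ ρ : ℝ, ∀ a, R a = ρ • (a - β a • y) := by
  obtain ⟨u, hu, hβu⟩ := exists_ne_zero_of_plane_form β
  obtain ⟨ρ, hρ⟩ := plane_decomp hy hu hβu (R u)
  rw [hβ, zero_smul, zero_add] at hρ
  refine ⟨ρ, fun a => ?_⟩
  obtain ⟨t, ht⟩ := plane_decomp hy hu hβu a
  have h1 : a - β a • y = t • u := by rw [sub_eq_iff_eq_add']; exact ht
  rw [h1]
  conv_lhs => rw [ht]
  rw [map_add, map_smul, map_smul, hRy, hρ, smul_zero, zero_add, smul_comm]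

/-- The trace of an endomorphism of the plane. -/
def planeTrace (R : Plane →L[ℝ] Plane) : ℝ :=
  R (EuclideanSpace.single 0 1) 0 + R (EuclideanSpace.single 1 1) 1

theorem planeTrace_isotropic {β : Plane →L[ℝ] ℝ} {R : Plane →L[ℝ] Plane} {y : Plane} {ρ : ℝ}
    (hy : β y = 1) (h : ∀ a, R a = ρ • (a - β a • y)) : planeTrace R = ρ := by
  have hy2 : y = y 0 • EuclideanSpace.single 0 1 + y 1 • EuclideanSpace.single 1 1 := by
    ext i; fin_cases i <;> simp
  have h1 : y 0 * β (EuclideanSpace.single 0 1) + y 1 * β (EuclideanSpace.single 1 1) = 1 := by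
    have h := congrArg β hy2
    rw [hy, map_add, map_smul, map_smul] at h
    exact h.symm
  rw [planeTrace, h, h]
  simp
  linear_combination (-ρ) * h1

variable {W : Type*} [AddCommGroup W] [Module ℝ W]

/-- Rank of a skew form `θ` on a `4`-dimensional space in terms of a frame `c, s, h, v` with
`θ(c, s) ≠ 0` and `θ(c, h) = θ(c, v) = 0`: its Pfaffian is `± θ(c, s) θ(v, h)`. -/
theorem rank_two_iff [FiniteDimensional ℝ W] (hW : Module.finrank ℝ W = 4)
    {θ : LinearMap.BilinForm ℝ W} (hθ : ∀ x y, θ x y = -θ y x) {c s h v : W}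
    (hspan : ∀ x, ∃ i j k l : ℝ, x = i • c + j • s + k • h + l • v)
    (hcs : θ c s ≠ 0) (hch : θ c h = 0) (hcv : θ c v = 0) :
    Module.finrank ℝ (LinearMap.range θ) = 2 ↔ θ v h = 0 := by
  have hself : ∀ x, θ x x = 0 := fun x => by linarith [hθ x x]
  have hsc : θ s c ≠ 0 := by rw [hθ]; exact neg_ne_zero.2 hcs
  have hhc : θ h c = 0 := by rw [hθ, hch, neg_zero]
  have hvc : θ v c = 0 := by rw [hθ, hcv, neg_zero]
  constructor
  · intro hr
    by_contra hvh
    have hhv : θ h v ≠ 0 := by rw [hθ]; exact neg_ne_zero.2 hvh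
    -- If `θ(v, h) ≠ 0`, then `θ` is nondegenerate and has rank four.
    have hker : LinearMap.ker θ = ⊥ := by
      rw [LinearMap.ker_eq_bot']
      intro x hx
      have hx' : ∀ w, θ w x = 0 := fun w => by rw [hθ, hx]; simp
      obtain ⟨i, j, k, l, rfl⟩ := hspan x
      have h1 := hx' c
      have h2 := hx' v
      have h3 := hx' h
      have h4 := hx' s
      simp [hself, hch, hcv, hcs] at h1
      subst h1
      simp [hself, hvc, hvh] at h2
      subst h2
      simp [hhc, hhv] at h3
      subst h3
      simp [hsc] at h4
      subst h4
      simp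
    have := LinearMap.finrank_range_add_finrank_ker θ
    rw [hr, hker, finrank_bot, hW] at this
    omega
  · intro hvh
    have hhv : θ h v = 0 := by rw [hθ, hvh, neg_zero]
    -- Otherwise `θ h` and `θ v` are multiples of `θ c`, and `θ c`, `θ s` span the range.
    have eh : θ h = (θ h s / θ c s) • θ c := by
      ext x
      obtain ⟨i, j, k, l, rfl⟩ := hspan x
      simp [hself, hhc, hhv, hch, hcv]
      field_simp
    have ev : θ v = (θ v s / θ c s) • θ c := by
      ext x
      obtain ⟨i, j, k, l, rfl⟩ := hspan x
      simp [hself, hvc, hvh, hch, hcv]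
      field_simp
    have hli : LinearIndependent ℝ ![θ c, θ s] := by
      rw [LinearIndependent.pair_iff]
      intro a b hab
      have h1 := LinearMap.congr_fun hab s
      have h2 := LinearMap.congr_fun hab c
      simp [hself, hcs] at h1
      simp [hself, hsc] at h2
      exact ⟨h1, h2⟩
    have hr : LinearMap.range θ = Submodule.span ℝ (range ![θ c, θ s]) := by
      refine le_antisymm ?_ ?_
      · rintro _ ⟨x, rfl⟩
        obtain ⟨i, j, k, l, rfl⟩ := hspan x
        rw [Matrix.range_cons, Matrix.range_cons, Matrix.range_empty, union_empty,
          singleton_union, Submodule.mem_span_pair]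
        refine ⟨i + k * (θ h s / θ c s) + l * (θ v s / θ c s), j, ?_⟩
        rw [map_add, map_add, map_add, map_smul, map_smul, map_smul, map_smul, eh, ev]
        simp only [LinearMap.smul_apply, smul_eq_mul]
        rw [div_mul_cancel₀ _ hcs, div_mul_cancel₀ _ hcs]
        module
      · rw [Submodule.span_le]
        rintro _ ⟨i, rfl⟩
        fin_cases i
        · exact ⟨c, rfl⟩
        · exact ⟨s, rfl⟩
    rw [hr, finrank_span_eq_card hli]
    simp

/-- Rank of a bilinear form on the plane in terms of a basis `y, u` with `γ(y, y) ≠ 0` and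
`γ(y, u) = γ(u, y) = 0`. -/
theorem rank_one_iff {γ : Plane →ₗ[ℝ] Plane →L[ℝ] ℝ} {y u : Plane}
    (hspan : ∀ x, ∃ i j : ℝ, x = i • y + j • u)
    (hyy : γ y y ≠ 0) (hyu : γ y u = 0) (huy : γ u y = 0) :
    Module.finrank ℝ (LinearMap.range γ) = 1 ↔ γ u u = 0 := by
  constructor
  · intro hr
    by_contra huu
    have hker : LinearMap.ker γ = ⊥ := by
      rw [LinearMap.ker_eq_bot']
      intro x hx
      obtain ⟨i, j, rfl⟩ := hspan x
      have h1 := DFunLike.congr_fun hx y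
      have h2 := DFunLike.congr_fun hx u
      simp [huy, hyy] at h1
      simp [hyu, huu] at h2
      simp [h1, h2]
    have := LinearMap.finrank_range_add_finrank_ker γ
    rw [hr, hker, finrank_bot] at this
    simp at this
  · intro huu
    have hu : γ u = 0 := by
      ext x
      obtain ⟨i, j, rfl⟩ := hspan x
      simp [huy, huu]
    have hr : LinearMap.range γ = Submodule.span ℝ {γ y} := by
      refine le_antisymm ?_ ?_
      · rintro _ ⟨x, rfl⟩
        obtain ⟨i, j, rfl⟩ := hspan x
        rw [Submodule.mem_span_singleton]
        exact ⟨i, by simp [hu]⟩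
      · rw [Submodule.span_singleton_le_iff_mem]
        exact ⟨y, rfl⟩
    rw [hr]
    refine finrank_span_singleton fun h => hyy ?_
    rw [h]; rfl

end LinearAlgebra

section LocalForms

variable {O : Set (Plane × Plane)} {g : Plane × Plane → Plane} {z : Plane × Plane}

/-- A form that vanishes on horizontal vectors factors through the vertical projection. -/
theorem form_eq_vert {η : Plane × Plane →L[ℝ] ℝ} (h : ∀ a, η (hor g z a) = 0) (w : Plane × Plane) :
    η w = η (0, w.2 + nonlin g z w.1) := by
  have e : w = hor g z w.1 + (0, w.2 + nonlin g z w.1) := by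
    refine Prod.ext ?_ ?_ <;> simp [hor]
  conv_lhs => rw [e, map_add, h, zero_add]

/-- Derivative of the identity `η(𝒞) = 1`. For a closed form `η` it says that `ℒ_𝒞 η = 0`. -/
theorem fderiv_form_vert {η : Plane × Plane → Plane × Plane →L[ℝ] ℝ} (hη : DifferentiableAt ℝ η z)
    (h1 : ∀ᶠ z in 𝓝 z, η z (0, z.2) = 1) (w : Plane × Plane) :
    fderiv ℝ η z w (0, z.2) = -η z (0, w.2) := by
  have e : (fun z : Plane × Plane => η z (0, z.2)) =ᶠ[𝓝 z] fun _ => (1 : ℝ) := h1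
  have h := DFunLike.congr_fun (e.fderiv_eq (𝕜 := ℝ)) w
  rw [fderiv_clm_apply hη (differentiableAt_snd_prod z)] at h
  simp only [_root_.add_apply, ContinuousLinearMap.comp_apply, ContinuousLinearMap.flip_apply,
    fderiv_snd_prod] at h
  simp at h
  linarith

/-- The rank of `θ = ε d(i_J η) + 2 η ∧ i_J η`, for a form `η` that vanishes on horizontal vectors
and has `ℒ_𝒞 η = 0`, is governed by the vertical derivative of `η` along its kernel. Here `D` stands
for the derivative of `η`, and `T`, with inverse `B`, identifies a tangent space with its coordinate
space. The frame used consists of `𝒞`, `S` and the horizontal and vertical lifts of `u`; then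
`θ(𝒞, S) = 2 - ε` and `θ` of the two lifts is `ε D(0, u)(0, u)`. -/
theorem rank_form_iff {W : Type*} [AddCommGroup W] [Module ℝ W] [FiniteDimensional ℝ W]
    (hW : Module.finrank ℝ W = 4) {T : W → Plane × Plane} {B : Plane × Plane →ₗ[ℝ] W}
    (hTB : ∀ v, T (B v) = v) (hBT : ∀ w, B (T w) = w) {θ : LinearMap.BilinForm ℝ W}
    {D : Plane × Plane →L[ℝ] Plane × Plane →L[ℝ] ℝ} {η : Plane × Plane →L[ℝ] ℝ} {ε : ℝ}
    (hε : ε ≠ 2) (hε0 : ε ≠ 0)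
    (hθ : ∀ x y, θ x y = ε * (D (T x) (0, (T y).1) - D (T y) (0, (T x).1)) +
      2 * (η (T x) * η (0, (T y).1) - η (T y) * η (0, (T x).1)))
    (hη : ∀ a, η (hor g z a) = 0) (hη1 : η (0, z.2) = 1)
    (hD : ∀ b, D (0, z.2) (0, b) = -η (0, b)) {u : Plane} (hu : u ≠ 0) (hηu : η (0, u) = 0) :
    Module.finrank ℝ (LinearMap.range θ) = 2 ↔ D (0, u) (0, u) = 0 := by
  have z0 : ∀ L : Plane × Plane →L[ℝ] ℝ, L (0, 0) = 0 := fun L => map_zero L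
  have hdec := plane_decomp (β := η.comp (ContinuousLinearMap.inr ℝ Plane Plane)) (y := z.2) (u := u)
    (by simpa using hη1) hu (by simpa using hηu)
  have key := rank_two_iff hW (θ := θ) (c := B (0, z.2)) (s := B (hor g z z.2))
    (h := B (hor g z u)) (v := B (0, u)) (fun x y => by rw [hθ, hθ]; ring) ?_ ?_ ?_ ?_
  · rw [key, hθ, hTB, hTB, hη]
    simp [hor, z0, hηu, hε0]
  · intro x
    obtain ⟨t, ht⟩ := hdec (T x).1
    obtain ⟨t', ht'⟩ := hdec ((T x).2 + nonlin g z (T x).1)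
    set s := (η.comp (ContinuousLinearMap.inr ℝ Plane Plane)) (T x).1
    set s' := (η.comp (ContinuousLinearMap.inr ℝ Plane Plane)) ((T x).2 + nonlin g z (T x).1)
    refine ⟨s', s, t, t', ?_⟩
    rw [← map_smul, ← map_smul, ← map_smul, ← map_smul, ← map_add, ← map_add, ← map_add]
    conv_lhs => rw [← hBT x]
    congr 1
    refine Prod.ext ?_ ?_
    · simpa [hor] using ht
    · have h2 : (T x).2 = s' • z.2 + t' • u - nonlin g z (s • z.2 + t • u) := by
        rw [← ht, ← ht', add_sub_cancel_right]
      rw [h2]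
      simp [hor]
      abel
  · rw [hθ, hTB, hTB, hη]
    simp only [hor, hD, z0, hη1]
    intro h
    apply hε
    linarith
  · rw [hθ, hTB, hTB, hη]
    simp [hor, hD, z0, hη1, hηu]
  · rw [hθ, hTB, hTB]
    simp [z0]

end LocalForms

/-! ### Potentials of horizontal forms in coordinates -/

section LocalFinsler

variable {O : Set (Plane × Plane)} {g : Plane × Plane → Plane} {z : Plane × Plane}
  {E : Plane × Plane → ℝ}

/-- `(a, -2 N a)` is what the derivative of `S` produces from the vertical vector `(0, a)`. -/
theorem apply_two_hor (L : Plane × Plane →L[ℝ] ℝ) (a : Plane) :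
    L (a, -((2 : ℝ) • nonlin g z a)) = 2 * L (hor g z a) - L (a, 0) := by
  have e : (a, -((2 : ℝ) • nonlin g z a)) = (2 : ℝ) • hor g z a - (a, 0) := by
    refine Prod.ext ?_ ?_
    · simp only [hor, Prod.fst_sub, Prod.smul_fst]; module
    · simp [hor]
  rw [e, map_sub, map_smul, smul_eq_mul]

namespace LocalSpray

variable (hg : LocalSpray O g) (hE : ∀ z ∈ O, ContDiffAt ℝ ∞ E z)

include hg hE

/-- Derivative of the identity `dE(S) = 0`. -/
theorem fderiv_fderiv_spray (h : ∀ z ∈ O, fderiv ℝ E z (sprayVec g z) = 0) (hz : z ∈ O)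
    (w : Plane × Plane) :
    fderiv ℝ (fderiv ℝ E) z (sprayVec g z) w + fderiv ℝ E z (w.2, fderiv ℝ g z w) = 0 := by
  have e : (fun z => fderiv ℝ E z (sprayVec g z)) =ᶠ[𝓝 z] fun _ => (0 : ℝ) := by
    filter_upwards [hg.eventually_mem hz] with w hw using h w hw
  have h2 := DFunLike.congr_fun (e.fderiv_eq (𝕜 := ℝ)) w
  rw [fderiv_fderiv_apply (hE z hz) ((hg.contDiffAt_sprayVec hz).differentiableAt (by simp)),
    hg.fderiv_sprayVec hz, fderiv_fderiv_symm (hE z hz)] at h2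
  simpa using h2

/-- If `E` is constant along horizontal vectors, then `D²E(S, ∂_{y,a}) = ∂_{x,a} E`, which is the
Euler–Lagrange equation in a chart. -/
theorem fderiv_fderiv_spray_of_hor (h : ∀ z ∈ O, ∀ a, fderiv ℝ E z (hor g z a) = 0) (hz : z ∈ O)
    (a : Plane) :
    fderiv ℝ (fderiv ℝ E) z (sprayVec g z) (0, a) = fderiv ℝ E z (a, 0) := by
  have h1 := hg.fderiv_fderiv_spray hE (fun z hz => by rw [← hg.hor_self hz]; exact h z hz _) hz
    (0, a)
  rw [fderiv_vert, apply_two_hor, h z hz] at h1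
  linarith

/-- The Euler–Lagrange equation forces `E` to be constant along horizontal vectors. -/
theorem hor_of_eulerLagrange (h2 : ∀ z ∈ O, fderiv ℝ E z (0, z.2) = 2 * E z)
    (h : ∀ z ∈ O, ∀ w : Plane × Plane, fderiv ℝ (fderiv ℝ E) z (sprayVec g z) (0, w.1)
      - fderiv ℝ (fderiv ℝ E) z w (0, z.2) = -fderiv ℝ E z w) (hz : z ∈ O) (a : Plane) :
    fderiv ℝ E z (hor g z a) = 0 := by
  have hS : ∀ z ∈ O, fderiv ℝ E z (sprayVec g z) = 0 := by
    intro z hz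
    have := h z hz (sprayVec g z)
    rw [show (sprayVec g z).1 = z.2 from rfl, sub_self] at this
    linarith
  have h1 := hg.fderiv_fderiv_spray hE hS hz (0, a)
  rw [fderiv_vert, apply_two_hor] at h1
  have h3 := h z hz (a, 0)
  have e : (fun z => fderiv ℝ E z (0, z.2)) =ᶠ[𝓝 z] fun z => 2 * E z := by
    filter_upwards [hg.eventually_mem hz] with w hw using h2 w hw
  have h4 := DFunLike.congr_fun (e.fderiv_eq (𝕜 := ℝ)) (a, 0)
  rw [fderiv_fderiv_apply (hE z hz) (differentiableAt_snd_prod z), fderiv_snd_prod,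
    fderiv_const_mul ((hE z hz).differentiableAt (by simp))] at h4
  have h0 : fderiv ℝ E z (0, 0) = 0 := map_zero _
  simp only [h0, add_zero, _root_.smul_apply, smul_eq_mul] at h4
  simp only at h1 h3
  linarith

/-- A function that is constant along horizontal vectors is constant along the image of the
Jacobi endomorphism, since up to horizontal vectors that image is spanned by the brackets of `S`
with horizontal fields. -/
theorem jac_of_hor (h : ∀ z ∈ O, ∀ a, fderiv ℝ E z (hor g z a) = 0) (hz : z ∈ O) (a : Plane) :
    fderiv ℝ E z (0, jac g z a) = 0 := by
  have h1 := hg.fderiv_fderiv_spray hE (fun z hz => by rw [← hg.hor_self hz]; exact h z hz _) hz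
    (hor g z a)
  have e : (fun z => fderiv ℝ E z (hor g z a)) =ᶠ[𝓝 z] fun _ => (0 : ℝ) := by
    filter_upwards [hg.eventually_mem hz] with w hw using h w hw a
  have h2 := DFunLike.congr_fun (e.fderiv_eq (𝕜 := ℝ)) (sprayVec g z)
  rw [fderiv_fderiv_apply (hE z hz) (hg.hasFDerivAt_hor hz a 0).1,
    (hg.hasFDerivAt_hor hz a _).2] at h2
  have h3 := h z hz (nonlin g z a)
  have h4 : fderiv ℝ g z (hor g z a) = fderiv ℝ g z (a, 0) + (2 : ℝ) • nonlin g z (nonlin g z a) := by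
    rw [fderiv_split]
    simp only [hor]
    rw [fderiv_vert, map_neg]
    simp
  rw [h4, fderiv_horiz] at h1
  simp only [fderiv_fun_const, Pi.zero_apply, _root_.zero_apply] at h2
  -- `(0, R a)` is the difference of the two differentiated directions minus a horizontal vector.
  have h5 : ((0 : Plane), jac g z a) = (0, -fderiv ℝ (nonlin g) z (sprayVec g z) a)
      - ((hor g z a).2, -jac g z a - fderiv ℝ (nonlin g) z (sprayVec g z) a
        - nonlin g z (nonlin g z a) + (2 : ℝ) • nonlin g z (nonlin g z a))
      - hor g z (nonlin g z a) := by
    refine Prod.ext ?_ ?_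
    · simp [hor]
    · simp [hor]; module
  rw [h5, map_sub, map_sub, h3]
  linarith

omit hE

/-- The vertical part `β` of the form that annihilates the Berwald distribution and is normalised
on the Liouville field is homogeneous of degree `-1`: by the homogeneity of `R` and `y`, the sum of
`β` and its derivative along `𝒞` vanishes on `y` and on the image of `R`, which span the plane. -/
theorem fderiv_vertForm {β : Plane × Plane → Plane →L[ℝ] ℝ} (hz : z ∈ O)
    (hβ : DifferentiableAt ℝ β z) (h1 : ∀ z ∈ O, β z z.2 = 1) (hR : ∀ z ∈ O, ∀ a, β z (jac g z a) = 0)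
    (hne : jac g z ≠ 0) : fderiv ℝ β z (0, z.2) = -β z := by
  rw [eq_neg_iff_add_eq_zero]
  refine plane_form_eq_zero (h1 z hz) (hR z hz) hne ?_ ?_
  · have e : (fun z : Plane × Plane => β z z.2) =ᶠ[𝓝 z] fun _ => (1 : ℝ) := by
      filter_upwards [hg.eventually_mem hz] with w hw using h1 w hw
    have h := DFunLike.congr_fun (e.fderiv_eq (𝕜 := ℝ)) (0, z.2)
    rw [fderiv_clm_apply hβ differentiableAt_snd] at h
    simp only [fderiv_snd, _root_.add_apply, ContinuousLinearMap.comp_apply,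
      ContinuousLinearMap.flip_apply, ContinuousLinearMap.coe_snd', fderiv_fun_const, Pi.zero_apply,
      _root_.zero_apply] at h
    rw [_root_.add_apply, add_comm]
    exact h
  · intro a
    have e : (fun z : Plane × Plane => β z (jac g z a)) =ᶠ[𝓝 z] fun _ => (0 : ℝ) := by
      filter_upwards [hg.eventually_mem hz] with w hw using hR w hw a
    have hJ := ((hg.contDiffAt_jac hz).differentiableAt (by simp))
    have h := DFunLike.congr_fun (e.fderiv_eq (𝕜 := ℝ)) (0, z.2)
    rw [fderiv_clm_apply hβ (hJ.clm_apply (differentiableAt_const a)),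
      fderiv_clm_apply hJ (differentiableAt_const a)] at h
    simp only [fderiv_fun_const, Pi.zero_apply, ContinuousLinearMap.comp_zero, zero_add,
      _root_.add_apply, ContinuousLinearMap.comp_apply, ContinuousLinearMap.flip_apply,
      _root_.zero_apply, hg.fderiv_jac_vert hz, _root_.smul_apply, map_smul, hR z hz, smul_zero] at h
    rw [_root_.add_apply, hR z hz, add_zero]
    exact h

/-- The form `β(v)`, for `β` homogeneous of degree `-1` with `β(y) = 1`, satisfies
`dη(𝒞, ·) = 0`. -/
theorem fderiv_form_symm_vert {β : Plane × Plane → Plane →L[ℝ] ℝ}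
    {η : Plane × Plane → Plane × Plane →L[ℝ] ℝ} (hz : z ∈ O)
    (hβ : DifferentiableAt ℝ β z) (hη : DifferentiableAt ℝ η z)
    (h : ∀ z ∈ O, ∀ w, η z w = β z (w.2 + nonlin g z w.1))
    (h1 : ∀ z ∈ O, β z z.2 = 1) (hβh : fderiv ℝ β z (0, z.2) = -β z) (w : Plane × Plane) :
    fderiv ℝ η z (0, z.2) w = fderiv ℝ η z w (0, z.2) := by
  rw [fderiv_form_vert hη]
  swap
  · filter_upwards [hg.eventually_mem hz] with z hz
    rw [h z hz]
    simpa using h1 z hz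
  have e : (fun z : Plane × Plane => η z w) =ᶠ[𝓝 z] fun z => β z (w.2 + nonlin g z w.1) := by
    filter_upwards [hg.eventually_mem hz] with z hz using h z hz w
  have hN := (hg.contDiffAt_nonlin hz).differentiableAt (by simp)
  have hd := DFunLike.congr_fun (e.fderiv_eq (𝕜 := ℝ)) (0, z.2)
  rw [fderiv_clm_apply hη (differentiableAt_const w),
    fderiv_clm_apply hβ ((hN.clm_apply (differentiableAt_const w.1)).const_add _),
    fderiv_const_add, fderiv_clm_apply hN (differentiableAt_const w.1)] at hd
  simp only [fderiv_fun_const, Pi.zero_apply, ContinuousLinearMap.comp_zero, zero_add,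
    _root_.add_apply, ContinuousLinearMap.comp_apply, ContinuousLinearMap.flip_apply,
    hβh, hg.fderiv_nonlin_vert hz, _root_.neg_apply, map_add] at hd
  rw [h z hz]
  simp only [map_zero, add_zero]
  linarith

end LocalSpray

/-- Rank of the metric tensor of `E = F²`, in terms of the closed form `η = d log F`. -/
theorem metric_rank_iff {γ : Plane →ₗ[ℝ] Plane →L[ℝ] ℝ} {D : Plane × Plane →L[ℝ] Plane × Plane →L[ℝ] ℝ}
    {η : Plane × Plane →L[ℝ] ℝ} {c : ℝ} (hc : c ≠ 0) {y : Plane}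
    (hγ : ∀ a b, γ a b = c * (2 * (η (0, a) * η (0, b)) + D (0, a) (0, b)))
    (hη1 : η (0, y) = 1) (hD : ∀ b, D (0, y) (0, b) = -η (0, b))
    (hD' : ∀ b, D (0, b) (0, y) = -η (0, b)) {u : Plane} (hu : u ≠ 0) (hηu : η (0, u) = 0) :
    Module.finrank ℝ (LinearMap.range γ) = 1 ↔ D (0, u) (0, u) = 0 := by
  have hdec := plane_decomp (β := η.comp (ContinuousLinearMap.inr ℝ Plane Plane)) (y := y) (u := u)
    (by simpa using hη1) hu (by simpa using hηu)
  have key := rank_one_iff (γ := γ) (y := y) (u := u)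
    (fun x => let ⟨t, ht⟩ := hdec x; ⟨_, t, ht⟩) ?_ ?_ ?_
  · rw [key, hγ]
    simp [hηu, hc]
  · rw [hγ, hD, hη1]
    intro h
    apply hc
    linarith
  · rw [hγ, hD, hηu]; simp
  · rw [hγ, hD', hηu]; simp

end LocalFinsler

/-! ### The tensors of a spray in a chart -/

section SprayCharts

variable {M : Type*} [TopologicalSpace M] [ChartedSpace (EuclideanSpace ℝ (Fin 2)) M]
  [IsManifold (𝓡 2) ∞ M]

/-- The image of `A` in the chart of `TM` centred at `p₀`. -/
def chartDom (p₀ : TM M) (A : Set (TM M)) : Set (Plane × Plane) :=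
  (tchart p₀).target ∩ (tchart p₀).symm ⁻¹' A

/-- The fibre part of the spray `S` in the chart of `TM` centred at `p₀`. -/
def sprayCoeff (p₀ : TM M) (S : VField (𝓡 2).tangent (N := TM M)) (z : Plane × Plane) : Plane :=
  (coordField p₀ S z).2

variable {p₀ q : TM M} {A : Set (TM M)} {S : VField (𝓡 2).tangent (N := TM M)}

theorem mem_chartDom (hq : q ∈ (tchart p₀).source) (hqA : q ∈ A) :
    tchart p₀ q ∈ chartDom p₀ A :=
  ⟨(tchart p₀).map_source hq, by rwa [mem_preimage, (tchart p₀).left_inv hq]⟩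

theorem exists_of_mem_chartDom {z : Plane × Plane} (hz : z ∈ chartDom p₀ A) :
    ∃ q ∈ A, q ∈ (tchart p₀).source ∧ tchart p₀ q = z ∧ (tchart p₀).symm z = q :=
  ⟨(tchart p₀).symm z, hz.2, (tchart p₀).map_target hz.1, (tchart p₀).right_inv hz.1, rfl⟩

theorem isOpen_chartDom (hA : IsOpen A) : IsOpen (chartDom p₀ A) :=
  (continuousOn_extChartAt_symm p₀).isOpen_inter_preimage (isOpen_extChartAt_target p₀) hA

theorem snd_tchart_ne_zero (hq : q ∈ (tchart p₀).source) (h : q.2 ≠ 0) : (tchart p₀ q).2 ≠ 0 := by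
  rw [tchart_apply hq]
  intro h0
  apply h
  rw [← chartDerivInv_chartDeriv (mem_tchart_source.1 hq) q.2]
  rw [show chartDeriv (𝓡 2) p₀.1 q.1 q.2 = 0 from h0, map_zero]

theorem tderiv_injective (hq : q ∈ (tchart p₀).source) : Function.Injective (tderiv p₀ q) :=
  Function.LeftInverse.injective (chartDerivInv_chartDeriv hq)

theorem coordField_liouville {z : Plane × Plane} (hz : z ∈ (tchart p₀).target) :
    coordField p₀ (liouville M) z = (0, z.2) := by
  have := tderiv_liouville ((tchart p₀).map_target hz)
  rw [(tchart p₀).right_inv hz] at this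
  exact this

theorem coordField_spray (hS : IsSpray A S) {z : Plane × Plane} (hz : z ∈ chartDom p₀ A) :
    coordField p₀ S z = sprayVec (sprayCoeff p₀ S) z := by
  obtain ⟨q, hqA, hq, rfl, -⟩ := exists_of_mem_chartDom hz
  refine Prod.ext ?_ rfl
  have h1 := tderiv_tangentStr hq (S q)
  rw [hS.second_order q hqA, tderiv_liouville hq, ← coordField_chart hq S] at h1
  exact (congrArg Prod.snd h1).symm

theorem contDiffAt_coordField_spray (hA : IsOpen A) (hS : IsSpray A S) {z : Plane × Plane}
    (hz : z ∈ chartDom p₀ A) : ContDiffAt ℝ ∞ (coordField p₀ S) z := by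
  obtain ⟨q, hqA, hq, rfl, -⟩ := exists_of_mem_chartDom hz
  rw [← contMDiffAt_field_iff hq]
  exact (hS.smooth q hqA).contMDiffAt (hA.mem_nhds hqA)

theorem fderiv_coordField_spray (hA : IsOpen A) (hS : IsSpray A S) {z : Plane × Plane}
    (hz : z ∈ chartDom p₀ A) (w : Plane × Plane) :
    fderiv ℝ (coordField p₀ S) z w = (w.2, fderiv ℝ (sprayCoeff p₀ S) z w) := by
  have e : coordField p₀ S =ᶠ[𝓝 z] sprayVec (sprayCoeff p₀ S) := by
    filter_upwards [(isOpen_chartDom hA).mem_nhds hz] with z hz using coordField_spray hS hz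
  have hd : DifferentiableAt ℝ (sprayCoeff p₀ S) z :=
    ((contDiffAt_coordField_spray hA hS hz).snd).differentiableAt (by simp)
  have hs : HasFDerivAt (sprayVec (sprayCoeff p₀ S)) _ z := hasFDerivAt_snd.prodMk hd.hasFDerivAt
  rw [e.fderiv_eq, hs.fderiv]
  rfl

/-- In a chart, the coefficients of a spray form a local spray. -/
theorem localSpray (hA : IsOpen A) (hS : IsSpray A S) (p₀ : TM M) :
    LocalSpray (chartDom p₀ A) (sprayCoeff p₀ S) where
  isOpen := isOpen_chartDom hA
  smooth z hz := (contDiffAt_coordField_spray hA hS hz).snd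
  homogeneous z hz := by
    have hSd := (contDiffAt_coordField_spray hA hS hz).differentiableAt (by simp)
    have hDS := fderiv_coordField_spray hA hS hz (0, z.2)
    have hSz := coordField_spray hS hz
    obtain ⟨q, hqA, hq, rfl, -⟩ := exists_of_mem_chartDom hz
    have eC : coordField p₀ (liouville M) =ᶠ[𝓝 (tchart p₀ q)] fun z => (0, z.2) := by
      filter_upwards [eventually_mem_target hq] with z hz using coordField_liouville hz
    have hCd := (differentiableAt_snd_prod (tchart p₀ q)).congr_of_eventuallyEq eC
    have h := congrArg (tderiv p₀ q) (hS.homogeneous q hqA)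
    rw [(ofCoord_coordField hq (liouville M)).symm.mlieBracket_vectorField_eq
      (ofCoord_coordField hq S).symm, chartDeriv_mlieBracket_ofCoord hq hCd hSd,
      ← coordField_chart hq S, lieBracket, coordField_liouville ((tchart p₀).map_source hq), hDS,
      eC.fderiv_eq, fderiv_snd_prod, hSz] at h
    have h2 := congrArg Prod.snd h
    simp only [sprayVec, Prod.snd_sub] at h2
    rw [two_smul]
    exact sub_eq_iff_eq_add.1 h2

theorem coordEnd_tangentStr {z : Plane × Plane} (hz : z ∈ (tchart p₀).target) :
    coordEnd p₀ (tangentStr M) z =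
      (ContinuousLinearMap.inr ℝ Plane Plane).comp (ContinuousLinearMap.fst ℝ Plane Plane) := by
  have hq := (tchart p₀).map_target hz
  refine ContinuousLinearMap.ext fun v => ?_
  have h := coordEnd_chart hq (tangentStr M) (tderivInv p₀ _ v)
  rw [(tchart p₀).right_inv hz, chartDeriv_chartDerivInv hq] at h
  rw [h, tderiv_tangentStr hq]
  simp [chartDeriv_chartDerivInv hq, -extChartAt]

/-- In a chart, `ℒ_S J (a, b) = (-a, b + 2 N a)`. -/
theorem tderiv_lieDeriv_tangentStr (hA : IsOpen A) (hS : IsSpray A S)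
    (hq : q ∈ (tchart p₀).source) (hqA : q ∈ A) (w : TTM q) :
    tderiv p₀ q (lieDerivEnd S (tangentStr M) q w) =
      (-(tderiv p₀ q w).1, (tderiv p₀ q w).2 +
        (2 : ℝ) • nonlin (sprayCoeff p₀ S) (tchart p₀ q) (tderiv p₀ q w).1) := by
  have hz := mem_chartDom hq hqA
  have eJ : coordEnd p₀ (tangentStr M) =ᶠ[𝓝 (tchart p₀ q)] fun _ =>
      (ContinuousLinearMap.inr ℝ Plane Plane).comp (ContinuousLinearMap.fst ℝ Plane Plane) := by
    filter_upwards [eventually_mem_target hq] with z hz using coordEnd_tangentStr hz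
  rw [chartDeriv_lieDerivEnd hq
    ((contDiffAt_coordField_spray hA hS hz).differentiableAt (by simp))
    ((differentiableAt_const _).congr_of_eventuallyEq eJ), eJ.fderiv_eq, fderiv_fun_const,
    eJ.self_of_nhds, fderiv_coordField_spray hA hS hz, fderiv_coordField_spray hA hS hz]
  simp only [Pi.zero_apply, _root_.zero_apply, ContinuousLinearMap.comp_apply,
    ContinuousLinearMap.inr_apply, ContinuousLinearMap.coe_fst', fderiv_vert]
  generalize tderiv p₀ q w = w'
  rw [show ((0 : Plane × Plane)) = ((0 : Plane), (0 : Plane)) from rfl]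
  refine Prod.ext ?_ ?_
  · simp only [Prod.fst_add, Prod.fst_sub]; module
  · simp only [Prod.snd_add, Prod.snd_sub]; module

/-- In a chart, `h (a, b) = (a, -N a)`. -/
theorem tderiv_hproj (hA : IsOpen A) (hS : IsSpray A S)
    (hq : q ∈ (tchart p₀).source) (hqA : q ∈ A) (w : TTM q) :
    tderiv p₀ q (hproj S q w) = hor (sprayCoeff p₀ S) (tchart p₀ q) (tderiv p₀ q w).1 := by
  have h := tderiv_lieDeriv_tangentStr hA hS hq hqA w
  change tderiv p₀ q ((1 / 2 : ℝ) • (w - lieDerivEnd S (tangentStr M) q w)) = _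
  rw [map_smul, map_sub, h, hor]
  refine Prod.ext ?_ ?_
  · simp only [Prod.smul_fst, Prod.fst_sub]; module
  · simp only [Prod.smul_snd, Prod.snd_sub]; module

/-- In a chart, `v (a, b) = (0, b + N a)`. -/
theorem tderiv_vproj (hA : IsOpen A) (hS : IsSpray A S)
    (hq : q ∈ (tchart p₀).source) (hqA : q ∈ A) (w : TTM q) :
    tderiv p₀ q (vproj S q w) =
      (0, (tderiv p₀ q w).2 + nonlin (sprayCoeff p₀ S) (tchart p₀ q) (tderiv p₀ q w).1) := by
  have h := tderiv_lieDeriv_tangentStr hA hS hq hqA w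
  change tderiv p₀ q ((1 / 2 : ℝ) • (w + lieDerivEnd S (tangentStr M) q w)) = _
  rw [map_smul, map_add, h]
  refine Prod.ext ?_ ?_
  · simp only [Prod.smul_fst, Prod.fst_add]; module
  · simp only [Prod.smul_snd, Prod.snd_add]; module

/-- In a chart, `ℒ_S h (a, b) = (c, R a - N c)` with `c = b + N a`. -/
theorem tderiv_lieDeriv_hproj (hA : IsOpen A) (hS : IsSpray A S)
    (hq : q ∈ (tchart p₀).source) (hqA : q ∈ A) (w : TTM q) :
    tderiv p₀ q (lieDerivEnd S (hproj S) q w) =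
      hor (sprayCoeff p₀ S) (tchart p₀ q) ((tderiv p₀ q w).2 +
        nonlin (sprayCoeff p₀ S) (tchart p₀ q) (tderiv p₀ q w).1) +
      (0, jac (sprayCoeff p₀ S) (tchart p₀ q) (tderiv p₀ q w).1) := by
  have hz := mem_chartDom hq hqA
  have hg := localSpray hA hS p₀
  set g := sprayCoeff p₀ S with hgdef
  have eH : coordEnd p₀ (hproj S) =ᶠ[𝓝 (tchart p₀ q)] fun z =>
      (ContinuousLinearMap.inl ℝ Plane Plane).comp (ContinuousLinearMap.fst ℝ Plane Plane) -
        (ContinuousLinearMap.inr ℝ Plane Plane).comp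
          ((nonlin g z).comp (ContinuousLinearMap.fst ℝ Plane Plane)) := by
    filter_upwards [hg.eventually_mem hz] with z hz
    obtain ⟨r, hrA, hr, rfl, -⟩ := exists_of_mem_chartDom hz
    refine ContinuousLinearMap.ext fun v => ?_
    have h := coordEnd_chart hr (hproj S) (tderivInv p₀ r v)
    rw [tderiv_hproj hA hS hr hrA, chartDeriv_chartDerivInv hr] at h
    rw [h]
    simp [hor, hgdef]
  have hN := (hg.contDiffAt_nonlin hz).differentiableAt (by simp)
  have hHd : DifferentiableAt ℝ (coordEnd p₀ (hproj S)) (tchart p₀ q) := by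
    refine DifferentiableAt.congr_of_eventuallyEq ?_ eH
    exact (differentiableAt_const _).sub
      ((differentiableAt_const _).clm_comp (hN.clm_comp (differentiableAt_const _)))
  have hHa : ∀ v x, fderiv ℝ (coordEnd p₀ (hproj S)) (tchart p₀ q) x v =
      (0, -fderiv ℝ (nonlin g) (tchart p₀ q) x v.1) := by
    intro v x
    have e2 : (fun z => coordEnd p₀ (hproj S) z v) =ᶠ[𝓝 (tchart p₀ q)] fun z => hor g z v.1 := by
      filter_upwards [eH] with z hz
      rw [hz]
      simp [hor]
    have h3 := DFunLike.congr_fun (e2.fderiv_eq (𝕜 := ℝ)) x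
    rw [(hg.hasFDerivAt_hor hz v.1 x).2, fderiv_clm_apply hHd (differentiableAt_const _),
      fderiv_fun_const] at h3
    simpa using h3
  rw [chartDeriv_lieDerivEnd hq
    ((contDiffAt_coordField_spray hA hS hz).differentiableAt (by simp)) hHd, hHa,
    eH.self_of_nhds, fderiv_coordField_spray hA hS hz, fderiv_coordField_spray hA hS hz,
    coordField_spray hS hz, ← hgdef]
  have h4 := fderiv_split (f := g) (z := tchart p₀ q)
    ((tderiv p₀ q w).1, -nonlin g (tchart p₀ q) (tderiv p₀ q w).1)
  rw [fderiv_vert, fderiv_horiz] at h4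
  have h5 : ∀ v : Plane × Plane, ((ContinuousLinearMap.inl ℝ Plane Plane).comp
      (ContinuousLinearMap.fst ℝ Plane Plane) - (ContinuousLinearMap.inr ℝ Plane Plane).comp
        ((nonlin g (tchart p₀ q)).comp (ContinuousLinearMap.fst ℝ Plane Plane))) v =
      hor g (tchart p₀ q) v.1 := by
    intro v
    simp [hor]
  rw [h5, h5]
  simp only [h4, hor, map_add, map_neg]
  refine Prod.ext ?_ ?_
  · simp only [Prod.fst_add, Prod.fst_sub]; module
  · simp only [Prod.snd_add, Prod.snd_sub]; module

/-- In a chart, `Φ (a, b) = (0, R a)`. -/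
theorem tderiv_jacobi (hA : IsOpen A) (hS : IsSpray A S)
    (hq : q ∈ (tchart p₀).source) (hqA : q ∈ A) (w : TTM q) :
    tderiv p₀ q (jacobi S q w) =
      (0, jac (sprayCoeff p₀ S) (tchart p₀ q) (tderiv p₀ q w).1) := by
  rw [jacobi, ContinuousLinearMap.comp_apply, tderiv_vproj hA hS hq hqA,
    tderiv_lieDeriv_hproj hA hS hq hqA]
  refine Prod.ext rfl ?_
  simp only [hor, Prod.fst_add, Prod.snd_add, add_zero]
  abel

/-- In a chart, `𝔽 (a, b) = (c, -N c - a)` with `c = b + N a`. -/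
theorem tderiv_almostComplex (hA : IsOpen A) (hS : IsSpray A S)
    (hq : q ∈ (tchart p₀).source) (hqA : q ∈ A) (w : TTM q) :
    tderiv p₀ q (almostComplex S q w) =
      hor (sprayCoeff p₀ S) (tchart p₀ q) ((tderiv p₀ q w).2 +
        nonlin (sprayCoeff p₀ S) (tchart p₀ q) (tderiv p₀ q w).1) - (0, (tderiv p₀ q w).1) := by
  change tderiv p₀ q (hproj S q (lieDerivEnd S (hproj S) q w) - tangentStr M q w) = _
  rw [map_sub, tderiv_tangentStr hq, tderiv_hproj hA hS hq hqA, tderiv_lieDeriv_hproj hA hS hq hqA]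
  simp [hor]

theorem jac_ne_zero (hA : IsOpen A) (hS : IsSpray A S) (hflat : NonFlat A S)
    (hq : q ∈ (tchart p₀).source) (hqA : q ∈ A) : jac (sprayCoeff p₀ S) (tchart p₀ q) ≠ 0 := by
  intro h
  apply hflat q hqA
  ext1 w
  apply tderiv_injective (p₀ := p₀) hq
  rw [tderiv_jacobi hA hS hq hqA, h]
  simp [Prod.mk_zero_zero]

/-- A linear form annihilates the Berwald distribution iff, in a chart, it vanishes on horizontal
vectors and on the image of the Jacobi endomorphism. -/
theorem annihilates_iff (hA : IsOpen A) (hS : IsSpray A S) (hq : q ∈ (tchart p₀).source)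
    (hqA : q ∈ A) {η : TTM q →L[ℝ] ℝ} {η' : Plane × Plane →L[ℝ] ℝ}
    (h : ∀ w, η w = η' (tderiv p₀ q w)) :
    (∀ w ∈ berwald S q, η w = 0) ↔
      (∀ a, η' (hor (sprayCoeff p₀ S) (tchart p₀ q) a) = 0) ∧
      ∀ a, η' (0, jac (sprayCoeff p₀ S) (tchart p₀ q) a) = 0 := by
  constructor
  · intro h0
    refine ⟨fun a => ?_, fun a => ?_⟩
    · have := h0 (hproj S q (tderivInv p₀ q (a, 0)))
        (Submodule.mem_sup_left ⟨tderivInv p₀ q (a, 0), rfl⟩)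
      rwa [h, tderiv_hproj hA hS hq hqA, chartDeriv_chartDerivInv hq] at this
    · have := h0 (jacobi S q (tderivInv p₀ q (a, 0)))
        (Submodule.mem_sup_right ⟨tderivInv p₀ q (a, 0), rfl⟩)
      rwa [h, tderiv_jacobi hA hS hq hqA, chartDeriv_chartDerivInv hq] at this
  · rintro ⟨h1, h2⟩ w hw
    obtain ⟨_, ⟨a, rfl⟩, _, ⟨b, rfl⟩, rfl⟩ := Submodule.mem_sup.1 hw
    simp only [ContinuousLinearMap.coe_coe]
    rw [map_add, h, h, tderiv_hproj hA hS hq hqA, tderiv_jacobi hA hS hq hqA, h1, h2, add_zero]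

end SprayCharts

/-! ### Adapted one-forms and the three rank conditions -/

/-- In coordinates: a smooth `1`-form that annihilates the horizontal vectors and the image of the
Jacobi endomorphism, and takes the value one on the Liouville field. -/
structure AdaptedForm (O : Set (Plane × Plane)) (g : Plane × Plane → Plane)
    (η : Plane × Plane → Plane × Plane →L[ℝ] ℝ) : Prop where
  smooth : ∀ z ∈ O, ContDiffAt ℝ ∞ η z
  hor_eq_zero : ∀ z ∈ O, ∀ a, η z (hor g z a) = 0
  jac_eq_zero : ∀ z ∈ O, ∀ a, η z (0, jac g z a) = 0
  liouville_eq_one : ∀ z ∈ O, η z (0, z.2) = 1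

section Adapted

variable {M : Type*} [TopologicalSpace M] [ChartedSpace (EuclideanSpace ℝ (Fin 2)) M]
  [IsManifold (𝓡 2) ∞ M]

/-- A smooth `1`-form on `A` that annihilates the Berwald distribution of `S` and takes the value
one on the Liouville field. -/
structure IsAdapted (A : Set (TM M)) (S : VField (𝓡 2).tangent (N := TM M))
    (η : OneForm (𝓡 2).tangent (N := TM M)) : Prop where
  smooth : SmoothOneForm A η
  annihilates : ∀ p ∈ A, ∀ w ∈ berwald S p, η p w = 0
  liouville_eq_one : ∀ p ∈ A, η p (liouville M p) = 1

variable {p₀ q : TM M} {A : Set (TM M)} {S : VField (𝓡 2).tangent (N := TM M)}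
  {η ζ : OneForm (𝓡 2).tangent (N := TM M)}

theorem IsSpray.mono {U : Set (TM M)} (hS : IsSpray A S) (hU : U ⊆ A) : IsSpray U S where
  smooth p hp := (hS.smooth p (hU hp)).mono hU
  second_order p hp := hS.second_order p (hU hp)
  homogeneous p hp := hS.homogeneous p (hU hp)

theorem contDiffAt_coordForm_of_smooth (hA : IsOpen A) (hη : SmoothOneForm A η) {z : Plane × Plane}
    (hz : z ∈ chartDom p₀ A) : ContDiffAt ℝ ∞ (coordForm p₀ η) z := by
  obtain ⟨q, hqA, hq, rfl, -⟩ := exists_of_mem_chartDom hz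
  exact contDiffAt_coordForm hq ((hη q hqA).contMDiffAt (hA.mem_nhds hqA))

theorem smoothOneForm_of_coord
    (h : ∀ p ∈ A, ContDiffAt ℝ ∞ (coordForm p η) (tchart p p)) : SmoothOneForm A η :=
  fun p hp => (contMDiffAt_form_of_coord (h p hp)).contMDiffWithinAt

theorem IsAdapted.adaptedForm (hA : IsOpen A) (hS : IsSpray A S) (hη : IsAdapted A S η)
    (p₀ : TM M) : AdaptedForm (chartDom p₀ A) (sprayCoeff p₀ S) (coordForm p₀ η) := by
  have key : ∀ z ∈ chartDom p₀ A, (∀ a, coordForm p₀ η z (hor (sprayCoeff p₀ S) z a) = 0) ∧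
      ∀ a, coordForm p₀ η z (0, jac (sprayCoeff p₀ S) z a) = 0 := by
    intro z hz
    obtain ⟨q, hqA, hq, rfl, -⟩ := exists_of_mem_chartDom hz
    exact (annihilates_iff hA hS hq hqA fun w => (coordForm_chart hq η w).symm).1
      (hη.annihilates q hqA)
  refine ⟨fun z hz => contDiffAt_coordForm_of_smooth hA hη.smooth hz, fun z hz => (key z hz).1,
    fun z hz => (key z hz).2, fun z hz => ?_⟩
  obtain ⟨q, hqA, hq, rfl, -⟩ := exists_of_mem_chartDom hz
  rw [← tderiv_liouville hq, coordForm_chart hq, hη.liouville_eq_one q hqA]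

/-- A form that is adapted in every chart is adapted. -/
theorem isAdapted_of_coord (hA : IsOpen A) (hS : IsSpray A S)
    (h : ∀ p₀, AdaptedForm (chartDom p₀ A) (sprayCoeff p₀ S) (coordForm p₀ η)) :
    IsAdapted A S η := by
  have hs : ∀ p : TM M, p ∈ (tchart p).source := fun p => mem_extChartAt_source p
  refine ⟨smoothOneForm_of_coord fun p hp => (h p).smooth _ (mem_chartDom (hs p) hp),
    fun p hp => ?_, fun p hp => ?_⟩
  · exact (annihilates_iff hA hS (hs p) hp fun w => (coordForm_chart (hs p) η w).symm).2
      ⟨(h p).hor_eq_zero _ (mem_chartDom (hs p) hp), (h p).jac_eq_zero _ (mem_chartDom (hs p) hp)⟩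
  · rw [← coordForm_chart (hs p) η, tderiv_liouville (hs p),
      (h p).liouville_eq_one _ (mem_chartDom (hs p) hp)]

theorem extDer_eq_zero_iff (hq : q ∈ (tchart p₀).source)
    (hη : DifferentiableAt ℝ (coordForm p₀ η) (tchart p₀ q)) :
    extDer η q = 0 ↔ ∀ v w, fderiv ℝ (coordForm p₀ η) (tchart p₀ q) v w =
      fderiv ℝ (coordForm p₀ η) (tchart p₀ q) w v := by
  constructor
  · intro h v w
    have := extDer_chart hq hη (tderivInv p₀ q v) (tderivInv p₀ q w)
    rw [h, chartDeriv_chartDerivInv hq, chartDeriv_chartDerivInv hq] at this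
    exact (sub_eq_zero.1 this.symm)
  · intro h
    refine LinearMap.ext₂ fun v w => ?_
    rw [extDer_chart hq hη, h, sub_self]
    rfl

theorem finrank_TTM (q : TM M) : Module.finrank ℝ (TTM q) = 4 := by
  change Module.finrank ℝ (Plane × Plane) = 4
  simp

theorem coordForm_insertEnd_tangentStr {z : Plane × Plane} (hz : z ∈ (tchart p₀).target)
    (η : OneForm (𝓡 2).tangent (N := TM M)) :
    coordForm p₀ (insertEnd (tangentStr M) η) z = (coordForm p₀ η z).comp
      ((ContinuousLinearMap.inr ℝ Plane Plane).comp (ContinuousLinearMap.fst ℝ Plane Plane)) := by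
  have hq := (tchart p₀).map_target hz
  refine ContinuousLinearMap.ext fun v => ?_
  have h := coordForm_chart hq (insertEnd (tangentStr M) η) (tderivInv p₀ _ v)
  rw [(tchart p₀).right_inv hz, chartDeriv_chartDerivInv hq] at h
  have h2 := coordForm_chart hq η (tangentStr M _ (tderivInv p₀ _ v))
  rw [(tchart p₀).right_inv hz, tderiv_tangentStr hq, chartDeriv_chartDerivInv hq] at h2
  rw [h]
  exact h2.symm

/-- The exterior derivative of `i_J η` in a chart. -/
theorem extDer_insertEnd_tangentStr (hq : q ∈ (tchart p₀).source)
    (hη : DifferentiableAt ℝ (coordForm p₀ η) (tchart p₀ q))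
    (hζ : ∀ᶠ r in 𝓝 q, ζ r = insertEnd (tangentStr M) η r) (w₁ w₂ : TTM q) :
    extDer ζ q w₁ w₂ =
      fderiv ℝ (coordForm p₀ η) (tchart p₀ q) (tderiv p₀ q w₁) (0, (tderiv p₀ q w₂).1) -
      fderiv ℝ (coordForm p₀ η) (tchart p₀ q) (tderiv p₀ q w₂) (0, (tderiv p₀ q w₁).1) := by
  have e : coordForm p₀ ζ =ᶠ[𝓝 (tchart p₀ q)] fun z => (coordForm p₀ η z).comp
      ((ContinuousLinearMap.inr ℝ Plane Plane).comp (ContinuousLinearMap.fst ℝ Plane Plane)) := by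
    filter_upwards [eventually_mem_target hq, eventually_chart hq hζ] with z hz h
    rw [← coordForm_insertEnd_tangentStr hz, coordForm, h, coordForm]
  have hd := hη.clm_comp (differentiableAt_const
    ((ContinuousLinearMap.inr ℝ Plane Plane).comp (ContinuousLinearMap.fst ℝ Plane Plane)))
  rw [extDer_chart hq (hd.congr_of_eventuallyEq e), e.fderiv_eq,
    fderiv_clm_comp hη (differentiableAt_const _), fderiv_fun_const]
  simp

/-- The condition to which all three rank conditions reduce: the derivative of the
form along the vertical part of its kernel, evaluated on that vertical part, vanishes. -/
def FlatOnKernel (η : Plane × Plane → Plane × Plane →L[ℝ] ℝ) (z : Plane × Plane) : Prop :=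
  ∀ u : Plane, η z (0, u) = 0 → fderiv ℝ η z (0, u) (0, u) = 0

theorem flatOnKernel_of_exists_iff {P : Prop} {η : Plane × Plane → Plane × Plane →L[ℝ] ℝ}
    {z : Plane × Plane}
    (h : ∀ u : Plane, u ≠ 0 → η z (0, u) = 0 → (P ↔ fderiv ℝ η z (0, u) (0, u) = 0)) :
    P ↔ FlatOnKernel η z := by
  obtain ⟨u, hu, hηu⟩ := exists_ne_zero_of_plane_form
    ((η z).comp (ContinuousLinearMap.inr ℝ Plane Plane))
  refine ⟨fun hP u hu => ?_, fun hf => (h u hu hηu).2 (hf u hηu)⟩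
  rcases eq_or_ne u 0 with rfl | h0
  · simp [Prod.mk_zero_zero]
  · exact (h u h0 hu).1 hP

section

variable {O : Set (Plane × Plane)} {g : Plane × Plane → Plane} {z : Plane × Plane}
  {η : Plane × Plane → Plane × Plane →L[ℝ] ℝ}

theorem AdaptedForm.fderiv_liouville (hO : IsOpen O) (hη : AdaptedForm O g η) (hz : z ∈ O)
    (w : Plane × Plane) : fderiv ℝ η z w (0, z.2) = -η z (0, w.2) :=
  fderiv_form_vert ((hη.smooth z hz).differentiableAt (by simp))
    (by filter_upwards [hO.mem_nhds hz] with z hz using hη.liouville_eq_one z hz) w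

end

theorem IsAdapted.differentiableAt (hA : IsOpen A) (hη : IsAdapted A S η)
    (hq : q ∈ (tchart p₀).source) (hqA : q ∈ A) :
    DifferentiableAt ℝ (coordForm p₀ η) (tchart p₀ q) :=
  (contDiffAt_coordForm_of_smooth hA hη.smooth (mem_chartDom hq hqA)).differentiableAt (by simp)

/-- A `2`-form `ε d(i_J η) + 2 η ∧ i_J η` built from an adapted closed form `η` has rank two iff
`η` is flat on its kernel. -/
theorem rank_iff_flatOnKernel (hA : IsOpen A) (hS : IsSpray A S) (hη : IsAdapted A S η)
    (hq : q ∈ (tchart p₀).source) (hqA : q ∈ A) (hcl : extDer η q = 0)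
    {θ : TwoForm (𝓡 2).tangent (N := TM M)} {ε : ℝ} (hε : ε ≠ 2) (hε0 : ε ≠ 0)
    (hθ : ∀ x y : TTM q, θ q x y = ε * extDer (insertEnd (tangentStr M) η) q x y +
      2 * (η q x * η q (tangentStr M q y) - η q y * η q (tangentStr M q x))) :
    rankAt θ q = 2 ↔ FlatOnKernel (coordForm p₀ η) (tchart p₀ q) := by
  have hz := mem_chartDom hq hqA
  have hη' := hη.adaptedForm hA hS p₀
  have hd := hη.differentiableAt hA hq hqA
  have hsymm := (extDer_eq_zero_iff hq hd).1 hcl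
  have hfin : FiniteDimensional ℝ (TTM q) :=
    inferInstanceAs (FiniteDimensional ℝ (Plane × Plane))
  refine flatOnKernel_of_exists_iff fun u hu hηu => ?_
  refine rank_form_iff (finrank_TTM q) (T := tderiv p₀ q) (B := (tderivInv p₀ q).toLinearMap)
    (g := sprayCoeff p₀ S) (z := tchart p₀ q) (η := coordForm p₀ η (tchart p₀ q)) (ε := ε)
    (fun v => chartDeriv_chartDerivInv hq v) (fun w => chartDerivInv_chartDeriv hq w)
    hε hε0 (fun x y => ?_) (hη'.hor_eq_zero _ hz) (hη'.liouville_eq_one _ hz) (fun b => ?_) hu hηu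
  · rw [hθ, extDer_insertEnd_tangentStr hq hd (Eventually.of_forall fun _ => rfl),
      ← coordForm_chart hq η, ← coordForm_chart hq η, ← coordForm_chart hq η,
      ← coordForm_chart hq η, tderiv_tangentStr hq, tderiv_tangentStr hq]
  · rw [hsymm, hη'.fderiv_liouville (isOpen_chartDom hA) hz]

/-- For closed `η`, `d_J η = -d i_J η`, so that the case `ε = -1` applies. -/
theorem rank_dEnd_iff (hA : IsOpen A) (hS : IsSpray A S) (hη : IsAdapted A S η)
    (hq : q ∈ (tchart p₀).source) (hqA : q ∈ A) (hcl : extDer η q = 0) :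
    rankAt (dEnd (tangentStr M) η + 2 • wedge η (insertEnd (tangentStr M) η)) q = 2 ↔
      FlatOnKernel (coordForm p₀ η) (tchart p₀ q) := by
  refine rank_iff_flatOnKernel hA hS hη hq hqA hcl (ε := -1) (by norm_num) (by norm_num)
    fun x y => ?_
  simp only [dEnd, insertEnd₂, wedge, Pi.add_apply, Pi.sub_apply, Pi.smul_apply, hcl,
    LinearMap.add_apply, LinearMap.sub_apply, LinearMap.smul_apply, LinearMap.compl₁₂_apply,
    LinearMap.zero_apply, LinearMap.BilinForm.linMulLin_apply]
  simp [insertEnd]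
  ring

theorem extDer_congr (h : ∀ᶠ r in 𝓝 q, ζ r = η r)
    (hη : DifferentiableAt ℝ (coordForm q η) (tchart q q)) :
    extDer ζ q = extDer η q := by
  have hq : q ∈ (tchart q).source := mem_extChartAt_source q
  have e : coordForm q ζ =ᶠ[𝓝 (tchart q q)] coordForm q η := by
    filter_upwards [eventually_chart hq h] with z h
    rw [coordForm, h, coordForm]
  refine LinearMap.ext₂ fun v w => ?_
  rw [extDer_chart hq hη, extDer_chart hq (hη.congr_of_eventuallyEq e), e.fderiv_eq]

/-- The rank of `Ω` at `q`, if `α / ρ` is `i_J η` for a closed adapted form `η`. -/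
theorem rank_omegaForm_iff (hA : IsOpen A) (hS : IsSpray A S) (hη : IsAdapted A S η)
    (hq : q ∈ (tchart p₀).source) (hqA : q ∈ A) (hcl : extDer η q = 0) {ρ : TM M → ℝ}
    {α : OneForm (𝓡 2).tangent (N := TM M)}
    (hα : ∀ r ∈ A, (ρ r)⁻¹ • α r = insertEnd (tangentStr M) η r)
    (hF : ∀ w, η q (tangentStr M q (almostComplex S q w)) = η q w) :
    rankAt (omegaForm S ρ α) q = 2 ↔ FlatOnKernel (coordForm p₀ η) (tchart p₀ q) := by
  refine rank_iff_flatOnKernel hA hS hη hq hqA hcl (ε := 1) (by norm_num) (by norm_num)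
    fun x y => ?_
  have hs : q ∈ (tchart q).source := mem_extChartAt_source q
  have h1 : extDer (fun p => (ρ p)⁻¹ • α p) q = extDer (insertEnd (tangentStr M) η) q := by
    refine extDer_congr ?_ ?_
    · filter_upwards [hA.mem_nhds hqA] with r hr using hα r hr
    · refine ((hη.differentiableAt hA hs hqA).clm_comp (differentiableAt_const
        ((ContinuousLinearMap.inr ℝ Plane Plane).comp
          (ContinuousLinearMap.fst ℝ Plane Plane)))).congr_of_eventuallyEq ?_
      filter_upwards [eventually_mem_target hs] with z hz using coordForm_insertEnd_tangentStr hz η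
  have h2 : ∀ w, ((ρ q)⁻¹ • α q) w = η q (tangentStr M q w) := fun w => by rw [hα q hqA]; rfl
  simp only [omegaForm, wedge, insertEnd, Pi.add_apply, Pi.smul_apply, h1, LinearMap.add_apply,
    LinearMap.sub_apply, LinearMap.smul_apply, LinearMap.BilinForm.linMulLin_apply,
    ContinuousLinearMap.coe_coe, ContinuousLinearMap.comp_apply, h2, hF]
  simp
  ring

end Adapted

/-! ### Degenerate Finsler functions and their logarithmic differentials -/

/-- The second derivative of the restriction of a function to a fibre. -/
theorem fderiv_fderiv_fibre {E : Plane × Plane → ℝ} {x y : Plane} (hE : ContDiffAt ℝ ∞ E (x, y))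
    (a b : Plane) :
    fderiv ℝ (fderiv ℝ fun y => E (x, y)) y a b =
      fderiv ℝ (fderiv ℝ E) (x, y) (0, a) (0, b) := by
  have hc : ContinuousAt (fun y : Plane => (x, y)) y := by fun_prop
  have hi : ∀ y : Plane, HasFDerivAt (fun y : Plane => (x, y))
      (ContinuousLinearMap.inr ℝ Plane Plane) y := fun y => hasFDerivAt_prodMk_right x y
  have h1 : ∀ᶠ z in 𝓝 (x, y), ContDiffAt ℝ 1 E z :=
    (hE.of_le (m := 1) (by simp)).eventually (by simp)
  have e : (fderiv ℝ fun y => E (x, y)) =ᶠ[𝓝 y]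
      fun y => (fderiv ℝ E (x, y)).comp (ContinuousLinearMap.inr ℝ Plane Plane) := by
    filter_upwards [hc.eventually h1] with y' h
    exact ((h.differentiableAt (by simp)).hasFDerivAt.comp y' (hi y')).fderiv
  have h2 : HasFDerivAt (fun y => fderiv ℝ E (x, y)) _ y :=
    (((contDiffAt_fderiv hE).differentiableAt (by simp)).hasFDerivAt.comp y (hi y))
  rw [e.fderiv_eq, fderiv_clm_comp h2.differentiableAt (differentiableAt_const _), fderiv_fun_const,
    h2.fderiv]
  simp

section Finsler

variable {M : Type*} [TopologicalSpace M] [ChartedSpace (EuclideanSpace ℝ (Fin 2)) M]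
  [IsManifold (𝓡 2) ∞ M]

/-- The energy `F²` in the chart of `TM` centred at `p₀`. -/
def energy (p₀ : TM M) (F : TM M → ℝ) : Plane × Plane → ℝ :=
  (fun q => F q ^ 2) ∘ (tchart p₀).symm

variable {p₀ p q : TM M} {U : Set (TM M)} {S : VField (𝓡 2).tangent (N := TM M)}
  {η : OneForm (𝓡 2).tangent (N := TM M)} {F : TM M → ℝ}

theorem contDiffAt_comp_chart (hU : IsOpen U) {f : TM M → ℝ}
    (hf : ContMDiffOn (𝓡 2).tangent 𝓘(ℝ, ℝ) ∞ f U) {z : Plane × Plane} (hz : z ∈ chartDom p₀ U) :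
    ContDiffAt ℝ ∞ (f ∘ (tchart p₀).symm) z := by
  obtain ⟨q, hqU, hq, rfl, -⟩ := exists_of_mem_chartDom hz
  exact (contMDiffAt_iff_chart (n := ⊤) hq).1 ((hf q hqU).contMDiffAt (hU.mem_nhds hqU))

theorem contDiffAt_energy (hU : IsOpen U) (hF : ContMDiffOn (𝓡 2).tangent 𝓘(ℝ, ℝ) ∞ F U)
    {z : Plane × Plane} (hz : z ∈ chartDom p₀ U) : ContDiffAt ℝ ∞ (energy p₀ F) z :=
  (contDiffAt_comp_chart hU hF hz).pow 2

theorem coordForm_differential_energy (hU : IsOpen U) (hF : ContMDiffOn (𝓡 2).tangent 𝓘(ℝ, ℝ) ∞ F U)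
    {z : Plane × Plane} (hz : z ∈ chartDom p₀ U) :
    coordForm p₀ (differential (I := (𝓡 2).tangent) fun q => F q ^ 2) z = fderiv ℝ (energy p₀ F) z := by
  have h := (contDiffAt_energy hU hF hz).differentiableAt (by simp)
  obtain ⟨q, hqU, hq, rfl, -⟩ := exists_of_mem_chartDom hz
  exact coordForm_differential hq h

/-- `η` is the logarithmic differential `dF / F` on `U`, expressed by `dF² = 2 F² η`. -/
def IsLogDifferential (U : Set (TM M)) (F : TM M → ℝ)
    (η : OneForm (𝓡 2).tangent (N := TM M)) : Prop :=
  ∀ q ∈ U, differential (I := (𝓡 2).tangent) (fun q => F q ^ 2) q = (2 * F q ^ 2) • η q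

theorem IsLogDifferential.fderiv_energy (h : IsLogDifferential U F η) (hU : IsOpen U)
    (hF : ContMDiffOn (𝓡 2).tangent 𝓘(ℝ, ℝ) ∞ F U) {z : Plane × Plane} (hz : z ∈ chartDom p₀ U) :
    fderiv ℝ (energy p₀ F) z = (2 * energy p₀ F z) • coordForm p₀ η z := by
  rw [← coordForm_differential_energy hU hF hz, coordForm, h _ hz.2]
  rfl

/-- The metric tensor of a function with logarithmic differential `η` has rank one iff `η` is flat
on its kernel. -/
theorem rank_metricTensor_iff (hU : IsOpen U) (hS : IsSpray U S) (hη : IsAdapted U S η)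
    (hpU : p ∈ U) (hcl : extDer η p = 0) (hF : ContMDiffOn (𝓡 2).tangent 𝓘(ℝ, ℝ) ∞ F U)
    (hpos : 0 < F p) (hlog : IsLogDifferential U F η) :
    Module.finrank ℝ (LinearMap.range (metricTensor F p).toLinearMap) = 1 ↔
      FlatOnKernel (coordForm p η) (tchart p p) := by
  have hp : p ∈ (tchart p).source := mem_extChartAt_source p
  have hz := mem_chartDom hp hpU
  have hη' := hη.adaptedForm hU hS p
  have hd := hη.differentiableAt hU hp hpU
  have hsymm := (extDer_eq_zero_iff hp hd).1 hcl
  have hE := contDiffAt_energy (p₀ := p) hU hF hz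
  have hp2 : (p.2 : Plane) = (tchart p p).2 := (congrArg Prod.snd (tchart_self_fibre p p.2).2).symm
  have hfib : (fun y : Plane => F (⟨p.1, y⟩ : TM M) ^ 2) =
      fun y => energy p F ((tchart p p).1, y) := by
    funext y
    rw [← (tchart_self_fibre p y).2, energy, Function.comp_apply,
      (tchart p).left_inv (tchart_self_fibre p y).1]
  have hEp : energy p F (tchart p p) = F p ^ 2 := by
    rw [energy, Function.comp_apply, (tchart p).left_inv hp]
  have e : fderiv ℝ (energy p F) =ᶠ[𝓝 (tchart p p)]
      fun z => (2 * energy p F z) • coordForm p η z := by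
    filter_upwards [(isOpen_chartDom hU).mem_nhds hz] with z hz using hlog.fderiv_energy hU hF hz
  have hEd : DifferentiableAt ℝ (fun z => 2 * energy p F z) (tchart p p) :=
    (hE.differentiableAt (by simp)).const_mul 2
  have h2 : ∀ a b : Plane, metricTensor F p a b = F p ^ 2 *
      (2 * (coordForm p η (tchart p p) (0, a) * coordForm p η (tchart p p) (0, b)) +
        fderiv ℝ (coordForm p η) (tchart p p) (0, a) (0, b)) := by
    intro a b
    have h3 := fderiv_fderiv_fibre (x := (tchart p p).1) (y := (tchart p p).2) hE a b
    rw [Prod.mk.eta, e.fderiv_eq, fderiv_fun_smul hEd hd,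
      fderiv_const_mul (hE.differentiableAt (by simp)), e.self_of_nhds, hEp] at h3
    have hg : metricTensor F p = (1 / 2 : ℝ) • fderiv ℝ (fderiv ℝ
        fun y => energy p F ((tchart p p).1, y)) (tchart p p).2 := by
      rw [← hp2, ← hfib]
      rfl
    rw [hg]
    simp only [_root_.smul_apply, h3, hEp, _root_.add_apply, ContinuousLinearMap.smulRight_apply,
      smul_eq_mul]
    ring
  refine flatOnKernel_of_exists_iff fun u hu hηu => ?_
  exact metric_rank_iff (γ := (metricTensor F p).toLinearMap) (y := (tchart p p).2)
    (η := coordForm p η (tchart p p)) (pow_ne_zero 2 hpos.ne') h2 (hη'.liouville_eq_one _ hz)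
    (fun b => by rw [hsymm, hη'.fderiv_liouville (isOpen_chartDom hU) hz])
    (fun b => by rw [hη'.fderiv_liouville (isOpen_chartDom hU) hz]) hu hηu

/-- The Euler–Lagrange equation in a chart. -/
theorem eulerLagrange_iff (hU : IsOpen U) (hS : IsSpray U S)
    (hF : ContMDiffOn (𝓡 2).tangent 𝓘(ℝ, ℝ) ∞ F U) (hq : q ∈ (tchart p₀).source) (hqU : q ∈ U) :
    (∀ w : TTM q, extDer (insertEnd (tangentStr M) (differential (I := (𝓡 2).tangent) (fun q => F q ^ 2))) q (S q) w =
      -differential (I := (𝓡 2).tangent) (fun q => F q ^ 2) q w) ↔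
    ∀ w, fderiv ℝ (fderiv ℝ (energy p₀ F)) (tchart p₀ q)
        (sprayVec (sprayCoeff p₀ S) (tchart p₀ q)) (0, w.1)
      - fderiv ℝ (fderiv ℝ (energy p₀ F)) (tchart p₀ q) w (0, (tchart p₀ q).2) =
      -fderiv ℝ (energy p₀ F) (tchart p₀ q) w := by
  have hz := mem_chartDom hq hqU
  have e : coordForm p₀ (differential (I := (𝓡 2).tangent) fun q => F q ^ 2) =ᶠ[𝓝 (tchart p₀ q)]
      fderiv ℝ (energy p₀ F) := by
    filter_upwards [(isOpen_chartDom hU).mem_nhds hz] with z hz using coordForm_differential_energy hU hF hz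
  have hd : DifferentiableAt ℝ (coordForm p₀ (differential (I := (𝓡 2).tangent) fun q => F q ^ 2)) (tchart p₀ q) :=
    ((contDiffAt_fderiv (contDiffAt_energy hU hF hz)).differentiableAt
      (by simp)).congr_of_eventuallyEq e
  have hSq : tderiv p₀ q (S q) = sprayVec (sprayCoeff p₀ S) (tchart p₀ q) := by
    rw [← coordField_chart hq S, coordField_spray hS hz]
  have key : ∀ w : TTM q,
      (extDer (insertEnd (tangentStr M) (differential (I := (𝓡 2).tangent) (fun q => F q ^ 2))) q (S q) w =
        -differential (I := (𝓡 2).tangent) (fun q => F q ^ 2) q w) ↔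
      (fderiv ℝ (fderiv ℝ (energy p₀ F)) (tchart p₀ q)
        (sprayVec (sprayCoeff p₀ S) (tchart p₀ q)) (0, (tderiv p₀ q w).1)
      - fderiv ℝ (fderiv ℝ (energy p₀ F)) (tchart p₀ q) (tderiv p₀ q w) (0, (tchart p₀ q).2) =
      -fderiv ℝ (energy p₀ F) (tchart p₀ q) (tderiv p₀ q w)) := by
    intro w
    rw [extDer_insertEnd_tangentStr hq hd (Eventually.of_forall fun _ => rfl), e.fderiv_eq, hSq,
      ← coordForm_chart hq (differential _), e.self_of_nhds]
    rfl
  refine ⟨fun h w => ?_, fun h w => (key w).2 (h _)⟩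
  have := (key (tderivInv p₀ q w)).1 (h _)
  rwa [chartDeriv_chartDerivInv hq] at this

/-- Derivative of Euler's identity `DE(0, y) = 2 E`. -/
theorem fderiv_euler {O : Set (Plane × Plane)} {E : Plane × Plane → ℝ} (hO : IsOpen O)
    (h2 : ∀ z ∈ O, fderiv ℝ E z (0, z.2) = 2 * E z) {z : Plane × Plane} (hz : z ∈ O)
    (hE : ContDiffAt ℝ ∞ E z) (w : Plane × Plane) :
    fderiv ℝ (fderiv ℝ E) z w (0, z.2) = 2 * fderiv ℝ E z w - fderiv ℝ E z (0, w.2) := by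
  have h := fderiv_fderiv_apply hE (differentiableAt_snd_prod z) w
  have e : (fun z => fderiv ℝ E z (0, z.2)) =ᶠ[𝓝 z] fun z => 2 * E z := by
    filter_upwards [hO.mem_nhds hz] with z hz using h2 z hz
  rw [e.fderiv_eq, fderiv_const_mul (hE.differentiableAt (by simp)), fderiv_snd_prod] at h
  simp only [_root_.smul_apply, smul_eq_mul] at h
  linarith

theorem isLogDifferential_exp (hU : IsOpen U) {f : TM M → ℝ}
    (hf : ContMDiffOn (𝓡 2).tangent 𝓘(ℝ, ℝ) ∞ f U)
    (hη : ∀ q ∈ U, η q = differential (I := (𝓡 2).tangent) f q) :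
    IsLogDifferential U (fun q => Real.exp (f q)) η := by
  intro q hqU
  have hq : q ∈ (tchart q).source := mem_extChartAt_source q
  have hd := (contDiffAt_comp_chart (p₀ := q) hU hf (mem_chartDom hq hqU)).differentiableAt (by simp)
  have hd2 : HasFDerivAt ((fun q => Real.exp (f q) ^ 2) ∘ (tchart q).symm)
      _ (tchart q q) := hd.hasFDerivAt.exp.pow 2
  refine ContinuousLinearMap.ext fun w => ?_
  rw [differential, mvfderiv_eq_chart hq hd2.differentiableAt, hd2.fderiv, hη q hqU]
  simp only [_root_.smul_apply, smul_eq_mul, nsmul_eq_mul]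
  rw [differential, mvfderiv_eq_chart hq hd, Function.comp_apply, (tchart q).left_inv hq]
  ring

/-- A potential of a form that takes the value one on the Liouville field is logarithmically
homogeneous. -/
theorem potential_dilate (hU : IsOpenCone U) {f : TM M → ℝ}
    (hf : ContMDiffOn (𝓡 2).tangent 𝓘(ℝ, ℝ) ∞ f U) (hη : ∀ q ∈ U, η q = differential (I := (𝓡 2).tangent) f q)
    (h1 : ∀ q ∈ U, η q (liouville M q) = 1) (hp : p ∈ U) {c : ℝ} (hc : 0 < c) :
    f (dilate c p) = f p + Real.log c := by
  have hs : p ∈ (tchart p).source := mem_extChartAt_source p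
  have hder : ∀ t ∈ Ioi (0 : ℝ), HasDerivAt (fun t => f (dilate t p) - Real.log t) 0 t := by
    intro t ht
    have ht' : 0 < t := ht
    have hq := tchart_dilate hs t
    have hqU := hU.dilate_mem p hp t ht
    have hd := (contDiffAt_comp_chart (p₀ := p) hU.isOpen hf
      (mem_chartDom hq.1 hqU)).differentiableAt (by simp)
    have e1 : (fun t => f (dilate t p)) =
        fun t : ℝ => (f ∘ (tchart p).symm) ((tchart p p).1, t • (tchart p p).2) := by
      funext t
      rw [← (tchart_dilate hs t).2, Function.comp_apply, (tchart p).left_inv (tchart_dilate hs t).1]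
    have h2 : HasDerivAt (fun t : ℝ => ((tchart p p).1, t • (tchart p p).2))
        ((0 : Plane), (1 : ℝ) • (tchart p p).2) t :=
      (hasDerivAt_const t _).prodMk ((hasDerivAt_id t).smul_const _)
    have h3 := h1 _ hqU
    rw [hη _ hqU, differential, mvfderiv_eq_chart hq.1 hd, tderiv_liouville hq.1, hq.2] at h3
    rw [hq.2] at hd
    have h4 := hd.hasFDerivAt.comp_hasDerivAt t h2
    rw [one_smul] at h4
    have h5 : fderiv ℝ (f ∘ (tchart p).symm) ((tchart p p).1, t • (tchart p p).2)
        (0, (tchart p p).2) = t⁻¹ := by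
      have h6 : ((0 : Plane), t • (tchart p p).2) = t • ((0 : Plane), (tchart p p).2) := by
        rw [Prod.smul_mk, smul_zero]
      rw [h6, map_smul, smul_eq_mul] at h3
      field_simp
      linarith
    rw [h5] at h4
    have h7 : HasDerivAt (fun t => f (dilate t p)) t⁻¹ t := by rw [e1]; exact h4
    have h8 := h7.sub (Real.hasDerivAt_log ht'.ne')
    rw [sub_self] at h8
    exact h8
  have h := isOpen_Ioi.is_const_of_deriv_eq_zero (𝕜 := ℝ) isPreconnected_Ioi
    (fun t ht => (hder t ht).differentiableAt.differentiableWithinAt)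
    (fun t ht => (hder t ht).deriv) (mem_Ioi.2 hc) (mem_Ioi.2 one_pos)
  have hd1 : dilate 1 p = p := by rw [dilate, one_smul]
  rw [Real.log_one, hd1] at h
  linarith

/-- The exponential of a potential of an adapted closed form satisfying the rank condition is a
degenerate Finsler function that metrizes the spray. -/
theorem degMetrizable_of_potential (hU : IsOpenCone U) (hS : IsSpray U S) (hη : IsAdapted U S η)
    (hcl : ∀ q ∈ U, extDer η q = 0)
    (hrank : ∀ q ∈ U, rankAt (dEnd (tangentStr M) η + 2 • wedge η (insertEnd (tangentStr M) η)) q = 2)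
    {f : TM M → ℝ} (hf : ContMDiffOn (𝓡 2).tangent 𝓘(ℝ, ℝ) ∞ f U)
    (hfη : ∀ q ∈ U, η q = differential (I := (𝓡 2).tangent) f q) : DegMetrizableOn U S := by
  have hs : ∀ q : TM M, q ∈ (tchart q).source := fun q => mem_extChartAt_source q
  have hlog := isLogDifferential_exp hU.isOpen hf hfη
  have hF : ContMDiffOn (𝓡 2).tangent 𝓘(ℝ, ℝ) ∞ (fun q => Real.exp (f q)) U :=
    Real.contDiff_exp.contMDiff.comp_contMDiffOn hf
  refine ⟨fun q => Real.exp (f q), ⟨hF, fun p _ => Real.exp_pos _, fun p hp c hc => ?_,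
    fun p hp => ?_⟩, fun p hp => ?_⟩
  · rw [potential_dilate hU hf hfη hη.liouville_eq_one hp hc, Real.exp_add, Real.exp_log hc,
      mul_comm]
  · exact (rank_metricTensor_iff hU.isOpen hS hη hp (hcl p hp) hF (Real.exp_pos _) hlog).2
      ((rank_dEnd_iff hU.isOpen hS hη (hs p) hp (hcl p hp)).1 (hrank p hp))
  · refine (eulerLagrange_iff (p₀ := p) hU.isOpen hS hF (hs p) hp).2 fun w => ?_
    have hη' := hη.adaptedForm hU.isOpen hS p
    have hz := mem_chartDom (hs p) hp
    have hE := fun z (hz : z ∈ chartDom p U) => contDiffAt_energy hU.isOpen hF hz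
    have hDE := fun z (hz : z ∈ chartDom p U) => hlog.fderiv_energy hU.isOpen hF hz
    have h1 := (localSpray hU.isOpen hS p).fderiv_fderiv_spray_of_hor hE (fun z hz a => by
      rw [hDE z hz, _root_.smul_apply, hη'.hor_eq_zero z hz, smul_zero]) hz w.1
    have h2 := fderiv_euler (isOpen_chartDom hU.isOpen) (fun z hz => by
      rw [hDE z hz, _root_.smul_apply, hη'.liouville_eq_one z hz, smul_eq_mul, mul_one]) hz
      (hE _ hz) w
    rw [h1, h2, fderiv_split w]
    ring

/-- The logarithmic differential of a degenerate Finsler function that metrizes the spray is an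
adapted closed form. -/
theorem exists_adapted_of_metrizes (hU : IsOpenCone U) (hS : IsSpray U S)
    (hF : IsDegenerateFinsler U F) (hEL : EulerLagrange U S F) :
    ∃ η : OneForm (𝓡 2).tangent (N := TM M), IsAdapted U S η ∧ ∀ q ∈ U, extDer η q = 0 ∧
      rankAt (dEnd (tangentStr M) η + 2 • wedge η (insertEnd (tangentStr M) η)) q = 2 := by
  have hs : ∀ q : TM M, q ∈ (tchart q).source := fun q => mem_extChartAt_source q
  have hO := hU.isOpen
  have hE := fun p₀ z (hz : z ∈ chartDom p₀ U) => contDiffAt_energy hO hF.smooth hz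
  have hpos : ∀ p₀, ∀ z ∈ chartDom p₀ U, 0 < energy p₀ F z := fun p₀ z hz =>
    pow_pos (hF.pos _ hz.2) 2
  -- Euler's identity, from the homogeneity of `F` by differentiating at dilation factor one.
  have hEuler : ∀ p₀, ∀ z ∈ chartDom p₀ U,
      fderiv ℝ (energy p₀ F) z (0, z.2) = 2 * energy p₀ F z := by
    intro p₀ z hz
    have hd := (hE p₀ z hz).differentiableAt (by simp)
    obtain ⟨q, hqU, hq, rfl, -⟩ := exists_of_mem_chartDom hz
    have h2 : HasDerivAt (fun t : ℝ => ((tchart p₀ q).1, t • (tchart p₀ q).2))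
        ((0 : Plane), (1 : ℝ) • (tchart p₀ q).2) 1 :=
      (hasDerivAt_const _ _).prodMk ((hasDerivAt_id _).smul_const _)
    have h4 := HasFDerivAt.comp_hasDerivAt (1 : ℝ) (l := energy p₀ F)
      (l' := fderiv ℝ (energy p₀ F) (tchart p₀ q)) (by rw [one_smul]; exact hd.hasFDerivAt) h2
    have e : (energy p₀ F ∘ fun t : ℝ => ((tchart p₀ q).1, t • (tchart p₀ q).2)) =ᶠ[𝓝 1]
        fun t => t ^ 2 * F q ^ 2 := by
      filter_upwards [lt_mem_nhds (one_pos (α := ℝ))] with t ht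
      have h := tchart_dilate hq t
      rw [Function.comp_apply, ← h.2, energy, Function.comp_apply, (tchart p₀).left_inv h.1,
        hF.homogeneous q hqU t ht, mul_pow]
    have h5 := ((hasDerivAt_pow 2 (1 : ℝ)).mul_const (F q ^ 2)).congr_of_eventuallyEq e
    have h6 := h4.unique h5
    rw [one_smul] at h6
    rw [h6, energy, Function.comp_apply, (tchart p₀).left_inv hq]
    norm_num
  have hEL' : ∀ p₀, ∀ z ∈ chartDom p₀ U, ∀ w : Plane × Plane,
      fderiv ℝ (fderiv ℝ (energy p₀ F)) z (sprayVec (sprayCoeff p₀ S) z) (0, w.1)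
      - fderiv ℝ (fderiv ℝ (energy p₀ F)) z w (0, z.2) = -fderiv ℝ (energy p₀ F) z w := by
    intro p₀ z hz
    obtain ⟨q, hqU, hq, rfl, -⟩ := exists_of_mem_chartDom hz
    exact (eulerLagrange_iff hO hS hF.smooth hq hqU).1 (hEL q hqU)
  have hhor : ∀ p₀, ∀ z ∈ chartDom p₀ U, ∀ a,
      fderiv ℝ (energy p₀ F) z (hor (sprayCoeff p₀ S) z a) = 0 := fun p₀ z hz a =>
    (localSpray hO hS p₀).hor_of_eulerLagrange (hE p₀) (hEuler p₀) (hEL' p₀) hz a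
  have hjac : ∀ p₀, ∀ z ∈ chartDom p₀ U, ∀ a,
      fderiv ℝ (energy p₀ F) z (0, jac (sprayCoeff p₀ S) z a) = 0 := fun p₀ z hz a =>
    (localSpray hO hS p₀).jac_of_hor (hE p₀) (hhor p₀) hz a
  let η : OneForm (𝓡 2).tangent (N := TM M) :=
    fun q => (2 * F q ^ 2)⁻¹ • differential (fun q => F q ^ 2) q
  have hcoord : ∀ p₀, ∀ z ∈ chartDom p₀ U,
      coordForm p₀ η z = (2 * energy p₀ F z)⁻¹ • fderiv ℝ (energy p₀ F) z := by
    intro p₀ z hz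
    rw [← coordForm_differential_energy hO hF.smooth hz]
    rfl
  -- Locally `η` is the differential of `½ log F²`.
  have hlogd : ∀ p₀, ∀ z ∈ chartDom p₀ U, coordForm p₀ η =ᶠ[𝓝 z]
      fderiv ℝ fun z => (1 / 2 : ℝ) * Real.log (energy p₀ F z) := by
    intro p₀ z hz
    filter_upwards [(isOpen_chartDom hO).mem_nhds hz] with z hz
    rw [hcoord p₀ z hz, ((((hE p₀ z hz).differentiableAt (by simp)).hasFDerivAt.log
      (hpos p₀ z hz).ne').const_mul (1 / 2 : ℝ)).fderiv, smul_smul, mul_inv]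
    norm_num
  have hlogs : ∀ p₀, ∀ z ∈ chartDom p₀ U,
      ContDiffAt ℝ ∞ (fun z => (1 / 2 : ℝ) * Real.log (energy p₀ F z)) z := fun p₀ z hz =>
    contDiffAt_const.mul ((hE p₀ z hz).log (hpos p₀ z hz).ne')
  have hη : IsAdapted U S η := isAdapted_of_coord hO hS fun p₀ =>
    { smooth := fun z hz => (contDiffAt_fderiv (hlogs p₀ z hz)).congr_of_eventuallyEq
        (hlogd p₀ z hz)
      hor_eq_zero := fun z hz a => by
        rw [hcoord p₀ z hz, _root_.smul_apply, hhor p₀ z hz, smul_zero]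
      jac_eq_zero := fun z hz a => by
        rw [hcoord p₀ z hz, _root_.smul_apply, hjac p₀ z hz, smul_zero]
      liouville_eq_one := fun z hz => by
        rw [hcoord p₀ z hz, _root_.smul_apply, hEuler p₀ z hz, smul_eq_mul]
        exact inv_mul_cancel₀ (mul_pos two_pos (hpos p₀ z hz)).ne' }
  have hlog : IsLogDifferential U F η := by
    intro q hq
    have : 2 * F q ^ 2 ≠ 0 := (mul_pos two_pos (pow_pos (hF.pos q hq) 2)).ne'
    change _ = (2 * F q ^ 2) • (2 * F q ^ 2)⁻¹ • _
    rw [smul_smul, mul_inv_cancel₀ this, one_smul]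
  have hcl : ∀ q ∈ U, extDer η q = 0 := by
    intro q hq
    have hz := mem_chartDom (hs q) hq
    refine (extDer_eq_zero_iff (hs q) (hη.differentiableAt hO (hs q) hq)).2 fun v w => ?_
    rw [(hlogd q _ hz).fderiv_eq, fderiv_fderiv_symm (hlogs q _ hz)]
  refine ⟨η, hη, fun q hq => ⟨hcl q hq, ?_⟩⟩
  exact (rank_dEnd_iff hO hS hη (hs q) hq (hcl q hq)).2
    ((rank_metricTensor_iff hO hS hη hq (hcl q hq) hF.smooth (hF.pos q hq) hlog).1
      (hF.rank_eq_one q hq))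

end Finsler

/-! ### Uniqueness of the adapted form and local potentials -/

section Potentials

variable {M : Type*} [TopologicalSpace M] [ChartedSpace (EuclideanSpace ℝ (Fin 2)) M]
  [IsManifold (𝓡 2) ∞ M]

variable {p₀ p q : TM M} {A U : Set (TM M)} {S : VField (𝓡 2).tangent (N := TM M)}
  {η : OneForm (𝓡 2).tangent (N := TM M)}

theorem IsAdapted.mono (hη : IsAdapted A S η) (hU : U ⊆ A) : IsAdapted U S η where
  smooth p hp := (hη.smooth p (hU hp)).mono hU
  annihilates p hp := hη.annihilates p (hU hp)
  liouville_eq_one p hp := hη.liouville_eq_one p (hU hp)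

/-- Since `Φ ≠ 0`, the Berwald distribution and the Liouville field together span the tangent
space, so that an adapted form is unique. -/
theorem adapted_unique (hA : IsOpen A) (hS : IsSpray A S) (hflat : NonFlat A S) (hqA : q ∈ A)
    {η₁ η₂ : TTM q →L[ℝ] ℝ} (h₁ : ∀ w ∈ berwald S q, η₁ w = 0) (h₂ : ∀ w ∈ berwald S q, η₂ w = 0)
    (hC₁ : η₁ (liouville M q) = 1) (hC₂ : η₂ (liouville M q) = 1) : η₁ = η₂ := by
  have hq : q ∈ (tchart q).source := mem_extChartAt_source q
  have key : ∀ θ : TTM q →L[ℝ] ℝ, ∀ w, θ w = (θ.comp (tderivInv q q)) (tderiv q q w) := by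
    intro θ w
    rw [ContinuousLinearMap.comp_apply, chartDerivInv_chartDeriv hq]
  have k1 := (annihilates_iff hA hS hq hqA (key η₁)).1 h₁
  have k2 := (annihilates_iff hA hS hq hqA (key η₂)).1 h₂
  rw [key, tderiv_liouville hq] at hC₁ hC₂
  have h := plane_form_eq_zero
    (β := (η₁.comp (tderivInv q q)).comp (ContinuousLinearMap.inr ℝ Plane Plane))
    (δ := (η₁.comp (tderivInv q q)).comp (ContinuousLinearMap.inr ℝ Plane Plane) -
      (η₂.comp (tderivInv q q)).comp (ContinuousLinearMap.inr ℝ Plane Plane))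
    hC₁ k1.2 (jac_ne_zero hA hS hflat hq hqA) (sub_eq_zero.2 (hC₁.trans hC₂.symm))
    (fun a => sub_eq_zero.2 ((k1.2 a).trans (k2.2 a).symm))
  refine ContinuousLinearMap.ext fun w => ?_
  rw [key η₁, key η₂, form_eq_vert k1.1, form_eq_vert k2.1]
  exact sub_eq_zero.1 (DFunLike.congr_fun h _)

theorem eventually_coordForm_eq {ζ : OneForm (𝓡 2).tangent (N := TM M)}
    (hq : q ∈ (tchart p₀).source) (h : ∀ᶠ r in 𝓝 q, ζ r = η r) :
    coordForm p₀ ζ =ᶠ[𝓝 (tchart p₀ q)] coordForm p₀ η := by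
  filter_upwards [eventually_chart hq h] with z h
  rw [coordForm, h, coordForm]

/-- Locally defined adapted closed forms fit together. -/
theorem hasClosedAnnihilator_of_local (hA : IsOpen A) (hS : IsSpray A S) (hflat : NonFlat A S)
    (h : ∀ p ∈ A, ∃ U : Set (TM M), IsOpen U ∧ p ∈ U ∧ U ⊆ A ∧
      ∃ η : OneForm (𝓡 2).tangent (N := TM M), IsAdapted U S η ∧ ∀ q ∈ U, extDer η q = 0 ∧
      rankAt (dEnd (tangentStr M) η + 2 • wedge η (insertEnd (tangentStr M) η)) q = 2) :
    HasClosedAnnihilator A S := by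
  classical
  choose! U hU hpU hUA η hη hcl using h
  -- The value at `q` of the form chosen for the neighbourhood of `q`.
  let ζ : OneForm (𝓡 2).tangent (N := TM M) := fun q => η q q
  have hloc : ∀ p ∈ A, ∀ᶠ r in 𝓝 p, ζ r = η p r := by
    intro p hp
    filter_upwards [(hU p hp).mem_nhds (hpU p hp)] with r hr
    have hrA := hUA p hp hr
    exact adapted_unique hA hS hflat hrA ((hη r hrA).annihilates r (hpU r hrA))
      ((hη p hp).annihilates r hr) ((hη r hrA).liouville_eq_one r (hpU r hrA))
      ((hη p hp).liouville_eq_one r hr)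
  have hs : ∀ q : TM M, q ∈ (tchart q).source := fun q => mem_extChartAt_source q
  have hζ : IsAdapted A S ζ :=
    { smooth := smoothOneForm_of_coord fun p hp =>
        (contDiffAt_coordForm_of_smooth (hU p hp) (hη p hp).smooth
          (mem_chartDom (hs p) (hpU p hp))).congr_of_eventuallyEq
          (eventually_coordForm_eq (hs p) (hloc p hp))
      annihilates := fun p hp => (hη p hp).annihilates p (hpU p hp)
      liouville_eq_one := fun p hp => (hη p hp).liouville_eq_one p (hpU p hp) }
  have hζcl : ∀ p ∈ A, extDer ζ p = 0 := fun p hp => by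
    rw [extDer_congr (hloc p hp) ((hη p hp).differentiableAt (hU p hp) (hs p) (hpU p hp))]
    exact (hcl p hp p (hpU p hp)).1
  refine ⟨ζ, ⟨hζ.smooth, hζcl⟩, hζ.annihilates, hζ.liouville_eq_one, fun p hp => ?_⟩
  have e := eventually_coordForm_eq (hs p) (hloc p hp)
  have h1 := (rank_dEnd_iff (hU p hp) (hS.mono (hUA p hp)) (hη p hp) (hs p) (hpU p hp)
    (hcl p hp p (hpU p hp)).1).1 (hcl p hp p (hpU p hp)).2
  refine (rank_dEnd_iff hA hS hζ (hs p) hp (hζcl p hp)).2 fun u hu => ?_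
  rw [e.fderiv_eq]
  exact h1 u (by rwa [← e.self_of_nhds])

open scoped Pointwise in
/-- A closed form on an open cone has potentials on conic neighbourhoods of the points: in a chart,
the product of a ball and the cone over a ball is a convex conic neighbourhood. -/
theorem exists_conic_potential (hA : IsOpenCone A) (hη : ClosedOn A η) (hp : p ∈ A) :
    ∃ U : Set (TM M), IsOpenCone U ∧ p ∈ U ∧ U ⊆ A ∧ ∃ f : TM M → ℝ,
      ContMDiffOn (𝓡 2).tangent 𝓘(ℝ, ℝ) ∞ f U ∧
      ∀ q ∈ U, η q = differential (I := (𝓡 2).tangent) f q := by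
  have hs : p ∈ (tchart p).source := mem_extChartAt_source p
  have hO := isOpen_chartDom (p₀ := p) hA.isOpen
  obtain ⟨r, hr, hball⟩ := Metric.isOpen_iff.1 hO _ (mem_chartDom hs hp)
  rw [← ball_prod_same] at hball
  have hmem : ∀ y, y ∈ ConvexCone.hull ℝ (Metric.ball (tchart p p).2 r) ↔
      ∃ c : ℝ, 0 < c ∧ y ∈ c • Metric.ball (tchart p p).2 r := fun y =>
    ConvexCone.mem_hull_of_convex (convex_ball _ _)
  set K := ConvexCone.hull ℝ (Metric.ball (tchart p p).2 r) with hK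
  have hKopen : IsOpen (K : Set Plane) := by
    have : (K : Set Plane) = ⋃ c ∈ Ioi (0 : ℝ), c • Metric.ball (tchart p p).2 r := by
      ext y
      simp only [mem_iUnion, SetLike.mem_coe, hmem, exists_prop, mem_Ioi]
    rw [this]
    exact isOpen_biUnion fun c hc => Metric.isOpen_ball.smul₀ (ne_of_gt hc)
  set s : Set (Plane × Plane) := Metric.ball (tchart p p).1 r ×ˢ (K : Set Plane) with hsdef
  have hsopen : IsOpen s := Metric.isOpen_ball.prod hKopen
  have hsconv : Convex ℝ s := (convex_ball _ _).prod K.convex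
  have hsO : s ⊆ chartDom p A := by
    rintro ⟨x, y⟩ ⟨hx, hy⟩
    obtain ⟨c, hc, y', hy', rfl⟩ := (hmem y).1 hy
    obtain ⟨q, hqA, hq, hqz, -⟩ := exists_of_mem_chartDom (hball (mk_mem_prod hx hy'))
    have h := tchart_dilate hq c
    rw [hqz] at h
    rw [← h.2]
    exact mem_chartDom h.1 (hA.dilate_mem q hqA c hc)
  have hdiff : DifferentiableOn ℝ (coordForm p η) s := fun z hz =>
    ((contDiffAt_coordForm_of_smooth hA.isOpen hη.1
      (hsO hz)).differentiableAt (by simp)).differentiableWithinAt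
  obtain ⟨F, hF⟩ := hsconv.exists_forall_hasFDerivAt_of_fderiv_symmetric hsopen hdiff
    (fun z hz v w => by
      have hd := (contDiffAt_coordForm_of_smooth hA.isOpen hη.1 (hsO hz)).differentiableAt (by simp)
      obtain ⟨q, hqA, hq, rfl, -⟩ := exists_of_mem_chartDom (hsO hz)
      exact (extDer_eq_zero_iff hq hd).1 (hη.2 q hqA) v w)
  have hFs : ∀ z ∈ s, ContDiffAt ℝ ∞ F z := by
    have : ContDiffOn ℝ ∞ F s := by
      refine (contDiffOn_infty_iff_fderiv_of_isOpen hsopen).2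
        ⟨fun z hz => (hF z hz).differentiableAt.differentiableWithinAt, fun z hz => ?_⟩
      refine ((contDiffAt_coordForm_of_smooth hA.isOpen hη.1
        (hsO hz)).congr_of_eventuallyEq ?_).contDiffWithinAt
      filter_upwards [hsopen.mem_nhds hz] with z hz using (hF z hz).fderiv
    exact fun z hz => (this z hz).contDiffAt (hsopen.mem_nhds hz)
  have hUA : (tchart p).source ∩ tchart p ⁻¹' s ⊆ A := by
    rintro q ⟨hq, hqs⟩
    have := (hsO hqs).2
    rwa [mem_preimage, (tchart p).left_inv hq] at this
  refine ⟨(tchart p).source ∩ tchart p ⁻¹' s, ⟨?_, fun q hq => hA.ne_zero q (hUA hq), ?_⟩,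
    ⟨hs, Metric.mem_ball_self hr, ?_⟩, hUA, F ∘ tchart p, ?_, ?_⟩
  · exact (continuousOn_extChartAt p).isOpen_inter_preimage (isOpen_extChartAt_source p) hsopen
  · rintro q ⟨hq, hqs⟩ c hc
    have h := tchart_dilate hq c
    refine ⟨h.1, ?_⟩
    rw [mem_preimage, h.2]
    exact ⟨hqs.1, K.smul_mem hc hqs.2⟩
  · exact ConvexCone.subset_hull (Metric.mem_ball_self hr)
  · rintro q ⟨hq, hqs⟩
    exact ((hFs _ hqs).contMDiffAt.comp q (contMDiffAt_chart hq)).contMDiffWithinAt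
  · rintro q ⟨hq, hqs⟩
    have e : (F ∘ tchart p) ∘ (tchart p).symm =ᶠ[𝓝 (tchart p q)] F := by
      filter_upwards [eventually_mem_target hq] with z hz
      rw [Function.comp_apply, Function.comp_apply, (tchart p).right_inv hz]
    have hd := (hF _ hqs).congr_of_eventuallyEq e
    refine ContinuousLinearMap.ext fun w => ?_
    rw [differential, mvfderiv_eq_chart hq hd.differentiableAt, hd.fderiv, coordForm_chart hq]

theorem locallyDegMetrizable_of_hasClosedAnnihilator (hA : IsOpenCone A) (hS : IsSpray A S)
    (h : HasClosedAnnihilator A S) : LocallyDegMetrizable A S := by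
  obtain ⟨η, hcl, hann, hC, hrank⟩ := h
  intro p hp
  obtain ⟨U, hU, hpU, hUA, f, hf, hfη⟩ := exists_conic_potential hA hcl hp
  exact ⟨U, hU, hpU, hUA, degMetrizable_of_potential hU (hS.mono hUA)
    (IsAdapted.mono ⟨hcl.1, hann, hC⟩ hUA) (fun q hq => hcl.2 q (hUA hq))
    (fun q hq => hrank q (hUA hq)) hf hfη⟩

theorem hasClosedAnnihilator_of_locallyDegMetrizable (hA : IsOpen A) (hS : IsSpray A S)
    (hflat : NonFlat A S) (h : LocallyDegMetrizable A S) : HasClosedAnnihilator A S := by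
  refine hasClosedAnnihilator_of_local hA hS hflat fun p hp => ?_
  obtain ⟨U, hU, hpU, hUA, F, hF, hEL⟩ := h p hp
  exact ⟨U, hU.isOpen, hpU, hUA, exists_adapted_of_metrizes hU (hS.mono hUA) hF hEL⟩

end Potentials

/-! ### Isotropy data of an adapted form -/

theorem contDiff_planeTrace : ContDiff ℝ ∞ planeTrace := by
  have h : ∀ (v : Plane) (i : Fin 2), ContDiff ℝ ∞ fun R : Plane →L[ℝ] Plane => R v i := fun v i =>
    ((EuclideanSpace.proj i : Plane →L[ℝ] ℝ).contDiff).comp (contDiff_id.clm_apply contDiff_const)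
  exact (h _ _).add (h _ _)

section Isotropy

variable {M : Type*} [TopologicalSpace M] [ChartedSpace (EuclideanSpace ℝ (Fin 2)) M]
  [IsManifold (𝓡 2) ∞ M]

variable {p₀ p q : TM M} {A U : Set (TM M)} {S : VField (𝓡 2).tangent (N := TM M)}
  {η : OneForm (𝓡 2).tangent (N := TM M)}

/-- `J ∘ 𝔽` is the vertical projector. -/
theorem tangentStr_almostComplex (hA : IsOpen A) (hS : IsSpray A S) (hqA : q ∈ A) (w : TTM q) :
    tangentStr M q (almostComplex S q w) = vproj S q w := by
  have hq : q ∈ (tchart q).source := mem_extChartAt_source q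
  apply tderiv_injective hq
  rw [tderiv_tangentStr hq, tderiv_almostComplex hA hS hq hqA, tderiv_vproj hA hS hq hqA]
  simp [hor]

theorem hproj_add_vproj (w : TTM q) : hproj S q w + vproj S q w = w := by
  change (1 / 2 : ℝ) • (w - lieDerivEnd S (tangentStr M) q w) +
    (1 / 2 : ℝ) • (w + lieDerivEnd S (tangentStr M) q w) = w
  module

theorem form_tangentStr_almostComplex (hA : IsOpen A) (hS : IsSpray A S) (hη : IsAdapted A S η)
    (hqA : q ∈ A) (w : TTM q) : η q (tangentStr M q (almostComplex S q w)) = η q w := by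
  have h : η q (hproj S q w) = 0 := hη.annihilates q hqA _ (Submodule.mem_sup_left ⟨w, rfl⟩)
  rw [tangentStr_almostComplex hA hS hqA]
  conv_rhs => rw [← hproj_add_vproj (S := S) w, map_add, h, zero_add]

/-- An adapted form `η` determines the isotropy data pointwise: `Φ = ρ (J - i_J η ⊗ 𝒞)`. -/
theorem exists_isotropy (hA : IsOpen A) (hS : IsSpray A S) (hflat : NonFlat A S)
    (hη : IsAdapted A S η) (hqA : q ∈ A) : ∃ ρ : ℝ, ρ ≠ 0 ∧ ∀ w : TTM q,
      jacobi S q w = ρ • (tangentStr M q w - η q (tangentStr M q w) • liouville M q) := by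
  have hq : q ∈ (tchart q).source := mem_extChartAt_source q
  have hz := mem_chartDom hq hqA
  have hη' := hη.adaptedForm hA hS q
  have hiso : ∃ ρ : ℝ, ∀ a, jac (sprayCoeff q S) (tchart q q) a =
      ρ • (a - coordForm q η (tchart q q) (0, a) • (tchart q q).2) :=
    plane_isotropy (β := (coordForm q η (tchart q q)).comp (ContinuousLinearMap.inr ℝ Plane Plane))
      (hη'.liouville_eq_one _ hz) (hη'.jac_eq_zero _ hz) ((localSpray hA hS q).jac_self hz)
  obtain ⟨ρ, hρ⟩ := hiso
  have key : ∀ w : TTM q,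
      jacobi S q w = ρ • (tangentStr M q w - η q (tangentStr M q w) • liouville M q) := by
    intro w
    apply tderiv_injective hq
    rw [tderiv_jacobi hA hS hq hqA, hρ, map_smul, map_sub, map_smul, tderiv_liouville hq,
      ← coordForm_chart hq η, tderiv_tangentStr hq]
    simp
  refine ⟨ρ, ?_, key⟩
  rintro rfl
  refine hflat q hqA (ContinuousLinearMap.ext fun w => ?_)
  rw [key, zero_smul, _root_.zero_apply]

/-- The Berwald distribution is the kernel of the adapted form. -/
theorem mem_berwald_iff (hA : IsOpen A) (hS : IsSpray A S) (hflat : NonFlat A S)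
    (hη : IsAdapted A S η) (hqA : q ∈ A) (w : TTM q) : w ∈ berwald S q ↔ η q w = 0 := by
  refine ⟨hη.annihilates q hqA w, fun h => ?_⟩
  obtain ⟨ρ, hρ, hΦ⟩ := exists_isotropy hA hS hflat hη hqA
  refine Submodule.mem_sup.2 ⟨_, ⟨w, rfl⟩, _, ⟨ρ⁻¹ • almostComplex S q w, rfl⟩, ?_⟩
  simp only [ContinuousLinearMap.coe_coe]
  rw [map_smul, hΦ, form_tangentStr_almostComplex hA hS hη hqA, h, zero_smul, sub_zero, smul_smul,
    inv_mul_cancel₀ hρ, one_smul, tangentStr_almostComplex hA hS hqA, hproj_add_vproj]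

/-- A spray that admits an adapted closed form `η` satisfying the rank condition is degenerate, with
`α = ρ i_J η`. The factor `ρ`, obtained pointwise, is smooth because it is the trace of the Jacobi
endomorphism in any chart. -/
theorem degenerate_of_hasClosedAnnihilator (hA : IsOpen A) (hS : IsSpray A S) (hflat : NonFlat A S)
    (h : HasClosedAnnihilator A S) : Degenerate A S := by
  obtain ⟨η, hcl, hann, hC, hrank⟩ := h
  have hη : IsAdapted A S η := ⟨hcl.1, hann, hC⟩
  have hs : ∀ q : TM M, q ∈ (tchart q).source := fun q => mem_extChartAt_source q
  choose! ρ hρ hΦ using fun (q : TM M) (hqA : q ∈ A) => exists_isotropy hA hS hflat hη hqA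
  have htrace : ∀ p₀, ∀ z ∈ chartDom p₀ A,
      (ρ ∘ (tchart p₀).symm) z = planeTrace (jac (sprayCoeff p₀ S) z) := by
    intro p₀ z hz
    have hη' := hη.adaptedForm hA hS p₀
    have h1 := hη'.liouville_eq_one z hz
    obtain ⟨q, hqA, hq, rfl, hzq⟩ := exists_of_mem_chartDom hz
    rw [Function.comp_apply, hzq]
    refine (planeTrace_isotropic (β := (coordForm p₀ η (tchart p₀ q)).comp
      (ContinuousLinearMap.inr ℝ Plane Plane)) h1 fun a => ?_).symm
    have h2 := congrArg (tderiv p₀ q) (hΦ q hqA (tderivInv p₀ q (a, 0)))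
    rw [tderiv_jacobi hA hS hq hqA, map_smul, map_sub, map_smul, tderiv_liouville hq,
      ← coordForm_chart hq η, tderiv_tangentStr hq, chartDeriv_chartDerivInv hq] at h2
    exact congrArg Prod.snd h2
  have hρs : ∀ p ∈ A, ContDiffAt ℝ ∞ (ρ ∘ (tchart p).symm) (tchart p p) := by
    intro p hp
    have hz := mem_chartDom (hs p) hp
    refine (contDiff_planeTrace.contDiffAt.comp _
      ((localSpray hA hS p).contDiffAt_jac hz)).congr_of_eventuallyEq ?_
    filter_upwards [(isOpen_chartDom hA).mem_nhds hz] with z hz using htrace p z hz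
  let α : OneForm (𝓡 2).tangent (N := TM M) := fun q => ρ q • insertEnd (tangentStr M) η q
  refine ⟨ρ, α, ⟨fun p hp => ?_, smoothOneForm_of_coord fun p hp => ?_, fun p hp w hw => ?_,
    fun p hp w => ?_⟩, fun p hp => ⟨hρ p hp, ?_⟩⟩
  · exact ((contMDiffAt_iff_chart (n := ⊤) (hs p)).2 (hρs p hp)).contMDiffWithinAt
  · have hz := mem_chartDom (hs p) hp
    have hηs := contDiffAt_coordForm_of_smooth hA hcl.1 hz
    refine ((hρs p hp).smul (hηs.clm_comp (contDiffAt_const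
      (c := (ContinuousLinearMap.inr ℝ Plane Plane).comp
        (ContinuousLinearMap.fst ℝ Plane Plane))))).congr_of_eventuallyEq ?_
    filter_upwards [eventually_mem_target (hs p)] with z hz
    change _ = ρ ((tchart p).symm z) • ((coordForm p η z).comp _)
    rw [← coordForm_insertEnd_tangentStr hz]
    rfl
  · have : tangentStr M p w = 0 := by
      rw [tangentStr, ContinuousLinearMap.comp_apply, hw, map_zero]
    change ρ p • η p (tangentStr M p w) = 0
    rw [this, map_zero, smul_zero]
  · rw [hΦ p hp w, smul_sub, smul_smul]
    rfl
  · refine (rank_omegaForm_iff hA hS hη (hs p) hp (hcl.2 p hp) (fun r hr => ?_)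
      (form_tangentStr_almostComplex hA hS hη hp)).2
      ((rank_dEnd_iff hA hS hη (hs p) hp (hcl.2 p hp)).1 (hrank p hp))
    change (ρ r)⁻¹ • ρ r • insertEnd (tangentStr M) η r = _
    rw [smul_smul, inv_mul_cancel₀ (hρ r hr), one_smul]

/-- The form `η = i_𝔽 (α / ρ)` is adapted, `α / ρ = i_J η`, and `dη(𝒞, ·) = 0`. -/
theorem isAdapted_of_isotropyData (hA : IsOpenCone A) (hS : IsSpray A S) (hflat : NonFlat A S)
    {ρ : TM M → ℝ} {α : OneForm (𝓡 2).tangent (N := TM M)} (h : IsotropyData A S ρ α)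
    (hρ : ∀ p ∈ A, ρ p ≠ 0) :
    IsAdapted A S (insertEnd (almostComplex S) fun p => (ρ p)⁻¹ • α p) ∧
    (∀ p ∈ A, (ρ p)⁻¹ • α p =
      insertEnd (tangentStr M) (insertEnd (almostComplex S) fun p => (ρ p)⁻¹ • α p) p) ∧
    ∀ p₀, ∀ z ∈ chartDom p₀ A, ∀ w,
      fderiv ℝ (coordForm p₀ (insertEnd (almostComplex S) fun p => (ρ p)⁻¹ • α p)) z (0, z.2) w =
      fderiv ℝ (coordForm p₀ (insertEnd (almostComplex S) fun p => (ρ p)⁻¹ • α p)) z w (0, z.2) := by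
  set ζ : OneForm (𝓡 2).tangent (N := TM M) := fun p => (ρ p)⁻¹ • α p with hζ
  set η := insertEnd (almostComplex S) ζ with hη
  -- The semi-basic form `α / ρ` in a chart, as a form on the base.
  let β : TM M → Plane × Plane → Plane →L[ℝ] ℝ := fun p₀ z =>
    (coordForm p₀ ζ z).comp (ContinuousLinearMap.inl ℝ Plane Plane)
  have hζβ : ∀ p₀ q, q ∈ (tchart p₀).source → q ∈ A → ∀ w : TTM q,
      ζ q w = β p₀ (tchart p₀ q) (tderiv p₀ q w).1 := by
    intro p₀ q hq hqA w
    have h1 : ζ q (tderivInv p₀ q (0, (tderiv p₀ q w).2)) = 0 := by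
      have : dproj q (tderivInv p₀ q (0, (tderiv p₀ q w).2)) = 0 := by
        rw [dproj_eq_zero_iff hq, chartDeriv_chartDerivInv hq]
      change (ρ q)⁻¹ • α q _ = 0
      rw [h.semibasic q hqA _ this, smul_zero]
    have h2 : w = tderivInv p₀ q ((tderiv p₀ q w).1, 0) +
        tderivInv p₀ q (0, (tderiv p₀ q w).2) := by
      rw [← map_add, Prod.mk_add_mk, add_zero, zero_add, Prod.mk.eta, chartDerivInv_chartDeriv hq]
    conv_lhs => rw [h2, map_add, h1, add_zero, ← coordForm_chart hq ζ, chartDeriv_chartDerivInv hq]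
    rfl
  have hηβ : ∀ p₀, ∀ z ∈ chartDom p₀ A, ∀ w,
      coordForm p₀ η z w = β p₀ z (w.2 + nonlin (sprayCoeff p₀ S) z w.1) := by
    intro p₀ z hz w
    obtain ⟨q, hqA, hq, rfl, -⟩ := exists_of_mem_chartDom hz
    have h1 := coordForm_chart hq η (tderivInv p₀ q w)
    rw [chartDeriv_chartDerivInv hq] at h1
    rw [h1]
    change ζ q (almostComplex S q _) = _
    rw [hζβ p₀ q hq hqA, tderiv_almostComplex hA.isOpen hS hq hqA, chartDeriv_chartDerivInv hq]
    simp [hor]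
  have hRβ : ∀ p₀, ∀ z ∈ chartDom p₀ A, ∃ r : ℝ, r ≠ 0 ∧
      ∀ a, jac (sprayCoeff p₀ S) z a = r • (a - β p₀ z a • z.2) := by
    intro p₀ z hz
    obtain ⟨q, hqA, hq, rfl, -⟩ := exists_of_mem_chartDom hz
    refine ⟨ρ q, hρ q hqA, fun a => ?_⟩
    have h1 := congrArg (tderiv p₀ q) (h.jacobi_eq q hqA (tderivInv p₀ q (a, 0)))
    have h2 : α q (tderivInv p₀ q (a, 0)) = ρ q * β p₀ (tchart p₀ q) a := by
      have := hζβ p₀ q hq hqA (tderivInv p₀ q (a, 0))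
      rw [chartDeriv_chartDerivInv hq] at this
      rw [← this]
      change _ = ρ q * ((ρ q)⁻¹ * _)
      rw [mul_inv_cancel_left₀ (hρ q hqA)]
      rfl
    rw [tderiv_jacobi hA.isOpen hS hq hqA, map_sub, map_smul, map_smul, tderiv_liouville hq,
      tderiv_tangentStr hq, chartDeriv_chartDerivInv hq, h2] at h1
    rw [smul_sub, smul_smul]
    exact congrArg Prod.snd h1
  have hβ1 : ∀ p₀, ∀ z ∈ chartDom p₀ A, β p₀ z z.2 = 1 := by
    intro p₀ z hz
    obtain ⟨r, hr, hR⟩ := hRβ p₀ z hz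
    have h1 := hR z.2
    rw [(localSpray hA.isOpen hS p₀).jac_self hz] at h1
    have h2 : (1 - β p₀ z z.2) • z.2 = 0 := by
      rw [sub_smul, one_smul]
      exact (smul_eq_zero.1 h1.symm).resolve_left hr
    have hz2 : z.2 ≠ 0 := by
      obtain ⟨q, hqA, hq, rfl, -⟩ := exists_of_mem_chartDom hz
      exact snd_tchart_ne_zero hq (hA.ne_zero q hqA)
    exact (sub_eq_zero.1 ((smul_eq_zero.1 h2).resolve_right hz2)).symm
  have hβR : ∀ p₀, ∀ z ∈ chartDom p₀ A, ∀ a, β p₀ z (jac (sprayCoeff p₀ S) z a) = 0 := by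
    intro p₀ z hz a
    obtain ⟨r, hr, hR⟩ := hRβ p₀ z hz
    rw [hR, map_smul, map_sub, map_smul, hβ1 p₀ z hz]
    simp
  have hβs : ∀ p₀, ∀ z ∈ chartDom p₀ A, ContDiffAt ℝ ∞ (β p₀) z := by
    intro p₀ z hz
    have h1 := contDiffAt_comp_chart hA.isOpen h.smooth_ricci hz
    have h2 := contDiffAt_coordForm_of_smooth hA.isOpen h.smooth_form hz
    exact ((h1.inv (hρ _ hz.2)).smul h2).clm_comp contDiffAt_const
  have hηs : ∀ p₀, ∀ z ∈ chartDom p₀ A, ContDiffAt ℝ ∞ (coordForm p₀ η) z := by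
    intro p₀ z hz
    have hN := (localSpray hA.isOpen hS p₀).contDiffAt_nonlin hz
    refine ((hβs p₀ z hz).clm_comp ((contDiffAt_const
      (c := ContinuousLinearMap.snd ℝ Plane Plane)).add (hN.clm_comp (contDiffAt_const
      (c := ContinuousLinearMap.fst ℝ Plane Plane))))).congr_of_eventuallyEq ?_
    filter_upwards [(isOpen_chartDom hA.isOpen).mem_nhds hz] with z hz
    refine ContinuousLinearMap.ext fun w => ?_
    rw [hηβ p₀ z hz]
    rfl
  refine ⟨isAdapted_of_coord hA.isOpen hS fun p₀ => ⟨hηs p₀, fun z hz a => ?_, fun z hz a => ?_,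
    fun z hz => ?_⟩, fun p hp => ?_, fun p₀ z hz w => ?_⟩
  · rw [hηβ p₀ z hz]
    simp [hor]
  · rw [hηβ p₀ z hz, map_zero, add_zero]
    exact hβR p₀ z hz a
  · rw [hηβ p₀ z hz, map_zero, add_zero]
    exact hβ1 p₀ z hz
  · have hq : p ∈ (tchart p).source := mem_extChartAt_source p
    refine ContinuousLinearMap.ext fun w => ?_
    change ζ p w = ζ p (almostComplex S p (tangentStr M p w))
    rw [hζβ p p hq hp, hζβ p p hq hp, tderiv_almostComplex hA.isOpen hS hq hp, tderiv_tangentStr hq]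
    simp [hor]
  · have hβd := (hβs p₀ z hz).differentiableAt (by simp)
    refine (localSpray hA.isOpen hS p₀).fderiv_form_symm_vert hz hβd
      ((hηs p₀ z hz).differentiableAt (by simp)) (hηβ p₀) (hβ1 p₀) ?_ w
    refine (localSpray hA.isOpen hS p₀).fderiv_vertForm hz hβd (hβ1 p₀) (hβR p₀) ?_
    obtain ⟨q, hqA, hq, rfl, -⟩ := exists_of_mem_chartDom hz
    exact jac_ne_zero hA.isOpen hS hflat hq hqA

end Isotropy

/-! ### Integrability of the Berwald distribution -/

section Integrability

variable {M : Type*} [TopologicalSpace M] [ChartedSpace (EuclideanSpace ℝ (Fin 2)) M]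
  [IsManifold (𝓡 2) ∞ M]

variable {p₀ p q : TM M} {A U : Set (TM M)} {S : VField (𝓡 2).tangent (N := TM M)}
  {η : OneForm (𝓡 2).tangent (N := TM M)}

/-- The derivative of a parametrization, read in a chart. -/
theorem tderiv_mfderiv {k : ℕ} {ψ : EuclideanSpace ℝ (Fin k) → TM M} {u : EuclideanSpace ℝ (Fin k)}
    (hψ : MDifferentiableAt (𝓡 k) (𝓡 2).tangent ψ u) (hu : ψ u ∈ (tchart p₀).source)
    (v : EuclideanSpace ℝ (Fin k)) :
    tderiv p₀ (ψ u) (mfderiv (𝓡 k) (𝓡 2).tangent ψ u v) = fderiv ℝ (tchart p₀ ∘ ψ) u v := by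
  have h := mfderiv_comp u ((contMDiffAt_chart hu).mdifferentiableAt (by simp)) hψ
  rw [mfderiv_eq_fderiv] at h
  exact (DFunLike.congr_fun h v).symm

/-- The exterior derivative of a form vanishes on the tangent spaces of the submanifolds on which
the form itself vanishes. -/
theorem extDer_eq_zero_of_integrable {k : ℕ} {D : Π p : TM M, Submodule ℝ (TTM p)} (hA : IsOpen A)
    (hη : SmoothOneForm A η) (hηD : ∀ p ∈ A, ∀ w ∈ D p, η p w = 0)
    (hD : IntegrableDistribution k A D) (hqA : q ∈ A) {d₁ d₂ : TTM q} (h₁ : d₁ ∈ D q)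
    (h₂ : d₂ ∈ D q) : extDer η q d₁ d₂ = 0 := by
  obtain ⟨W, ψ, hW, h0, rfl, hψ, hWψ⟩ := hD q hqA
  have hq : ψ 0 ∈ (tchart (ψ 0)).source := mem_extChartAt_source _
  have hz := mem_chartDom hq hqA
  have hd := (contDiffAt_coordForm_of_smooth hA hη hz).differentiableAt (by simp)
  have hψa : ∀ u ∈ W, ContMDiffAt (𝓡 k) (𝓡 2).tangent ∞ ψ u := fun u hu =>
    (hψ u hu).contMDiffAt (hW.mem_nhds hu)
  have hψd : ∀ u ∈ W, MDifferentiableAt (𝓡 k) (𝓡 2).tangent ψ u := fun u hu =>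
    (hψa u hu).mdifferentiableAt (by simp)
  set φ := tchart (ψ 0) ∘ ψ with hφ
  have hφs : ContDiffAt ℝ ∞ φ 0 := ((contMDiffAt_chart hq).comp 0 (hψa 0 h0)).contDiffAt
  have hsrc : ∀ᶠ u in 𝓝 (0 : EuclideanSpace ℝ (Fin k)), ψ u ∈ (tchart (ψ 0)).source :=
    (hψa 0 h0).continuousAt.eventually (eventually_mem_source hq)
  have hvanish : ∀ v, (fun u => coordForm (ψ 0) η (φ u) (fderiv ℝ φ u v)) =ᶠ[𝓝 0] fun _ => 0 := by
    intro v
    filter_upwards [hsrc, hW.mem_nhds h0] with u hu huW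
    obtain ⟨huA, -, hur⟩ := hWψ u huW
    rw [hφ, ← tderiv_mfderiv (hψd u huW) hu, Function.comp_apply, coordForm_chart hu]
    refine hηD _ huA _ ?_
    rw [← hur]
    exact ⟨v, rfl⟩
  have hcomp : DifferentiableAt ℝ (fun u => coordForm (ψ 0) η (φ u)) 0 :=
    DifferentiableAt.comp (0 : EuclideanSpace ℝ (Fin k)) (g := coordForm (ψ 0) η) hd
      (hφs.differentiableAt (by simp))
  have hfc : fderiv ℝ (fun u => coordForm (ψ 0) η (φ u)) 0 =
      (fderiv ℝ (coordForm (ψ 0) η) (φ 0)).comp (fderiv ℝ φ 0) :=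
    fderiv_comp (0 : EuclideanSpace ℝ (Fin k)) (g := coordForm (ψ 0) η) hd
      (hφs.differentiableAt (by simp))
  have hφ2 := (contDiffAt_fderiv hφs).differentiableAt (by simp)
  have key : ∀ v v', fderiv ℝ (coordForm (ψ 0) η) (φ 0) (fderiv ℝ φ 0 v') (fderiv ℝ φ 0 v) =
      -coordForm (ψ 0) η (φ 0) (fderiv ℝ (fderiv ℝ φ) 0 v' v) := by
    intro v v'
    have h := DFunLike.congr_fun ((hvanish v).fderiv_eq (𝕜 := ℝ)) v'
    rw [fderiv_fun_const, fderiv_clm_apply hcomp (hφ2.clm_apply (differentiableAt_const _)),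
      fderiv_clm_apply hφ2 (differentiableAt_const _), fderiv_fun_const, hfc] at h
    simp only [_root_.add_apply, ContinuousLinearMap.comp_apply, ContinuousLinearMap.flip_apply,
      Pi.zero_apply, _root_.zero_apply, map_zero, zero_add] at h
    linarith
  have key' : ∀ v v', fderiv ℝ (coordForm (ψ 0) η) (φ 0) (fderiv ℝ φ 0 v) (fderiv ℝ φ 0 v') -
      fderiv ℝ (coordForm (ψ 0) η) (φ 0) (fderiv ℝ φ 0 v') (fderiv ℝ φ 0 v) = 0 := fun v v' => by
    rw [key, key, fderiv_fderiv_symm hφs, sub_self]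
  obtain ⟨-, -, hr⟩ := hWψ 0 h0
  rw [← hr] at h₁ h₂
  obtain ⟨v₁, rfl⟩ := h₁
  obtain ⟨v₂, rfl⟩ := h₂
  refine (extDer_chart hq hd _ _).trans ?_
  refine (congrArg₂ (fun a b => fderiv ℝ (coordForm (ψ 0) η) (φ 0) a b -
    fderiv ℝ (coordForm (ψ 0) η) (φ 0) b a) (tderiv_mfderiv (hψd 0 h0) hq v₁)
    (tderiv_mfderiv (hψd 0 h0) hq v₂)).trans ?_
  exact key' v₁ v₂

/-- For a degenerate spray with integrable Berwald distribution the form `i_𝔽 (α / ρ)` is closed: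
its exterior derivative vanishes on the leaves and, by homogeneity, on the Liouville field. -/
theorem hasClosedAnnihilator_of_degenerate (hA : IsOpenCone A) (hS : IsSpray A S)
    (hflat : NonFlat A S) (hdeg : Degenerate A S)
    (hint : IntegrableDistribution 3 A (berwald S)) : HasClosedAnnihilator A S := by
  obtain ⟨ρ, α, hiso, hρ⟩ := hdeg
  obtain ⟨hη, hJ, hsymm⟩ := isAdapted_of_isotropyData hA hS hflat hiso fun p hp => (hρ p hp).1
  set η := insertEnd (almostComplex S) fun p => (ρ p)⁻¹ • α p with hηdef
  have hs : ∀ q : TM M, q ∈ (tchart q).source := fun q => mem_extChartAt_source q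
  have hcl : ∀ q ∈ A, extDer η q = 0 := by
    intro q hq
    have hd := hη.differentiableAt hA.isOpen (hs q) hq
    have hC : ∀ w : TTM q, extDer η q (liouville M q) w = 0 := by
      intro w
      rw [extDer_chart (hs q) hd, tderiv_liouville (hs q), hsymm q _ (mem_chartDom (hs q) hq),
        sub_self]
    have hC' : ∀ w : TTM q, extDer η q w (liouville M q) = 0 := by
      intro w
      rw [extDer_chart (hs q) hd, tderiv_liouville (hs q), hsymm q _ (mem_chartDom (hs q) hq),
        sub_self]
    have hdec : ∀ w : TTM q, w - η q w • liouville M q ∈ berwald S q := by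
      intro w
      rw [mem_berwald_iff hA.isOpen hS hflat hη hq, map_sub, map_smul, hη.liouville_eq_one q hq]
      simp
    refine LinearMap.ext₂ fun w₁ w₂ => ?_
    have h := extDer_eq_zero_of_integrable hA.isOpen hη.smooth hη.annihilates hint hq (hdec w₁)
      (hdec w₂)
    simpa [hC, hC'] using h
  refine ⟨η, ⟨hη.smooth, hcl⟩, hη.annihilates, hη.liouville_eq_one, fun p hp => ?_⟩
  exact (rank_dEnd_iff hA.isOpen hS hη (hs p) hp (hcl p hp)).2
    ((rank_omegaForm_iff hA.isOpen hS hη (hs p) hp (hcl p hp) hJ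
      (form_tangentStr_almostComplex hA.isOpen hS hη hp)).1 (hρ p hp).2)

/-- A level set of a function with nonzero derivative has a local parametrization. -/
theorem exists_levelSet_parametrization {f : Plane × Plane → ℝ} {O : Set (Plane × Plane)}
    (hO : IsOpen O) (hf : ∀ z ∈ O, ContDiffAt ℝ ∞ f z) {z₀ c : Plane × Plane} (hz₀ : z₀ ∈ O)
    (hc : fderiv ℝ f z₀ c = 1) :
    ∃ (W : Set (EuclideanSpace ℝ (Fin 3))) (φ : EuclideanSpace ℝ (Fin 3) → Plane × Plane),
      IsOpen W ∧ 0 ∈ W ∧ φ 0 = z₀ ∧ (∀ u ∈ W, ContDiffAt ℝ ∞ φ u) ∧ ∀ u ∈ W, φ u ∈ O ∧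
        Function.Injective (fderiv ℝ φ u) ∧ ∀ v, fderiv ℝ f (φ u) (fderiv ℝ φ u v) = 0 := by
  set L := fderiv ℝ f z₀ with hL
  -- The straightening map: the identity to first order at `z₀`, with `L (Θ z - z₀) = f z - f z₀`.
  set Θ : Plane × Plane → Plane × Plane := fun z => z + (f z - f z₀ - L (z - z₀)) • c with hΘ
  have hΘs : ∀ z ∈ O, ContDiffAt ℝ ∞ Θ z := fun z hz =>
    contDiffAt_id.add ((((hf z hz).sub contDiffAt_const).sub
      (L.contDiff.contDiffAt.comp z (contDiffAt_id.sub contDiffAt_const))).smul contDiffAt_const)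
  have hΘd : HasFDerivAt Θ ((ContinuousLinearEquiv.refl ℝ (Plane × Plane) :
      Plane × Plane →L[ℝ] Plane × Plane)) z₀ := by
    have h1 : HasFDerivAt Θ _ z₀ := (hasFDerivAt_id z₀).add
      (((((hf z₀ hz₀).differentiableAt (by simp)).hasFDerivAt.sub_const (f z₀)).sub
        (L.hasFDerivAt.comp z₀ ((hasFDerivAt_id z₀).sub_const z₀))).smul_const c)
    refine h1.congr_fderiv ?_
    refine ContinuousLinearMap.ext fun v => ?_
    simp [← hL]
  have hΘ0 : Θ z₀ = z₀ := by simp [hΘ]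
  have hLΘ : ∀ z, L (Θ z - z₀) = f z - f z₀ := by
    intro z
    have : Θ z - z₀ = (z - z₀) + (f z - f z₀ - L (z - z₀)) • c := by
      simp only [hΘ]
      abel
    rw [this, map_add, map_smul, hc, smul_eq_mul]
    ring
  set T := (hΘs z₀ hz₀).toOpenPartialHomeomorph Θ hΘd (by simp) with hT
  have hTcoe : ∀ z, T z = Θ z := fun z => rfl
  have hT0 : z₀ ∈ T.source := (hΘs z₀ hz₀).mem_toOpenPartialHomeomorph_source hΘd (by simp)
  -- Near `z₀` the derivative of `Θ` stays invertible.
  have hinv : ∀ᶠ z in 𝓝 z₀, fderiv ℝ Θ z ∈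
      range ((↑) : ((Plane × Plane) ≃L[ℝ] Plane × Plane) → Plane × Plane →L[ℝ] Plane × Plane) := by
    have hcont : ContinuousAt (fderiv ℝ Θ) z₀ := (contDiffAt_fderiv (hΘs z₀ hz₀)).continuousAt
    refine hcont.eventually ?_
    rw [hΘd.fderiv]
    exact ContinuousLinearEquiv.nhds _
  obtain ⟨N, hN, hNopen, hN0⟩ := mem_nhds_iff.1 (inter_mem hinv (hO.mem_nhds hz₀))
  have hker : Module.finrank ℝ (LinearMap.ker L.toLinearMap) = 3 := by
    have h1 := Module.Dual.finrank_ker_add_one_of_ne_zero (f := L.toLinearMap) (by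
      intro h0
      have : L c = 0 := DFunLike.congr_fun h0 c
      rw [this] at hc
      exact zero_ne_one hc)
    have h2 : Module.finrank ℝ (Plane × Plane) = 4 := by simp
    omega
  let ι : EuclideanSpace ℝ (Fin 3) ≃L[ℝ] LinearMap.ker L.toLinearMap :=
    ContinuousLinearEquiv.ofFinrankEq (by simp [hker])
  let i : EuclideanSpace ℝ (Fin 3) →L[ℝ] Plane × Plane :=
    (LinearMap.ker L.toLinearMap).subtypeL.comp (ι : EuclideanSpace ℝ (Fin 3) →L[ℝ] _)
  have hLi : ∀ u, L (i u) = 0 := fun u => (ι u).2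
  have hi : Function.Injective i := Subtype.val_injective.comp ι.injective
  let j : EuclideanSpace ℝ (Fin 3) → Plane × Plane := fun u => z₀ + i u
  have hj : ∀ u, HasFDerivAt j i u := fun u => i.hasFDerivAt.const_add z₀
  have hjs : ContDiff ℝ ∞ j := contDiff_const.add i.contDiff
  have hj0 : j 0 = z₀ := by simp [j]
  have hT0' : T.symm z₀ = z₀ := by
    have := T.left_inv hT0
    rwa [hTcoe, hΘ0] at this
  have hz₀t : z₀ ∈ T.target := by
    have := T.map_source hT0
    rwa [hTcoe, hΘ0] at this
  have hTN : IsOpen (T.target ∩ T.symm ⁻¹' N) := T.symm.isOpen_inter_preimage hNopen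
  have hφs : ∀ u ∈ j ⁻¹' (T.target ∩ T.symm ⁻¹' N),
      ContDiffAt ℝ ∞ (fun u => T.symm (j u)) u := by
    intro u hu
    obtain ⟨e, he⟩ := (hN hu.2).1
    have hO' := (hN hu.2).2
    have h1 : HasFDerivAt T (e : Plane × Plane →L[ℝ] Plane × Plane) (T.symm (j u)) := by
      rw [he]
      exact ((hΘs _ hO').differentiableAt (by simp)).hasFDerivAt
    exact (T.contDiffAt_symm hu.1 h1 (hΘs _ hO')).comp u hjs.contDiffAt
  have hWopen : IsOpen (j ⁻¹' (T.target ∩ T.symm ⁻¹' N)) := hTN.preimage hjs.continuous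
  refine ⟨j ⁻¹' (T.target ∩ T.symm ⁻¹' N), fun u => T.symm (j u), hWopen, ?_, ?_, hφs, ?_⟩
  · rw [mem_preimage, hj0]
    exact ⟨hz₀t, by rwa [mem_preimage, hT0']⟩
  · change T.symm (j 0) = z₀
    rw [hj0, hT0']
  · intro u hu
    have hO' := (hN hu.2).2
    have hφd := (hφs u hu).differentiableAt (by simp)
    refine ⟨hO', ?_, fun v => ?_⟩
    · have e : (Θ ∘ fun u => T.symm (j u)) =ᶠ[𝓝 u] j := by
        filter_upwards [hWopen.mem_nhds hu] with u hu
        exact T.right_inv hu.1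
      have h1 : fderiv ℝ (Θ ∘ fun u => T.symm (j u)) u = i := by rw [e.fderiv_eq, (hj u).fderiv]
      rw [fderiv_comp u ((hΘs _ hO').differentiableAt (by simp)) hφd] at h1
      have h2 : Function.Injective (fderiv ℝ Θ (T.symm (j u)) ∘
          fderiv ℝ (fun u => T.symm (j u)) u) := by
        have : (fderiv ℝ Θ (T.symm (j u)) ∘ fderiv ℝ (fun u => T.symm (j u)) u) = i := by
          rw [← h1]
          rfl
        rwa [this]
      exact h2.of_comp
    · have e : (f ∘ fun u => T.symm (j u)) =ᶠ[𝓝 u] fun _ => f z₀ := by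
        filter_upwards [hWopen.mem_nhds hu] with u hu
        have h1 := hLΘ (T.symm (j u))
        rw [← hTcoe, T.right_inv hu.1, show j u - z₀ = i u by simp [j], hLi] at h1
        exact (sub_eq_zero.1 h1.symm)
      have h1 := DFunLike.congr_fun (e.fderiv_eq (𝕜 := ℝ)) v
      rw [fderiv_comp u ((hf _ hO').differentiableAt (by simp)) hφd, fderiv_fun_const] at h1
      exact h1

/-- The Berwald distribution is the kernel of a closed form, hence integrable: the leaves are the
level sets of the local potentials. -/
theorem integrable_of_hasClosedAnnihilator (hA : IsOpenCone A) (hS : IsSpray A S)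
    (hflat : NonFlat A S) (h : HasClosedAnnihilator A S) :
    IntegrableDistribution 3 A (berwald S) := by
  obtain ⟨η, hcl, hann, hC, -⟩ := h
  have hη : IsAdapted A S η := ⟨hcl.1, hann, hC⟩
  intro p hp
  have hs : p ∈ (tchart p).source := mem_extChartAt_source p
  obtain ⟨U, hU, hpU, hUA, f, hf, hfη⟩ := exists_conic_potential hA hcl hp
  have hfs := fun z (hz : z ∈ chartDom p U) => contDiffAt_comp_chart (p₀ := p) hU.isOpen hf hz
  have hfd : ∀ q, q ∈ (tchart p).source → q ∈ U → ∀ w : TTM q,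
      fderiv ℝ (f ∘ (tchart p).symm) (tchart p q) (tderiv p q w) = η q w := by
    intro q hq hqU w
    rw [hfη q hqU, differential, mvfderiv_eq_chart hq
      ((hfs _ (mem_chartDom hq hqU)).differentiableAt (by simp))]
  obtain ⟨W, φ, hW, h0, hφ0, hφs, hφ⟩ := exists_levelSet_parametrization (isOpen_chartDom hU.isOpen)
    hfs (mem_chartDom hs hpU) (c := tderiv p p (liouville M p)) (by rw [hfd p hs hpU, hC p hp])
  have hψs : ∀ u ∈ W, ContMDiffAt (𝓡 3) (𝓡 2).tangent ∞ ((tchart p).symm ∘ φ) u := fun u hu =>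
    ContMDiffAt.comp u (contMDiffAt_chart_symm (hφ u hu).1.1) (hφs u hu).contMDiffAt
  refine ⟨W, (tchart p).symm ∘ φ, hW, h0, ?_, fun u hu => (hψs u hu).contMDiffWithinAt,
    fun u hu => ?_⟩
  · rw [Function.comp_apply, hφ0, (tchart p).left_inv hs]
  obtain ⟨hO, hinj, hker⟩ := hφ u hu
  have hsrc : ((tchart p).symm ∘ φ) u ∈ (tchart p).source := (tchart p).map_target hO.1
  have hqA : ((tchart p).symm ∘ φ) u ∈ A := hUA hO.2
  have hder : ∀ v, tderiv p _ (mfderiv (𝓡 3) (𝓡 2).tangent ((tchart p).symm ∘ φ) u v) =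
      fderiv ℝ φ u v := by
    intro v
    refine (tderiv_mfderiv ((hψs u hu).mdifferentiableAt (by simp)) hsrc v).trans ?_
    have e : tchart p ∘ (tchart p).symm ∘ φ =ᶠ[𝓝 u] φ := by
      filter_upwards [hW.mem_nhds hu] with u hu
      rw [Function.comp_apply, Function.comp_apply, (tchart p).right_inv (hφ u hu).1.1]
    rw [e.fderiv_eq]
  have hinj' : Function.Injective (mfderiv (𝓡 3) (𝓡 2).tangent ((tchart p).symm ∘ φ) u) := by
    intro v v' h
    apply hinj
    rw [← hder, ← hder, h]
  refine ⟨hqA, hinj', ?_⟩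
  have hfin : FiniteDimensional ℝ (TTM (((tchart p).symm ∘ φ) u)) :=
    inferInstanceAs (FiniteDimensional ℝ (Plane × Plane))
  have hle : LinearMap.range (mfderiv (𝓡 3) (𝓡 2).tangent ((tchart p).symm ∘ φ) u).toLinearMap ≤
      berwald S (((tchart p).symm ∘ φ) u) := by
    rintro _ ⟨v, rfl⟩
    rw [mem_berwald_iff hA.isOpen hS hflat hη hqA]
    simp only [ContinuousLinearMap.coe_coe]
    rw [← hfd _ hsrc hO.2, hder, Function.comp_apply, (tchart p).right_inv hO.1]
    exact hker v
  refine Submodule.eq_of_le_of_finrank_eq hle ?_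
  have hr := LinearMap.finrank_range_of_inj
    (f := (mfderiv (𝓡 3) (𝓡 2).tangent ((tchart p).symm ∘ φ) u).toLinearMap) hinj'
  have hb : berwald S (((tchart p).symm ∘ φ) u) =
      LinearMap.ker (η (((tchart p).symm ∘ φ) u)).toLinearMap := by
    ext w
    exact mem_berwald_iff hA.isOpen hS hflat hη hqA w
  have h1 := Module.Dual.finrank_ker_add_one_of_ne_zero
    (f := (η (((tchart p).symm ∘ φ) u)).toLinearMap) (by
      intro h0
      have h2 := hC _ hqA
      have h3 : η (((tchart p).symm ∘ φ) u) (liouville M _) = 0 := DFunLike.congr_fun h0 _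
      rw [h3] at h2
      exact zero_ne_one h2)
  rw [finrank_TTM] at h1
  rw [hr, hb]
  have h3 : Module.finrank ℝ (TangentSpace (𝓡 3) u) = 3 := by
    change Module.finrank ℝ (EuclideanSpace ℝ (Fin 3)) = 3
    simp
  omega

end Integrability

end

end SprayGeometry

theorem theorem2 {M : Type*} [TopologicalSpace M] [ChartedSpace (EuclideanSpace ℝ (Fin 2)) M]
    [IsManifold (𝓡 2) ∞ M] (A : Set (TM M)) (hA : IsOpenCone A)
    (S : VField (𝓡 2).tangent (N := TM M)) (hS : IsSpray A S) (hflat : NonFlat A S) :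
    [LocallyDegMetrizable A S,
      Degenerate A S ∧ IntegrableDistribution 3 A (berwald S),
      HasClosedAnnihilator A S].TFAE ∧
    (ClosedFormsExact (𝓡 2).tangent A →
      [DegMetrizableOn A S,
        Degenerate A S ∧ IntegrableDistribution 3 A (berwald S),
        HasClosedAnnihilator A S].TFAE) := by
  have h23 : Degenerate A S ∧ IntegrableDistribution 3 A (berwald S) → HasClosedAnnihilator A S :=
    fun h => hasClosedAnnihilator_of_degenerate hA hS hflat h.1 h.2
  have h32 : HasClosedAnnihilator A S → Degenerate A S ∧ IntegrableDistribution 3 A (berwald S) :=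
    fun h => ⟨degenerate_of_hasClosedAnnihilator hA.isOpen hS hflat h,
      integrable_of_hasClosedAnnihilator hA hS hflat h⟩
  have h13 : LocallyDegMetrizable A S → HasClosedAnnihilator A S :=
    hasClosedAnnihilator_of_locallyDegMetrizable hA.isOpen hS hflat
  refine ⟨?_, fun hex => ?_⟩
  · tfae_have 1 → 3 := h13
    tfae_have 3 → 1 := locallyDegMetrizable_of_hasClosedAnnihilator hA hS
    tfae_have 2 → 3 := h23
    tfae_have 3 → 2 := h32
    tfae_finish
  · tfae_have 1 → 3 := fun h => h13 fun p hp => ⟨A, hA, hp, Set.Subset.rfl, h⟩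
    tfae_have 3 → 1 := by
      rintro ⟨η, hcl, hann, hC, hrank⟩
      obtain ⟨f, hf, hfη⟩ := hex η hcl
      exact degMetrizable_of_potential hA hS ⟨hcl.1, hann, hC⟩ hcl.2 hrank hf hfη
    tfae_have 2 → 3 := h23
    tfae_have 3 → 2 := h32
    tfae_finish
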